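/- **Setting.** Let $\psi_k,\psi^*_k$ ($k\in\mathbb Z$) be the charged free fermions, $[\psi_k,\psi^*_l]_+=\delta_{kl}$, $[\psi_k,\psi_l]_+=[\psi^*_k,\psi^*_l]_+=0$, acting on the fermionic Fock space $\mathcal H$ over $\mathbb C$ with the shifted Dirac vacua $|n\rangle$, $\langle n|$ ($\psi_k|n\rangle=0$ for $k<n$, $\psi^*_k|n\rangle=0$ for $k\ge n$, $\psi_n|n\rangle=|n+1\rangle$, $\langle n|n\rangle=1$). Let $J_k=\sum_j\psi_j\psi^*_{j+k}$ ($k\ne0$), $J_+(\mathbf t_+)=\sum_{k\ge1}t_kJ_k$, $J_-(\mathbf t_-)=\sum_{k\ge1}t_{-k}J_{-k}$, $\xi(\mathbf t,z)=\sum_{k\ge1}t_kz^k$ (for $\mathbf t_-=(t_{-1},t_{-2},\dots)$: $\xi(\mathbf t_-,z)=\sum_{k\ge1}t_{-k}z^k$), and $\mathbf t\pm[z]=(t_1\pm z,\,t_2\pm\tfrac12z^2,\,t_3\pm\tfrac13z^3,\dots)$. A formal operator $G$ is given by arbitrary matrix elements $\langle S|G|T\rangle\in\mathbb C$ between basis states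 of $\mathcal H$. It is *group-like* if for all states $\langle U|,\langle U'|,|V\rangle,|V'\rangle$ (finite combinations of basis states) $$\sum_{k\in\mathbb Z}\langle U|\psi_kG|V\rangle\langle U'|\psi^*_kG|V'\rangle=\sum_{k\in\mathbb Z}\langle U|G\psi_k|V\rangle\langle U'|G\psi^*_k|V'\rangle$$ (both sums are finite). Fix $q\in\mathbb Z$ (the basic case is $q=0$; for $G$ of charge $q'$ only $q=q'$ is of interest) and put $$\tau_n(\mathbf t_+,\mathbf t_-)=\langle n|e^{J_+(\mathbf t_+)}Ge^{-J_-(\mathbf t_-)}|n-q\rangle,\qquad \tau_n(\mathbf t)=\langle n|e^{J_+(\mathbf t)}G|n-q\rangle ,$$ formal power series in the times. $\operatorname{res}_{z=\infty}$ and $\operatorname{res}_{z=0}$ denote the coefficient of $z^{-1}$ of the (formal) Laurent expansion in $z^{-1}$, respectively in $z$, whose coefficients are taken monomial by monomial in the times (both correspond to $\frac1{2\pi i}\oint dz$ over counterclockwise contours; there is no additional sign at $\infty$). All identities below are identities of formal power series in the times. **Statement.** Let $G$ be group-like and $q\in\mathbb Z$. Then: 1. (2DTL) For all $n,n'\in\mathbb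 Z$, $$\operatorname*{res}_{z=\infty}\Big[z^{n-n'}e^{\xi(\mathbf t_+-\mathbf t'_+,z)}\tau_n(\mathbf t_+-[z^{-1}],\mathbf t_-)\,\tau_{n'}(\mathbf t'_++[z^{-1}],\mathbf t'_-)\Big]$$ $$=\operatorname*{res}_{z=0}\Big[z^{n-n'}e^{\xi(\mathbf t_--\mathbf t'_-,z^{-1})}\tau_{n+1}(\mathbf t_+,\mathbf t_--[z])\,\tau_{n'-1}(\mathbf t'_+,\mathbf t'_-+[z])\Big].$$ 2. (MKP) For all $n\ge n'$ the left-hand side of 1 vanishes at $\mathbf t'_-=\mathbf t_-$, and $$\operatorname*{res}_{z=\infty}\Big[z^{n-n'}e^{\xi(\mathbf t-\mathbf t',z)}\tau_n(\mathbf t-[z^{-1}])\,\tau_{n'}(\mathbf t'+[z^{-1}])\Big]=0 .$$ 3. (KP) For all $n$, $\ \operatorname*{res}_{z=\infty}\big[e^{\xi(\mathbf t-\mathbf t',z)}\tau_n(\mathbf t-[z^{-1}])\,\tau_n(\mathbf t'+[z^{-1}])\big]=0$. 4. (Hirota equations) Write $P(D)f\cdot g=P(\partial_X)\big(f(\mathbf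 t+X)g(\mathbf t-X)\big)|_{X=0}$, let $h_j$ be defined by $e^{\xi(\mathbf t,z)}=\sum_{j\ge0}h_j(\mathbf t)z^j$, and $\tilde D=(D_1,\tfrac12D_2,\tfrac13D_3,\dots)$. For all $n$, identically in $\mathbf a=(a_1,a_2,\dots)$, $$\sum_{j\ge0}h_j(-2\mathbf a)\,h_{j+1}(\tilde D)\,e^{\sum_{l\ge1}a_lD_l}\,\tau_n(\mathbf t)\cdot\tau_n(\mathbf t)=0,$$ in particular $(D_1^4+3D_2^2-4D_1D_3)\,\tau_n\cdot\tau_n=0$; moreover $(D_1^2-D_2)\,\tau_{n+1}(\mathbf t)\cdot\tau_n(\mathbf t)=0$, and, for the series $\tau_n(\mathbf t_+,\mathbf t_-)$, $\ \tfrac12D_1D_{-1}\,\tau_n\cdot\tau_n+\tau_{n+1}\tau_{n-1}=0$. -/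

import Mathlib

namespace FreeFermion

noncomputable section

/-! ### The fermionic Fock space -/

/-- Maya diagrams: sets of integers which contain all sufficiently negative integers and no
sufficiently large ones. They index the basis states of all charges of the fermionic Fock space:
the state of `S` is the one in which exactly the modes `k ∈ S` are filled by the `ψ_k`, that is
`ψ_k |S⟩ = 0` iff `k ∈ S` and `ψ*_k |S⟩ = 0` iff `k ∉ S`. -/
def Maya : Type :=
  {S : Set ℤ // (∃ a, ∀ k < a, k ∈ S) ∧ ∃ b, ∀ k, b ≤ k → k ∉ S}

/-- The Maya diagram with the position `k` filled. -/
def Maya.insert (S : Maya) (k : ℤ) : Maya :=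
  ⟨{j | j = k ∨ j ∈ S.1}, by
    obtain ⟨⟨a, ha⟩, b, hb⟩ := S.2
    refine ⟨⟨a, fun j hj => Or.inr (ha j hj)⟩, max b (k + 1), fun j hj h => ?_⟩
    rcases h with h | h
    · omega
    · exact hb j (le_trans (le_max_left _ _) hj) h⟩

/-- The Maya diagram with the position `k` emptied. -/
def Maya.erase (S : Maya) (k : ℤ) : Maya :=
  ⟨{j | j ≠ k ∧ j ∈ S.1}, by
    obtain ⟨⟨a, ha⟩, b, hb⟩ := S.2
    refine ⟨⟨min a k, fun j hj => ⟨?_, ha j (lt_of_lt_of_le hj (min_le_left _ _))⟩⟩,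
      b, fun j hj h => hb j hj h.2⟩
    have := lt_of_lt_of_le hj (min_le_right _ _)
    omega⟩

/-- The Maya diagram `{k | k < n}` of the shifted Dirac vacuum of charge `n`. -/
def Maya.vac (n : ℤ) : Maya :=
  ⟨{k | k < n}, ⟨n, fun _ h => h⟩, n, fun _ h h' => absurd h' (not_lt.mpr h)⟩

/-- The sign `(-1)^m`, `m` being the number of elements of `S` above `k`. -/
def Maya.sgn (k : ℤ) (S : Maya) : ℂ := (-1) ^ {j | j ∈ S.1 ∧ k < j}.ncard

/-- The fermionic Fock space: finite linear combinations of the basis states. The same type is used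
for kets `|U⟩` and for bras `⟨U|`, the bra `⟨S|` being the element of the dual basis. -/
abbrev Fock : Type := Maya →₀ ℂ

/-- The shifted Dirac vacuum `|n⟩` (and `⟨n|`). -/
def vac (n : ℤ) : Fock := Finsupp.single (Maya.vac n) 1

open Classical in
/-- The fermionic operator `ψ_k` acting on kets. -/
def psi (k : ℤ) : Fock →ₗ[ℂ] Fock :=
  Finsupp.linearCombination ℂ fun S : Maya =>
    if k ∈ S.1 then (0 : Fock) else Finsupp.single (S.insert k) (S.sgn k)

open Classical in
/-- The fermionic operator `ψ*_k` acting on kets. -/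
def psiStar (k : ℤ) : Fock →ₗ[ℂ] Fock :=
  Finsupp.linearCombination ℂ fun S : Maya =>
    if k ∈ S.1 then Finsupp.single (S.erase k) (S.sgn k) else (0 : Fock)

/-- The pairing `⟨U|V⟩` of a bra and a ket. -/
def pairing (U V : Fock) : ℂ := U.sum fun S a => a * V S

/-- The right action of `ψ_k` on bras, `⟨U| ↦ ⟨U|ψ_k`. It is the transpose of `psi k`, see
`braPsi_pairing`. -/
def braPsi (k : ℤ) : Fock →ₗ[ℂ] Fock := psiStar k

/-- The right action of `ψ*_k` on bras, `⟨U| ↦ ⟨U|ψ*_k`. It is the transpose of `psiStar k`, see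
`braPsiStar_pairing`. -/
def braPsiStar (k : ℤ) : Fock →ₗ[ℂ] Fock := psi k

theorem Maya.erase_eq_iff {S T : Maya} {k : ℤ} :
    (k ∈ S.1 ∧ S.erase k = T) ↔ (k ∉ T.1 ∧ T.insert k = S) := by
  constructor
  · rintro ⟨h, rfl⟩
    refine ⟨fun h' => h'.1 rfl, Subtype.ext (Set.ext fun j => ?_)⟩
    change (j = k ∨ (j ≠ k ∧ j ∈ S.1)) ↔ j ∈ S.1
    by_cases hj : j = k
    · subst hj; simp [h]
    · simp [hj]
  · rintro ⟨h, rfl⟩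
    refine ⟨Or.inl rfl, Subtype.ext (Set.ext fun j => ?_)⟩
    change (j ≠ k ∧ (j = k ∨ j ∈ T.1)) ↔ j ∈ T.1
    by_cases hj : j = k
    · subst hj; simp [h]
    · simp [hj]

theorem Maya.sgn_insert (T : Maya) (k : ℤ) : (T.insert k).sgn k = T.sgn k := by
  unfold Maya.sgn
  congr 2
  ext j
  change ((j = k ∨ j ∈ T.1) ∧ k < j) ↔ (j ∈ T.1 ∧ k < j)
  constructor
  · rintro ⟨h | h, h'⟩
    · omega
    · exact ⟨h, h'⟩
  · rintro ⟨h, h'⟩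
    exact ⟨Or.inr h, h'⟩

theorem psiStar_apply_single (k : ℤ) (S T : Maya) :
    psiStar k (Finsupp.single S 1) T = psi k (Finsupp.single T 1) S := by
  classical
  have key := @Maya.erase_eq_iff S T k
  simp only [psi, psiStar, Finsupp.linearCombination_single, one_smul]
  by_cases h : k ∈ S.1 ∧ S.erase k = T
  · have h' := key.1 h
    rw [if_pos h.1, if_neg h'.1, h.2, h'.2, Finsupp.single_eq_same, Finsupp.single_eq_same,
      ← h'.2, Maya.sgn_insert]
  · have h' := fun h' => h (key.2 h')
    have e1 : (if k ∈ S.1 then Finsupp.single (S.erase k) (S.sgn k) else (0 : Fock)) T = 0 := by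
      split_ifs with hk
      · exact Finsupp.single_eq_of_ne' fun e => h ⟨hk, e⟩
      · rfl
    have e2 : (if k ∈ T.1 then (0 : Fock) else Finsupp.single (T.insert k) (T.sgn k)) S = 0 := by
      split_ifs with hk
      · rfl
      · exact Finsupp.single_eq_of_ne' fun e => h' ⟨hk, e⟩
    convert e1.trans e2.symm

/-- A right action given on basis states by the transposed matrix is the transpose. -/
theorem pairing_transpose {A B : Fock →ₗ[ℂ] Fock}
    (h : ∀ S T, B (Finsupp.single S 1) T = A (Finsupp.single T 1) S) (U V : Fock) :
    pairing (B U) V = pairing U (A V) := by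
  classical
  have hp : ∀ U V, pairing U V = Finsupp.linearCombination ℂ (fun S => V S) U := fun U V => by
    simp [pairing, Finsupp.linearCombination_apply]
  rw [hp, hp]
  induction U using Finsupp.induction_linear with
  | zero => simp
  | add U₁ U₂ h₁ h₂ => simp only [map_add, h₁, h₂]
  | single S a =>
    induction V using Finsupp.induction_linear with
    | zero => simp [Finsupp.linearCombination_apply]
    | add V₁ V₂ h₁ h₂ =>
      have hadd : ∀ (W V₁ V₂ : Fock), Finsupp.linearCombination ℂ (fun S => (V₁ + V₂) S) W =
          Finsupp.linearCombination ℂ (fun S => V₁ S) W +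
            Finsupp.linearCombination ℂ (fun S => V₂ S) W := fun W V₁ V₂ => by
        simp [Finsupp.linearCombination_apply, mul_add, Finsupp.sum_add]
      rw [map_add, hadd, hadd, h₁, h₂]
    | single T b =>
      have e1 : (Finsupp.single S a : Fock) = a • Finsupp.single S 1 := by simp
      have e2 : (Finsupp.single T b : Fock) = b • Finsupp.single T 1 := by simp
      have e3 : ∀ W : Fock, Finsupp.linearCombination ℂ
          (fun S => (Finsupp.single T b : Fock) S) W = W T * b := fun W => by
        rw [Finsupp.linearCombination_apply, Finsupp.sum_eq_single T]
        · simp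
        · intro X _ hX; simp [Finsupp.single_eq_of_ne hX]
        · simp
      rw [e3, e1, e2, map_smul, map_smul, Finsupp.linearCombination_apply,
        Finsupp.sum_single_index (by simp)]
      rw [map_smul]
      simp only [Finsupp.smul_apply, smul_eq_mul, h S T]
      ring

theorem braPsi_pairing (k : ℤ) (U V : Fock) :
    pairing (braPsi k U) V = pairing U (psi k V) :=
  pairing_transpose (fun S T => psiStar_apply_single k S T) U V

theorem braPsiStar_pairing (k : ℤ) (U V : Fock) :
    pairing (braPsiStar k U) V = pairing U (psiStar k V) :=
  pairing_transpose (fun S T => (psiStar_apply_single k T S).symm) U V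

/-- The currents `J_k = ∑_j ψ_j ψ*_{j+k}`, `k ≠ 0`, acting on kets. On every basis state the sum
has only finitely many non-zero terms. -/
def current (k : ℤ) : Fock →ₗ[ℂ] Fock :=
  Finsupp.linearCombination ℂ fun S : Maya =>
    ∑ᶠ j : ℤ, psi j (psiStar (j + k) (Finsupp.single S 1))

/-- The right action `⟨U| ↦ ⟨U|J_k`, `k ≠ 0`, of the currents on bras. -/
def braCurrent (k : ℤ) : Fock →ₗ[ℂ] Fock :=
  Finsupp.linearCombination ℂ fun S : Maya =>
    ∑ᶠ j : ℤ, braPsiStar (j + k) (braPsi j (Finsupp.single S 1))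

/-! ### Formal operators and the basic bilinear condition -/

/-- A formal operator on the Fock space (an element of the completed Clifford algebra), given by its
matrix elements `⟨S|G|T⟩` between basis states. -/
abbrev Operator : Type := Maya → Maya → ℂ

/-- The matrix element `⟨U|G|V⟩` between arbitrary states. -/
def Operator.elt (G : Operator) (U V : Fock) : ℂ :=
  U.sum fun S a => V.sum fun T b => a * G S T * b

/-- The basic bilinear condition `∑_k ψ_k G ⊗ ψ*_k G = ∑_k G ψ_k ⊗ G ψ*_k`, in terms of matrix
elements. For given states both sums have only finitely many non-zero terms. -/
def GroupLike (G : Operator) : Prop :=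
  ∀ U U' V V' : Fock,
    ∑ᶠ k : ℤ, G.elt (braPsi k U) V * G.elt (braPsiStar k U') V' =
      ∑ᶠ k : ℤ, G.elt U (psi k V) * G.elt U' (psiStar k V')

/-! ### Formal power series and tau-functions -/

/-- The formal linear form `∑_i c_i t_i`. -/
def linearForm {σ R : Type} [Ring R] (c : σ → R) : MvPowerSeries σ R :=
  fun d => if d.degree = 1 then d.sum fun i m => m • c i else 0

/-- The exponential `e^A = ∑_N A^N / N!` of a formal power series `A` without constant term, over a
possibly non-commutative ring: only the terms with `N ≤ |d|` contribute to the coefficient of the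
monomial `d`. -/
def expSeries {σ R : Type} [Ring R] [Algebra ℂ R] (A : MvPowerSeries σ R) : MvPowerSeries σ R :=
  fun d => ∑ N ∈ Finset.range (d.degree + 1),
    ((Nat.factorial N : ℂ)⁻¹) • MvPowerSeries.coeff d (A ^ N)

/-- `e^{J_+(t)}`, `J_+(t) = ∑_{k ≥ 1} t_k J_k`, acting on bras: a formal power series in the times
whose coefficients are operators. -/
def expJPlus : MvPowerSeries ℕ+ (Module.End ℂ Fock) :=
  expSeries (linearForm fun k : ℕ+ => braCurrent ((k : ℕ) : ℤ))

/-- `e^{-J_-(t)}`, `J_-(t) = ∑_{k ≥ 1} t_{-k} J_{-k}`, acting on kets. The variable with the index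
`k : ℕ+` is the time `t_{-k}`. -/
def expNegJMinus : MvPowerSeries ℕ+ (Module.End ℂ Fock) :=
  expSeries (-linearForm fun k : ℕ+ => current (-((k : ℕ) : ℤ)))

/-- The tau-function `τ_n(t) = ⟨n|e^{J_+(t)} G|n - q⟩` of the MKP hierarchy (of the KP hierarchy for
fixed `n`), as a formal power series in `t_1, t_2, …`. -/
def mkpTau (G : Operator) (q n : ℤ) : MvPowerSeries ℕ+ ℂ := fun d =>
  G.elt (MvPowerSeries.coeff d expJPlus (vac n)) (vac (n - q))

/-- The tau-function `τ_n(t_+, t_-) = ⟨n|e^{J_+(t_+)} G e^{-J_-(t_-)}|n - q⟩` of the 2DTL hierarchy,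
as a formal power series. The variable `Sum.inl k` is `t_k`, the variable `Sum.inr k` is
`t_{-k}`. -/
def todaTau (G : Operator) (q n : ℤ) : MvPowerSeries (ℕ+ ⊕ ℕ+) ℂ := fun d =>
  G.elt (MvPowerSeries.coeff (Finsupp.sumFinsuppEquivProdFinsupp d).1 expJPlus (vac n))
    (MvPowerSeries.coeff (Finsupp.sumFinsuppEquivProdFinsupp d).2 expNegJMinus (vac (n - q)))

/-! ### Formal residues

Power series in the times whose coefficients are Laurent series in `z⁻¹` (expansions at `z = ∞`) or
in `z` (expansions at `z = 0`). In both cases the formal variable of the Laurent series is called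
`u`; an extra variable `none` of a formal power series also stands for `u`. -/

/-- The times `t ± [u]`, with components `t_k ± u^k / k`. Here `ε = ± 1` and `t k` is the variable
for `t_k`. -/
def shift {σ : Type} (ε : ℂ) (t : ℕ+ → σ) (k : ℕ+) : MvPowerSeries (Option σ) ℂ :=
  MvPowerSeries.X (some (t k)) +
    MvPowerSeries.C (ε / ((k : ℕ) : ℂ)) * MvPowerSeries.X none ^ (k : ℕ)

/-- The times `t` without a shift. -/
def noShift {σ : Type} (t : ℕ+ → σ) (k : ℕ+) : MvPowerSeries (Option σ) ℂ :=
  MvPowerSeries.X (some (t k))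

/-- A power series in the times and `u` as a power series in the times whose coefficients are
Laurent series in `u`. -/
def toLaurent {σ : Type} (F : MvPowerSeries (Option σ) ℂ) : MvPowerSeries σ (LaurentSeries ℂ) :=
  fun d => HahnSeries.ofPowerSeries ℤ ℂ
    (PowerSeries.mk fun j => MvPowerSeries.coeff (d.optionElim j) F)

/-- Coefficientwise extraction of the coefficient of `u^m`. -/
def laurentCoeff {σ : Type} (m : ℤ) (F : MvPowerSeries σ (LaurentSeries ℂ)) : MvPowerSeries σ ℂ :=
  fun d => (MvPowerSeries.coeff d F).coeff m

/-- `z` in the Laurent series field `ℂ((z⁻¹))`, where `u = z⁻¹`. -/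
def zInfty : LaurentSeries ℂ := HahnSeries.single (-1) 1

/-- `z` in the Laurent series field `ℂ((z))`, where `u = z`. -/
def zZero : LaurentSeries ℂ := HahnSeries.single 1 1

/-- The coefficient of `z⁻¹` of an expansion at `z = ∞` (where `u = z⁻¹`). -/
def resInfty {σ : Type} (F : MvPowerSeries σ (LaurentSeries ℂ)) : MvPowerSeries σ ℂ :=
  laurentCoeff 1 F

/-- The coefficient of `z⁻¹` of an expansion at `z = 0` (where `u = z`). -/
def resZero {σ : Type} (F : MvPowerSeries σ (LaurentSeries ℂ)) : MvPowerSeries σ ℂ :=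
  laurentCoeff (-1) F

/-- The index set of the times `(t_+, t_-, t'_+, t'_-)`. -/
abbrev Times : Type := (ℕ+ ⊕ ℕ+) ⊕ (ℕ+ ⊕ ℕ+)

/-- The variables `t_k`. -/
def tPlus (k : ℕ+) : Times := Sum.inl (Sum.inl k)
/-- The variables `t_{-k}`. -/
def tMinus (k : ℕ+) : Times := Sum.inl (Sum.inr k)
/-- The variables `t'_k`. -/
def tPlus' (k : ℕ+) : Times := Sum.inr (Sum.inl k)
/-- The variables `t'_{-k}`. -/
def tMinus' (k : ℕ+) : Times := Sum.inr (Sum.inr k)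

/-- `ξ(t_+ - t'_+, c) = ∑_{k ≥ 1} (t_k - t'_k) c^k`. -/
def xiPlus (c : LaurentSeries ℂ) : MvPowerSeries Times (LaurentSeries ℂ) :=
  linearForm (Sum.elim (Sum.elim (fun k => c ^ (k : ℕ)) 0) (Sum.elim (fun k => -c ^ (k : ℕ)) 0))

/-- `ξ(t_- - t'_-, c) = ∑_{k ≥ 1} (t_{-k} - t'_{-k}) c^k`. -/
def xiMinus (c : LaurentSeries ℂ) : MvPowerSeries Times (LaurentSeries ℂ) :=
  linearForm (Sum.elim (Sum.elim 0 (fun k => c ^ (k : ℕ))) (Sum.elim 0 (fun k => -c ^ (k : ℕ))))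

/-- The coefficient of `z⁻¹` in the expansion at `z = ∞` of
`z^m e^{ξ(t_+ - t'_+, z)} f(t_+ - [z⁻¹], t_-) g(t'_+ + [z⁻¹], t'_-)`. -/
def todaInfty (m : ℤ) (f g : MvPowerSeries (ℕ+ ⊕ ℕ+) ℂ) : MvPowerSeries Times ℂ :=
  resInfty (MvPowerSeries.C (zInfty ^ m) * expSeries (xiPlus zInfty) *
    toLaurent (f.subst (Sum.elim (shift (-1) tPlus) (noShift tMinus)) *
      g.subst (Sum.elim (shift 1 tPlus') (noShift tMinus'))))

/-- The coefficient of `z⁻¹` in the expansion at `z = 0` of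
`z^m e^{ξ(t_- - t'_-, z⁻¹)} f(t_+, t_- - [z]) g(t'_+, t'_- + [z])`. -/
def todaZero (m : ℤ) (f g : MvPowerSeries (ℕ+ ⊕ ℕ+) ℂ) : MvPowerSeries Times ℂ :=
  resZero (MvPowerSeries.C (zZero ^ m) * expSeries (xiMinus zZero⁻¹) *
    toLaurent (f.subst (Sum.elim (noShift tPlus) (shift (-1) tMinus)) *
      g.subst (Sum.elim (noShift tPlus') (shift 1 tMinus'))))

/-- The specialization `t'_- = t_-`; the result is a power series in `t_+` (`Sum.inl (Sum.inl k)`),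
`t'_+` (`Sum.inl (Sum.inr k)`) and `t_-` (`Sum.inr k`). -/
def equateMinus (F : MvPowerSeries Times ℂ) : MvPowerSeries ((ℕ+ ⊕ ℕ+) ⊕ ℕ+) ℂ :=
  F.subst (Sum.elim
    (Sum.elim (fun k => (MvPowerSeries.X (Sum.inl (Sum.inl k)) :
        MvPowerSeries ((ℕ+ ⊕ ℕ+) ⊕ ℕ+) ℂ))
      (fun k => MvPowerSeries.X (Sum.inr k)))
    (Sum.elim (fun k => MvPowerSeries.X (Sum.inl (Sum.inr k)))
      (fun k => MvPowerSeries.X (Sum.inr k))))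

/-- The coefficient of `z⁻¹` in the expansion at `z = ∞` of
`z^m e^{ξ(t - t', z)} f(t - [z⁻¹]) g(t' + [z⁻¹])`; the variable `Sum.inl k` is `t_k` and the variable
`Sum.inr k` is `t'_k`. -/
def mkpInfty (m : ℤ) (f g : MvPowerSeries ℕ+ ℂ) : MvPowerSeries (ℕ+ ⊕ ℕ+) ℂ :=
  resInfty (MvPowerSeries.C (zInfty ^ m) *
    expSeries (linearForm
      (Sum.elim (fun k : ℕ+ => zInfty ^ (k : ℕ)) (fun k : ℕ+ => -zInfty ^ (k : ℕ)))) *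
    toLaurent (f.subst (shift (σ := ℕ+ ⊕ ℕ+) (-1) Sum.inl) *
      g.subst (shift (σ := ℕ+ ⊕ ℕ+) 1 Sum.inr)))

/-! ### Hirota equations -/

/-- `f(t + X) g(t - X)`; the variables `Sum.inl i` are the `t_i`, the variables `Sum.inr i` are the
`X_i`. -/
def hirotaProduct {σ : Type} (f g : MvPowerSeries σ ℂ) : MvPowerSeries (σ ⊕ σ) ℂ :=
  f.subst (fun i => (MvPowerSeries.X (Sum.inl i) + MvPowerSeries.X (Sum.inr i) :
      MvPowerSeries (σ ⊕ σ) ℂ)) *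
    g.subst (fun i => (MvPowerSeries.X (Sum.inl i) - MvPowerSeries.X (Sum.inr i) :
      MvPowerSeries (σ ⊕ σ) ℂ))

/-- The Hirota derivative `P(D) f · g = P(∂_X) (f(t + X) g(t - X))` at `X = 0`. The value at `X = 0`
of `∂_X^α F` is `α!` times the coefficient of `X^α` in `F`. -/
def hirota {σ : Type} (P : MvPolynomial σ ℂ) (f g : MvPowerSeries σ ℂ) : MvPowerSeries σ ℂ :=
  fun d => ∑ α ∈ P.support,
    P.coeff α * (α.prod fun _ m => (Nat.factorial m : ℂ)) *
      MvPowerSeries.coeff (Finsupp.sumFinsuppEquivProdFinsupp.symm (d, α)) (hirotaProduct f g)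

/-- The polynomials `h_j(t)`, defined by `e^{ξ(t,z)} = ∑_j h_j(t) z^j`, `ξ(t,z) = ∑_{k ≥ 1} t_k z^k`. -/
def hPoly (j : ℕ) : MvPolynomial ℕ+ ℂ :=
  PowerSeries.coeff j (expSeries (PowerSeries.mk fun k =>
    if h : 0 < k then (MvPolynomial.X ⟨k, h⟩ : MvPolynomial ℕ+ ℂ) else 0))

/-- The coefficient of `a^γ` in `∑_{j ≥ 0} h_j(-2a) h_{j+1}(D̃) e^{∑_l a_l D_l}`, a polynomial in the
symbols `D_1, D_2, …`; here `D̃ = (D_1, D_2/2, D_3/3, …)`. Only finitely many `j` contribute. -/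
def kpHirotaPoly (γ : ℕ+ →₀ ℕ) : MvPolynomial ℕ+ ℂ :=
  ∑ᶠ j : ℕ, MvPowerSeries.coeff γ
    (MvPolynomial.aeval
        (fun l : ℕ+ => (-2 : ℂ) • (MvPowerSeries.X l : MvPowerSeries ℕ+ (MvPolynomial ℕ+ ℂ)))
        (hPoly j) *
      MvPowerSeries.C (MvPolynomial.aeval
        (fun l : ℕ+ => ((l : ℕ) : ℂ)⁻¹ • (MvPolynomial.X l : MvPolynomial ℕ+ ℂ)) (hPoly (j + 1))) *
      expSeries (linearForm fun l : ℕ+ => (MvPolynomial.X l : MvPolynomial ℕ+ ℂ)))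

end

end FreeFermion

open FreeFermion

/-!
The bilinear identities all come from one operator on `Fock ⊗ Fock`. Group-likeness says that
`G ⊗ G` commutes with `Ω = ∑_K ψ_K ⊗ ψ*_K` (`GroupLike.form₂_exchange`). The matrix elements of
`(G ⊗ G) Ω = Ω (G ⊗ G)` between the bras `⟨n + 1| e^{J_+(t_+)}`, `⟨n' - 1| e^{J_+(t'_+)}` and the
kets `e^{-J_-(t_-)} |n - q⟩`, `e^{-J_-(t'_-)} |n' - q⟩` are the two sides of the identity of the
2DTL hierarchy, once the action of `Ω` on such states is known. This action is the boson–fermion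
correspondence `exchange_bosonAction₂`: `Ω` acts on states generated from vacua by currents as the
residue of a vertex operator. Two facts imply it. The commutators of the currents with `ψ_K` and
`ψ*_K` are again `ψ_{K±k}` and `ψ*_{K±k}`, so that a current passing through `Ω` shifts its index.
And `ψ_{m+j}|m⟩` and `ψ*_{m-1-j}|m⟩` satisfy Newton's recursion for the complete symmetric
functions of the currents (`psi_vac_recursion`, `psiStar_vac_recursion`), so that
`ψ_{m+j}|m⟩ = h_j(J_{-1}, J_{-2}/2, …)|m + 1⟩`, and similarly for `ψ*` with the opposite sign.

Instead of infinite series in the times, polynomials in the currents are used. A power series `f`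
is the same as the functional `P ↦ P(∂) f |_{t = 0}` on polynomials (`dualPairing`), and for a
tau-function this functional is `P ↦ ⟨n| P(J) G |n - q⟩`. Substitutions into `f` become, by
duality, maps of polynomials (`coeff_subst_eq_dualPairing`); the residue of
`z^m e^{ξ(t - t', z)} f(t - [z⁻¹]) g(t' + [z⁻¹])` becomes the finite sum `vertexSum`
(`coeff_laurentCoeff`). The bilinear identities are then identities of functionals,
`GroupLike.todaTau_bilinear` and `GroupLike.mkpTau_bilinear`. In the second one `Ω` annihilates the
kets; in the first one, at `t'_- = t_-`, the residue at `z = 0` is that of a power series in `z`.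

A Hirota derivative `P(D) f · g` is the functional of `f(t) g(t')` at `P(x - y)`, multiplied by the
divided powers of `x + y` which pick the coefficients in `t` (`coeff_hirota`). The Hirota equations
are therefore the bilinear identities evaluated at suitable polynomials. For the KP hierarchy these
are the products of divided powers of `x + y` and of `y - x`: the shift of the times leaves `x + y`
invariant and translates `y_k - x_k` by `-2 w^k`, which produces the factors `h_j(-2a)`
(`vertexSum_pairShift_divPow`).
-/

namespace FreeFermion

noncomputable section

open Finset.HasAntidiagonal
open scoped TensorProduct

/-! ### Canonical anticommutation relations -/

theorem Maya.finite_above (S : Maya) (k : ℤ) : {j | j ∈ S.1 ∧ k < j}.Finite := by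
  obtain ⟨b, hb⟩ := S.2.2
  refine (Set.finite_Ioo k b).subset fun j hj => ⟨hj.2, ?_⟩
  by_contra h
  exact hb j (not_lt.mp h) hj.1

theorem Maya.mem_insert {S : Maya} {k j : ℤ} : j ∈ (S.insert k).1 ↔ j = k ∨ j ∈ S.1 := Iff.rfl

theorem Maya.insert_erase {S : Maya} {k : ℤ} (h : k ∈ S.1) : (S.erase k).insert k = S :=
  (Maya.erase_eq_iff.1 ⟨h, rfl⟩).2

theorem Maya.erase_insert {S : Maya} {k : ℤ} (h : k ∉ S.1) : (S.insert k).erase k = S :=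
  (Maya.erase_eq_iff.2 ⟨h, rfl⟩).2

theorem Maya.insert_comm (S : Maya) (k l : ℤ) :
    (S.insert l).insert k = (S.insert k).insert l :=
  Subtype.ext (Set.ext fun _ => or_left_comm)

theorem Maya.erase_insert_comm (S : Maya) {k l : ℤ} (h : k ≠ l) :
    (S.erase l).insert k = (S.insert k).erase l := by
  refine Subtype.ext (Set.ext fun j => ?_)
  change (j = k ∨ (j ≠ l ∧ j ∈ S.1)) ↔ (j ≠ l ∧ (j = k ∨ j ∈ S.1))
  constructor
  · rintro (rfl | h')
    · exact ⟨h, Or.inl rfl⟩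
    · exact ⟨h'.1, Or.inr h'.2⟩
  · rintro ⟨h1, h2 | h2⟩
    · exact Or.inl h2
    · exact Or.inr ⟨h1, h2⟩

theorem Maya.sgn_insert_of_lt {S : Maya} {k l : ℤ} (hl : l ∉ S.1) (h : k < l) :
    (S.insert l).sgn k = -S.sgn k := by
  have : {j | j ∈ (S.insert l).1 ∧ k < j} = Insert.insert l {j | j ∈ S.1 ∧ k < j} := by
    ext j
    simp only [Set.mem_ofPred_eq, Set.mem_insert_iff, Maya.mem_insert]
    constructor
    · rintro ⟨h1 | h1, h2⟩
      · exact Or.inl h1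
      · exact Or.inr ⟨h1, h2⟩
    · rintro (rfl | h1)
      · exact ⟨Or.inl rfl, h⟩
      · exact ⟨Or.inr h1.1, h1.2⟩
  unfold Maya.sgn
  rw [this, Set.ncard_insert_of_notMem (fun h' => hl h'.1) (S.finite_above k), pow_succ]
  ring

theorem Maya.sgn_insert_of_ge {S : Maya} {k l : ℤ} (h : l ≤ k) :
    (S.insert l).sgn k = S.sgn k := by
  unfold Maya.sgn
  congr 2
  ext j
  simp only [Set.mem_ofPred_eq, Maya.mem_insert]
  constructor
  · rintro ⟨h1 | h1, h2⟩
    · omega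
    · exact ⟨h1, h2⟩
  · rintro ⟨h1, h2⟩
    exact ⟨Or.inr h1, h2⟩

theorem Maya.sgn_mul_self (S : Maya) (k : ℤ) : S.sgn k * S.sgn k = 1 := by
  unfold Maya.sgn
  rw [← mul_pow]
  simp

theorem Maya.sgn_erase_self {S : Maya} {k : ℤ} (h : k ∈ S.1) : (S.erase k).sgn k = S.sgn k := by
  rw [← Maya.sgn_insert, Maya.insert_erase h]

theorem psi_single_of_mem {k : ℤ} {S : Maya} (h : k ∈ S.1) (a : ℂ) :
    psi k (Finsupp.single S a) = 0 := by
  simp [psi, Finsupp.linearCombination_single, h]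

theorem psi_single_of_notMem {k : ℤ} {S : Maya} (h : k ∉ S.1) (a : ℂ) :
    psi k (Finsupp.single S a) = Finsupp.single (S.insert k) (a * S.sgn k) := by
  simp [psi, Finsupp.linearCombination_single, h]

theorem psiStar_single_of_mem {k : ℤ} {S : Maya} (h : k ∈ S.1) (a : ℂ) :
    psiStar k (Finsupp.single S a) = Finsupp.single (S.erase k) (a * S.sgn k) := by
  simp [psiStar, Finsupp.linearCombination_single, h]

theorem psiStar_single_of_notMem {k : ℤ} {S : Maya} (h : k ∉ S.1) (a : ℂ) :
    psiStar k (Finsupp.single S a) = 0 := by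
  simp [psiStar, Finsupp.linearCombination_single, h]

theorem psi_psi_of_lt {k l : ℤ} (h : k < l) (v : Fock) : psi k (psi l v) = -psi l (psi k v) := by
  induction v using Finsupp.induction_linear with
  | zero => simp
  | add u w hu hw => simp only [map_add, hu, hw, neg_add]
  | single S a =>
    by_cases hk : k ∈ S.1 <;> by_cases hl : l ∈ S.1
    · simp [psi_single_of_mem hk, psi_single_of_mem hl]
    · rw [psi_single_of_mem hk, psi_single_of_notMem hl, psi_single_of_mem (Or.inr hk)]
      simp
    · rw [psi_single_of_mem hl, psi_single_of_notMem hk, psi_single_of_mem (Or.inr hl)]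
      simp
    · rw [psi_single_of_notMem hl, psi_single_of_notMem hk,
        psi_single_of_notMem (k := k)
          (by rw [Maya.mem_insert]; rintro (h' | h'); omega; exact hk h'),
        psi_single_of_notMem (k := l)
          (by rw [Maya.mem_insert]; rintro (h' | h'); omega; exact hl h'),
        Maya.insert_comm, Maya.sgn_insert_of_lt hl h, Maya.sgn_insert_of_ge h.le,
        ← Finsupp.single_neg]
      congr 1
      ring

theorem psi_psi_self (k : ℤ) (v : Fock) : psi k (psi k v) = 0 := by
  induction v using Finsupp.induction_linear with
  | zero => simp
  | add u w hu hw => simp only [map_add, hu, hw, add_zero]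
  | single S a =>
    by_cases hk : k ∈ S.1
    · simp [psi_single_of_mem hk]
    · rw [psi_single_of_notMem hk, psi_single_of_mem (Or.inl rfl)]

theorem psi_psi (k l : ℤ) (v : Fock) : psi k (psi l v) = -psi l (psi k v) := by
  rcases lt_trichotomy k l with h | rfl | h
  · exact psi_psi_of_lt h v
  · simp [psi_psi_self]
  · rw [psi_psi_of_lt h, neg_neg]

theorem pairing_single_one (U : Fock) (T : Maya) : pairing U (Finsupp.single T 1) = U T := by
  classical
  rw [pairing, Finsupp.sum_eq_single T]
  · simp
  · intro S _ hS
    simp [Finsupp.single_eq_of_ne hS]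
  · simp

theorem pairing_neg (U V : Fock) : pairing U (-V) = -pairing U V := by
  simp [pairing, Finsupp.sum]

theorem neg_pairing (U V : Fock) : pairing (-U) V = -pairing U V := by
  simp [pairing, Finsupp.sum]

/-- The relation for the `ψ*` is the transpose of the relation for the `ψ`. -/
theorem psiStar_psiStar (k l : ℤ) (v : Fock) :
    psiStar k (psiStar l v) = -psiStar l (psiStar k v) := by
  ext T
  rw [← pairing_single_one, ← pairing_single_one (-_), neg_pairing]
  have h := fun i U V => braPsi_pairing i U V
  simp only [braPsi] at h
  rw [h, h, h, h, psi_psi, pairing_neg]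

theorem psi_psiStar (k l : ℤ) (v : Fock) :
    psi k (psiStar l v) = (if k = l then v else 0) - psiStar l (psi k v) := by
  induction v using Finsupp.induction_linear with
  | zero => simp
  | add u w hu hw =>
    simp only [map_add, hu, hw]
    split_ifs <;> abel
  | single S a =>
    by_cases hkl : k = l
    · subst hkl
      rw [if_pos rfl]
      by_cases hk : k ∈ S.1
      · rw [psi_single_of_mem hk, psiStar_single_of_mem hk,
          psi_single_of_notMem (S := S.erase k) (fun h => h.1 rfl), Maya.insert_erase hk,
          Maya.sgn_erase_self hk, mul_assoc, Maya.sgn_mul_self]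
        simp
      · rw [psiStar_single_of_notMem hk, psi_single_of_notMem hk,
          psiStar_single_of_mem (Or.inl rfl), Maya.erase_insert hk, Maya.sgn_insert,
          mul_assoc, Maya.sgn_mul_self]
        simp
    · rw [if_neg hkl, zero_sub]
      by_cases hk : k ∈ S.1 <;> by_cases hl : l ∈ S.1
      · rw [psi_single_of_mem hk, psiStar_single_of_mem hl,
          psi_single_of_mem (S := S.erase l) ⟨hkl, hk⟩]
        simp
      · rw [psi_single_of_mem hk, psiStar_single_of_notMem hl]
        simp
      · rw [psiStar_single_of_mem hl, psi_single_of_notMem hk,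
          psi_single_of_notMem (S := S.erase l) fun h => hk h.2,
          psiStar_single_of_mem (Or.inr hl), Maya.erase_insert_comm S hkl, ← Finsupp.single_neg]
        congr 1
        have key : S.sgn l * (S.erase l).sgn k = -(S.sgn k * (S.insert k).sgn l) := by
          rcases lt_or_gt_of_ne hkl with h | h
          · have h1 : S.sgn k = -(S.erase l).sgn k := by
              conv_lhs => rw [← Maya.insert_erase hl]
              exact Maya.sgn_insert_of_lt (fun h => h.1 rfl) h
            rw [Maya.sgn_insert_of_ge h.le, h1]
            ring
          · have h1 : S.sgn k = (S.erase l).sgn k := by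
              conv_lhs => rw [← Maya.insert_erase hl]
              exact Maya.sgn_insert_of_ge h.le
            rw [Maya.sgn_insert_of_lt hk h, h1]
            ring
        rw [mul_assoc, key]
        ring
      · rw [psiStar_single_of_notMem hl, psi_single_of_notMem hk,
          psiStar_single_of_notMem
            (by rw [Maya.mem_insert]; rintro (h | h); exact hkl h.symm; exact hl h)]
        simp

theorem exists_psiStar_eq_zero (v : Fock) : ∃ b : ℤ, ∀ k, b ≤ k → psiStar k v = 0 := by
  induction v using Finsupp.induction_linear with
  | zero => exact ⟨0, by simp⟩
  | add u w hu hw =>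
    obtain ⟨a, ha⟩ := hu
    obtain ⟨b, hb⟩ := hw
    exact ⟨max a b, fun k hk => by
      rw [map_add, ha k ((le_max_left _ _).trans hk), hb k ((le_max_right _ _).trans hk), add_zero]⟩
  | single S a =>
    obtain ⟨b, hb⟩ := S.2.2
    exact ⟨b, fun k hk => psiStar_single_of_notMem (hb k hk) a⟩

theorem exists_psi_eq_zero (v : Fock) : ∃ a : ℤ, ∀ k, k < a → psi k v = 0 := by
  induction v using Finsupp.induction_linear with
  | zero => exact ⟨0, by simp⟩
  | add u w hu hw =>
    obtain ⟨a, ha⟩ := hu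
    obtain ⟨b, hb⟩ := hw
    exact ⟨min a b, fun k hk => by
      rw [map_add, ha k (hk.trans_le (min_le_left _ _)), hb k (hk.trans_le (min_le_right _ _)),
        add_zero]⟩
  | single S a =>
    obtain ⟨b, hb⟩ := S.2.1
    exact ⟨b, fun k hk => psi_single_of_mem (hb k hk) a⟩

theorem psi_vac_of_lt {k n : ℤ} (h : k < n) : psi k (vac n) = 0 :=
  psi_single_of_mem (S := Maya.vac n) h 1

theorem psiStar_vac_of_le {k n : ℤ} (h : n ≤ k) : psiStar k (vac n) = 0 :=
  psiStar_single_of_notMem (S := Maya.vac n) (not_lt.mpr h) 1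

theorem psi_vac_self (n : ℤ) : psi n (vac n) = vac (n + 1) := by
  have h1 : (Maya.vac n).insert n = Maya.vac (n + 1) := by
    refine Subtype.ext (Set.ext fun j => ?_)
    change (j = n ∨ j < n) ↔ j < n + 1
    omega
  have h2 : (Maya.vac n).sgn n = 1 := by
    have : {j | j ∈ (Maya.vac n).1 ∧ n < j} = ∅ := by
      refine Set.eq_empty_of_forall_notMem fun j hj => ?_
      have h : j < n := hj.1
      exact lt_asymm h hj.2
    rw [Maya.sgn, this, Set.ncard_empty, pow_zero]
  rw [vac, psi_single_of_notMem (S := Maya.vac n) (lt_irrefl n), h1, h2, mul_one, vac]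

theorem psiStar_vac_self (n : ℤ) : psiStar n (vac (n + 1)) = vac n := by
  have h := psi_psiStar n n (vac n)
  rw [if_pos rfl, psi_vac_self, psiStar_vac_of_le le_rfl, map_zero] at h
  exact (sub_eq_zero.1 h.symm).symm

/-! ### The currents -/

theorem finite_current_support {k : ℤ} (hk : k ≠ 0) (v : Fock) :
    (Function.support fun j => psi j (psiStar (j - k) v)).Finite := by
  obtain ⟨b, hb⟩ := exists_psiStar_eq_zero v
  obtain ⟨a, ha⟩ := exists_psi_eq_zero v
  refine (Set.finite_Ico a (b + k)).subset fun j hj => ⟨?_, ?_⟩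
  · by_contra h
    apply hj
    dsimp only
    rw [psi_psiStar, if_neg (by omega), ha j (by omega), map_zero, sub_zero]
  · by_contra h
    apply hj
    dsimp only
    rw [hb (j - k) (by omega), map_zero]

theorem current_neg_apply {k : ℤ} (hk : k ≠ 0) (v : Fock) :
    current (-k) v = ∑ᶠ j : ℤ, psi j (psiStar (j - k) v) := by
  induction v using Finsupp.induction_linear with
  | zero => simp
  | add u w hu hw =>
    simp only [map_add, hu, hw]
    exact (finsum_add_distrib (finite_current_support hk u) (finite_current_support hk w)).symm
  | single S a =>
    have e : (Finsupp.single S a : Fock) = a • Finsupp.single S 1 := by simp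
    rw [e]
    simp only [map_smul]
    rw [← smul_finsum' a (finite_current_support hk _)]
    simp [current, sub_eq_add_neg]

/-- On bras, written in the dual basis, `J_k` acts by its transpose `J_{-k}`. -/
theorem braCurrent_eq (k : ℤ) : braCurrent k = current (-k) := by
  rw [braCurrent, current]
  congr 1
  funext S
  refine Eq.trans (finsum_congr fun j => ?_) (finsum_comp_equiv (Equiv.addRight k))
  simp [braPsiStar, braPsi]

theorem current_psi {k : ℤ} (hk : k ≠ 0) (i : ℤ) (v : Fock) :
    current (-k) (psi i v) = psi i (current (-k) v) + psi (i + k) v := by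
  have h : ∀ j, psi j (psiStar (j - k) (psi i v)) =
      psi i (psi j (psiStar (j - k) v)) + if j = i + k then psi (i + k) v else 0 := by
    intro j
    have h1 := psi_psiStar i (j - k) v
    have h2 : psiStar (j - k) (psi i v) =
        (if i = j - k then v else 0) - psi i (psiStar (j - k) v) := by rw [h1]; abel
    rw [h2, map_sub, psi_psi j i, sub_neg_eq_add, add_comm]
    by_cases hj : j = i + k
    · rw [if_pos (by omega), if_pos hj, hj]
    · rw [if_neg (by omega), if_neg hj, map_zero]
  rw [current_neg_apply hk, current_neg_apply hk, map_finsum _ (finite_current_support hk v)]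
  simp only [h]
  rw [finsum_add_distrib ((finite_current_support hk v).subset fun j hj hj' => hj ?_)
    ((Set.finite_singleton (i + k)).subset fun j hj => ?_),
    finsum_eq_single _ (i + k) (fun j hj => if_neg hj), if_pos rfl]
  · dsimp only at hj' ⊢
    rw [hj', map_zero]
  · by_contra h'
    exact hj (if_neg h')

theorem current_psiStar {k : ℤ} (hk : k ≠ 0) (i : ℤ) (v : Fock) :
    current (-k) (psiStar i v) = psiStar i (current (-k) v) - psiStar (i - k) v := by
  have h : ∀ j, psi j (psiStar (j - k) (psiStar i v)) =
      psiStar i (psi j (psiStar (j - k) v)) + if j = i then -psiStar (i - k) v else 0 := by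
    intro j
    rw [psiStar_psiStar (j - k) i, map_neg, psi_psiStar j i, neg_sub, sub_eq_add_neg]
    by_cases hj : j = i
    · rw [if_pos hj, if_pos hj, hj]
    · rw [if_neg hj, if_neg hj, neg_zero]
  rw [current_neg_apply hk, current_neg_apply hk, map_finsum _ (finite_current_support hk v)]
  simp only [h]
  have hf : (Function.support fun j => psiStar i (psi j (psiStar (j - k) v))).Finite :=
    (finite_current_support hk v).subset fun j hj hj' => hj (by
      dsimp only at hj' ⊢
      rw [hj', map_zero])
  have hg : (Function.support fun j => if j = i then -psiStar (i - k) v else 0).Finite :=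
    (Set.finite_singleton i).subset fun j hj => by
      by_contra h'
      exact hj (if_neg h')
  rw [finsum_add_distrib hf hg, finsum_eq_single _ i (fun j hj => if_neg hj), if_pos rfl,
    ← sub_eq_add_neg]

theorem current_comm {k l : ℤ} (hk : 0 < k) (hl : 0 < l) (v : Fock) :
    current (-k) (current (-l) v) = current (-l) (current (-k) v) := by
  have h : ∀ j, current (-k) (psi j (psiStar (j - l) v)) =
      psi j (psiStar (j - l) (current (-k) v)) +
        (psi (j + k) (psiStar (j + k - (k + l)) v) - psi j (psiStar (j - (k + l)) v)) := by
    intro j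
    rw [current_psi hk.ne', current_psiStar hk.ne', map_sub,
      show j + k - (k + l) = j - l by ring, show j - l - k = j - (k + l) by ring]
    abel
  have hkl : k + l ≠ 0 := by omega
  have hfin := finite_current_support hkl v
  have hfin' : (Function.support fun j => psi (j + k) (psiStar (j + k - (k + l)) v)).Finite :=
    hfin.preimage (f := fun j => j + k) (add_left_injective k).injOn
  rw [current_neg_apply hl.ne' v, map_finsum _ (finite_current_support hl.ne' v)]
  simp only [h]
  rw [finsum_add_distrib (finite_current_support hl.ne' _)
    ((hfin'.union hfin).subset fun j hj => ?_), finsum_sub_distrib hfin' hfin,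
    ← current_neg_apply hl.ne',
    show ∑ᶠ j, psi (j + k) (psiStar (j + k - (k + l)) v) = ∑ᶠ j, psi j (psiStar (j - (k + l)) v)
      from finsum_comp_equiv (Equiv.addRight k) (f := fun j => psi j (psiStar (j - (k + l)) v)),
    sub_self, add_zero]
  by_contra h'
  simp only [Set.mem_union, Function.mem_support, not_or, not_not] at h'
  exact hj (by simp only [h'.1, h'.2, sub_zero])

/-! ### Recursions for the neighbours of the vacuum -/

/-- A sum of anticommuting products which is invariant under the exchange of the factors. -/
theorem sum_antisymm_eq_zero {M : Type*} [AddCommGroup M] (p r : ℤ) (f : ℤ → M)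
    (h : ∀ K, f K = -f (p + r - K)) (h0 : ∀ K, K = p + r - K → f K = 0) :
    ∑ K ∈ Finset.Icc p r, f K = 0 := by
  refine Finset.sum_involution (fun K _ => p + r - K) ?_ ?_ ?_ ?_
  · intro K _
    rw [h K]
    simp
  · intro K _ hK h'
    exact hK (h0 K h'.symm)
  · intro K hK
    rw [Finset.mem_Icc] at hK ⊢
    omega
  · intro K _
    simp

theorem sum_psi_current_vac (m j : ℤ) :
    ∑ K ∈ Finset.Icc 1 j, psi (m + j - K) (current (-K) (vac m)) = 0 := by
  have hcur : ∀ K ∈ Finset.Icc 1 j, psi (m + j - K) (current (-K) (vac m)) =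
      ∑ l ∈ Finset.Ico (m - j) m, psi (m + j - K) (psi (l + K) (psiStar l (vac m))) := by
    intro K hK
    rw [Finset.mem_Icc] at hK
    rw [current_neg_apply (by omega), ← map_sum,
      ← finsum_comp_equiv (Equiv.addRight K)]
    congr 1
    simp only [Equiv.coe_addRight, add_sub_cancel_right]
    refine finsum_eq_sum_of_support_subset _ fun l hl => ?_
    rw [Finset.coe_Ico]
    refine ⟨?_, ?_⟩
    · by_contra h
      apply hl
      dsimp only
      rw [psi_psiStar, if_neg (by omega), psi_vac_of_lt (by omega), map_zero, sub_zero]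
    · by_contra h
      apply hl
      dsimp only
      rw [psiStar_vac_of_le (by omega), map_zero]
  rw [Finset.sum_congr rfl hcur, Finset.sum_comm]
  refine Finset.sum_eq_zero fun l hl => ?_
  rw [Finset.mem_Ico] at hl
  rw [← Finset.sum_subset (s₁ := Finset.Icc (m - l) j)]
  · refine sum_antisymm_eq_zero _ _ _ (fun K => ?_) fun K hK => ?_
    · rw [psi_psi, show m + j - (m - l + j - K) = l + K by ring,
        show l + (m - l + j - K) = m + j - K by ring]
    · rw [show m + j - K = l + K by omega, psi_psi_self]
  · exact Finset.Icc_subset_Icc_left (by omega)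
  · intro K hK hK'
    rw [Finset.mem_Icc] at hK hK'
    rw [psi_psiStar (l + K), if_neg (by omega), psi_vac_of_lt (by omega), map_zero, sub_zero,
      map_zero]

theorem sum_psiStar_current_vac (m j : ℤ) :
    ∑ K ∈ Finset.Icc 1 j, psiStar (m - 1 - j + K) (current (-K) (vac m)) = 0 := by
  have hcur : ∀ K ∈ Finset.Icc 1 j, psiStar (m - 1 - j + K) (current (-K) (vac m)) =
      -∑ i ∈ Finset.Ico m (m + j),
        psiStar (m - 1 - j + K) (psiStar (i - K) (psi i (vac m))) := by
    intro K hK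
    rw [Finset.mem_Icc] at hK
    rw [current_neg_apply (by omega), ← map_sum, ← map_neg, ← Finset.sum_neg_distrib]
    congr 1
    rw [finsum_eq_sum_of_support_subset (s := Finset.Ico m (m + j))]
    · refine Finset.sum_congr rfl fun i _ => ?_
      rw [psi_psiStar, if_neg (by omega), zero_sub]
    · intro i hi
      rw [Finset.coe_Ico]
      refine ⟨?_, ?_⟩
      · by_contra h
        apply hi
        dsimp only
        rw [psi_psiStar, if_neg (by omega), psi_vac_of_lt (by omega), map_zero, sub_zero]
      · by_contra h
        apply hi
        dsimp only
        rw [psiStar_vac_of_le (by omega), map_zero]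
  rw [Finset.sum_congr rfl hcur, Finset.sum_neg_distrib, Finset.sum_comm, neg_eq_zero]
  refine Finset.sum_eq_zero fun i hi => ?_
  rw [Finset.mem_Ico] at hi
  rw [← Finset.sum_subset (s₁ := Finset.Icc (i - m + 1) j)]
  · refine sum_antisymm_eq_zero _ _ _ (fun K => ?_) fun K hK => ?_
    · rw [psiStar_psiStar, show m - 1 - j + (i - m + 1 + j - K) = i - K by ring,
        show i - (i - m + 1 + j - K) = m - 1 - j + K by ring]
    · rw [show m - 1 - j + K = i - K by omega]
      exact self_eq_neg.1 (psiStar_psiStar _ _ _)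
  · exact Finset.Icc_subset_Icc_left (by omega)
  · intro K hK hK'
    rw [Finset.mem_Icc] at hK hK'
    have h := psi_psiStar i (i - K) (vac m)
    rw [psiStar_vac_of_le (by omega), map_zero, if_neg (by omega), zero_sub, eq_comm,
      neg_eq_zero] at h
    rw [h, map_zero]

/-- Newton's recursion for the states `ψ_{m+j}|m⟩`, as satisfied by the complete symmetric
functions. -/
theorem psi_vac_recursion (m : ℤ) (j : ℕ) :
    (j : ℂ) • psi (m + j) (vac m) =
      ∑ K ∈ Finset.Icc 1 (j : ℤ), current (-K) (psi (m + j - K) (vac m)) := by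
  have h : ∀ K ∈ Finset.Icc 1 (j : ℤ), current (-K) (psi (m + j - K) (vac m)) =
      psi (m + j - K) (current (-K) (vac m)) + psi (m + j) (vac m) := by
    intro K hK
    rw [Finset.mem_Icc] at hK
    rw [current_psi (by omega), sub_add_cancel]
  rw [Finset.sum_congr rfl h, Finset.sum_add_distrib, sum_psi_current_vac, zero_add,
    Finset.sum_const, Int.card_Icc, ← Nat.cast_smul_eq_nsmul ℂ]
  simp

/-- Newton's recursion for the states `ψ*_{m-1-j}|m⟩`, as satisfied, up to sign, by the elementary
symmetric functions. -/
theorem psiStar_vac_recursion (m : ℤ) (j : ℕ) :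
    (j : ℂ) • psiStar (m - 1 - j) (vac m) =
      -∑ K ∈ Finset.Icc 1 (j : ℤ), current (-K) (psiStar (m - 1 - j + K) (vac m)) := by
  have h : ∀ K ∈ Finset.Icc 1 (j : ℤ), current (-K) (psiStar (m - 1 - j + K) (vac m)) =
      psiStar (m - 1 - j + K) (current (-K) (vac m)) - psiStar (m - 1 - j) (vac m) := by
    intro K hK
    rw [Finset.mem_Icc] at hK
    rw [current_psiStar (by omega), add_sub_cancel_right]
  rw [Finset.sum_congr rfl h, Finset.sum_sub_distrib, sum_psiStar_current_vac, zero_sub, neg_neg,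
    Finset.sum_const, Int.card_Icc, ← Nat.cast_smul_eq_nsmul ℂ]
  simp

/-! ### Divided powers and exponential series -/

section DividedPowers

variable {σ : Type}

theorem finsupp_single_induction {P : (σ →₀ ℕ) → Prop} (h0 : P 0)
    (hs : ∀ d i, P d → P (d + Finsupp.single i 1)) (d : σ →₀ ℕ) : P d := by
  classical
  induction d using Finsupp.induction with
  | zero => exact h0
  | single_add i n f _ _ hf =>
    clear * - hf hs
    induction n with
    | zero => simpa using hf
    | succ n ih =>
      rw [Finsupp.single_add, add_right_comm]
      exact hs _ _ ih

theorem sum_antidiagonal_fst_smul [DecidableEq σ] {M : Type*} [AddCommMonoid M] (d : σ →₀ ℕ)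
    (i : σ) (F : (σ →₀ ℕ) → (σ →₀ ℕ) → M) :
    ∑ p ∈ antidiagonal (d + Finsupp.single i 1 : σ →₀ ℕ), p.1 i • F p.1 p.2 =
      ∑ p ∈ antidiagonal d,
        (p.1 i + 1) • F (p.1 + Finsupp.single i 1) p.2 := by
  symm
  refine Finset.sum_of_injOn (fun p => (p.1 + Finsupp.single i 1, p.2)) ?_ ?_ ?_ ?_
  · rintro ⟨a, b⟩ _ ⟨a', b'⟩ _ h
    simp only [Prod.mk.injEq, add_left_inj] at h
    exact Prod.ext h.1 h.2
  · rintro ⟨a, b⟩ h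
    simp only [Finset.mem_coe, mem_antidiagonal] at h ⊢
    rw [← h]
    abel
  · rintro ⟨a, b⟩ h h'
    rw [mem_antidiagonal] at h
    by_cases ha : a i = 0
    · simp [ha]
    · refine absurd ⟨(a - Finsupp.single i 1, b), ?_, ?_⟩ h'
      · have hle : Finsupp.single i 1 ≤ a := by
          rw [Finsupp.single_le_iff]
          omega
        rw [Finset.mem_coe, mem_antidiagonal]
        dsimp only at h ⊢
        apply add_right_cancel (b := Finsupp.single i 1)
        rw [← h, add_right_comm, tsub_add_cancel_of_le hle]
      · have hle : Finsupp.single i 1 ≤ a := by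
          rw [Finsupp.single_le_iff]
          omega
        simp [tsub_add_cancel_of_le hle]
  · rintro ⟨a, b⟩ _
    simp

/-- The product rule, in terms of the coefficients of power series. -/
theorem sum_antidiagonal_add_single [DecidableEq σ] {M : Type*} [AddCommMonoid M] (d : σ →₀ ℕ)
    (i : σ) (F : (σ →₀ ℕ) → (σ →₀ ℕ) → M) :
    (d i + 1) • ∑ p ∈ antidiagonal (d + Finsupp.single i 1 : σ →₀ ℕ), F p.1 p.2 =
      ∑ p ∈ antidiagonal d, ((p.1 i + 1) • F (p.1 + Finsupp.single i 1) p.2 +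
        (p.2 i + 1) • F p.1 (p.2 + Finsupp.single i 1)) := by
  have h : ∀ p ∈ antidiagonal (d + Finsupp.single i 1 : σ →₀ ℕ),
      (d i + 1) • F p.1 p.2 = p.1 i • F p.1 p.2 + p.2 i • F p.1 p.2 := by
    intro p hp
    rw [mem_antidiagonal] at hp
    rw [← add_smul]
    congr 1
    have := DFunLike.congr_fun hp i
    simpa using this.symm
  rw [Finset.smul_sum, Finset.sum_congr rfl h, Finset.sum_add_distrib, Finset.sum_add_distrib,
    sum_antidiagonal_fst_smul, Finsupp.sum_antidiagonal_swap _ fun a b => b i • F a b,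
    Finsupp.sum_antidiagonal_swap d fun a b => (b i + 1) • F a (b + Finsupp.single i 1),
    sum_antidiagonal_fst_smul d i fun a b => F b a]

/-- The multi-index factorial `b! = ∏ b_i!`. -/
def multiFactorial (b : σ →₀ ℕ) : ℂ := b.prod fun _ m => (Nat.factorial m : ℂ)

theorem multiFactorial_ne_zero (b : σ →₀ ℕ) : multiFactorial b ≠ 0 :=
  Finset.prod_ne_zero_iff.2 fun i _ => Nat.cast_ne_zero.2 (Nat.factorial_ne_zero (b i))

theorem multiFactorial_zero : multiFactorial (0 : σ →₀ ℕ) = 1 := Finsupp.prod_zero_index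

/-- Monomials in commuting quantities, one factor added. -/
theorem prod_add_single {R : Type*} [CommMonoid R] (c : σ → ℕ → R)
    (hc : ∀ i, c i 0 = 1) (d : σ →₀ ℕ) (i : σ) (x : R)
    (hx : c i (d i + 1) = x * c i (d i)) :
    (d + Finsupp.single i 1).prod c = x * d.prod c := by
  classical
  have e1 : (d + Finsupp.single i 1).prod c =
      ∏ j ∈ insert i d.support, c j ((d + Finsupp.single i 1 : σ →₀ ℕ) j) := by
    refine Finsupp.prod_of_support_subset _ (fun j hj => ?_) _ fun j _ => hc j
    rw [Finsupp.mem_support_iff, Finsupp.add_apply, Finsupp.single_apply] at hj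
    rw [Finset.mem_insert, Finsupp.mem_support_iff]
    by_cases h : i = j
    · exact Or.inl h.symm
    · rw [if_neg h] at hj
      exact Or.inr hj
  have e2 : d.prod c = ∏ j ∈ insert i d.support, c j (d j) :=
    Finsupp.prod_of_support_subset _ (Finset.subset_insert _ _) _ fun j _ => hc j
  rw [e1, e2, ← Finset.mul_prod_erase _ _ (Finset.mem_insert_self i d.support),
    ← Finset.mul_prod_erase _ (fun j => c j (d j)) (Finset.mem_insert_self i d.support),
    ← mul_assoc]
  congr 1
  · simp [hx]
  · refine Finset.prod_congr rfl fun j hj => ?_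
    rw [Finsupp.add_apply, Finsupp.single_eq_of_ne (Finset.ne_of_mem_erase hj), add_zero]

theorem multiFactorial_add_single (d : σ →₀ ℕ) (i : σ) :
    multiFactorial (d + Finsupp.single i 1) = ((d i + 1 : ℕ) : ℂ) * multiFactorial d := by
  refine prod_add_single _ (fun _ => ?_) d i _ ?_
  · simp
  · rw [Nat.factorial_succ, Nat.cast_mul]

variable {R : Type*} [CommRing R] [Algebra ℂ R]

/-- The divided power monomial `c^b / b!`. -/
def divPow (c : σ → R) (b : σ →₀ ℕ) : R :=
  (multiFactorial b)⁻¹ • b.prod fun i m => c i ^ m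

theorem divPow_zero (c : σ → R) : divPow c 0 = 1 := by
  simp [divPow, multiFactorial_zero]

theorem divPow_add_single (c : σ → R) (d : σ →₀ ℕ) (i : σ) :
    (d i + 1) • divPow c (d + Finsupp.single i 1) = c i * divPow c d := by
  have h : ((d i + 1 : ℕ) : ℂ) ≠ 0 := Nat.cast_ne_zero.2 (Nat.succ_ne_zero _)
  rw [divPow, divPow, multiFactorial_add_single,
    prod_add_single (fun i m => c i ^ m) (fun _ => pow_zero _) d i (c i)
      (pow_succ' _ _), ← Nat.cast_smul_eq_nsmul ℂ, smul_smul, mul_inv, ← mul_assoc,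
    mul_inv_cancel₀ h, one_mul, mul_smul_comm]

theorem nsmul_right_injective' {M : Type*} [AddCommGroup M] [Module ℂ M] {n : ℕ} {x y : M}
    (h : (n + 1) • x = (n + 1) • y) : x = y := by
  rw [← Nat.cast_smul_eq_nsmul ℂ, ← Nat.cast_smul_eq_nsmul ℂ] at h
  exact smul_right_injective M (Nat.cast_ne_zero.2 (Nat.succ_ne_zero n)) h

/-- The coefficients of an exponential are determined by the differential equation. -/
theorem eq_divPow {c : σ → R} {F : (σ →₀ ℕ) → R} (h0 : F 0 = 1)
    (hs : ∀ d i, (d i + 1) • F (d + Finsupp.single i 1) = c i * F d) (d : σ →₀ ℕ) :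
    F d = divPow c d := by
  induction d using finsupp_single_induction with
  | h0 => rw [h0, divPow_zero]
  | hs d i ih =>
    apply nsmul_right_injective' (n := d i)
    rw [hs, divPow_add_single, ih]

theorem divPow_add [DecidableEq σ] (c c' : σ → R) (d : σ →₀ ℕ) :
    divPow (c + c') d = ∑ p ∈ antidiagonal d, divPow c p.1 * divPow c' p.2 := by
  refine (eq_divPow (F := fun d => ∑ p ∈ antidiagonal d, divPow c p.1 * divPow c' p.2)
    ?_ (fun d i => ?_) d).symm
  · simp [divPow_zero]
  · rw [sum_antidiagonal_add_single d i fun a b => divPow c a * divPow c' b, Finset.mul_sum]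
    refine Finset.sum_congr rfl fun p _ => ?_
    rw [← smul_mul_assoc, ← mul_smul_comm, divPow_add_single, divPow_add_single, Pi.add_apply]
    ring

theorem map_divPow {S : Type*} [CommRing S] [Algebra ℂ S] (f : R →ₐ[ℂ] S) (c : σ → R)
    (b : σ →₀ ℕ) : f (divPow c b) = divPow (fun i => f (c i)) b := by
  simp [divPow, Finsupp.prod, map_prod]

theorem divPow_X (b : σ →₀ ℕ) :
    divPow (fun i => (MvPolynomial.X i : MvPolynomial σ ℂ)) b =
      MvPolynomial.monomial b (multiFactorial b)⁻¹ := by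
  rw [divPow, MvPolynomial.monomial_eq, MvPolynomial.smul_eq_C_mul]

theorem divPow_sum {τ : Type} (c : σ ⊕ τ → R) (a : σ →₀ ℕ) (b : τ →₀ ℕ) :
    divPow c (Finsupp.sumFinsuppEquivProdFinsupp.symm (a, b)) =
      divPow (fun i => c (Sum.inl i)) a * divPow (fun i => c (Sum.inr i)) b := by
  rw [divPow, divPow, divPow, multiFactorial, multiFactorial, multiFactorial, smul_mul_smul_comm,
    ← mul_inv]
  change _ • (Finsupp.sumElim a b).prod _ = _
  change ((Finsupp.sumElim a b).prod _)⁻¹ • _ = _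
  simp only [Finsupp.prod_sumElim]
  rfl

/-- The exponential of linear forms in `u` with monomial values. -/
theorem divPow_smul_pow (c : σ → ℂ) (x : R) (g : σ → ℕ) (b : σ →₀ ℕ) :
    divPow (fun i => c i • x ^ g i) b = divPow c b • x ^ Finsupp.weight g b := by
  have h : (b.prod fun i m => (c i • x ^ g i) ^ m) =
      (b.prod fun i m => c i ^ m) • x ^ Finsupp.weight g b := by
    rw [Finsupp.weight_apply, Finsupp.sum, ← Finset.prod_pow_eq_pow_sum, Finsupp.prod, Finsupp.prod,
      Algebra.smul_def, map_prod, ← Finset.prod_mul_distrib]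
    refine Finset.prod_congr rfl fun i _ => ?_
    rw [Algebra.smul_def, mul_pow, ← map_pow, ← pow_mul, smul_eq_mul, mul_comm (g i)]
  rw [divPow, h, divPow, smul_assoc]

theorem divPow_algebraMap_mul_pow (c : σ → ℂ) (x : R) (g : σ → ℕ) (b : σ →₀ ℕ) :
    divPow (fun i => algebraMap ℂ R (c i) * x ^ g i) b =
      algebraMap ℂ R (divPow c b) * x ^ Finsupp.weight g b := by
  simpa only [Algebra.smul_def] using divPow_smul_pow c x g b

end DividedPowers

section ExpSeries

variable {σ R : Type} [Ring R]

/-- The formal partial derivative of a power series over a possibly non-commutative ring. -/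
def partialDeriv (i : σ) (F : MvPowerSeries σ R) : MvPowerSeries σ R :=
  fun d => (d i + 1) • MvPowerSeries.coeff (d + Finsupp.single i 1) F

theorem coeff_partialDeriv (i : σ) (F : MvPowerSeries σ R) (d : σ →₀ ℕ) :
    MvPowerSeries.coeff d (partialDeriv i F) =
      (d i + 1) • MvPowerSeries.coeff (d + Finsupp.single i 1) F := rfl

theorem partialDeriv_mul (i : σ) (F G : MvPowerSeries σ R) :
    partialDeriv i (F * G) = partialDeriv i F * G + F * partialDeriv i G := by
  classical
  ext d
  rw [coeff_partialDeriv, MvPowerSeries.coeff_mul, map_add, MvPowerSeries.coeff_mul,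
    MvPowerSeries.coeff_mul, ← Finset.sum_add_distrib,
    sum_antidiagonal_add_single d i fun a b => MvPowerSeries.coeff a F * MvPowerSeries.coeff b G]
  refine Finset.sum_congr rfl fun p _ => ?_
  rw [coeff_partialDeriv, coeff_partialDeriv, smul_mul_assoc, mul_smul_comm]

theorem partialDeriv_pow_succ (i : σ) {A : MvPowerSeries σ R} (h : Commute A (partialDeriv i A))
    (N : ℕ) : partialDeriv i (A ^ (N + 1)) = (N + 1) • (A ^ N * partialDeriv i A) := by
  induction N with
  | zero => simp
  | succ N ih =>
    rw [pow_succ, partialDeriv_mul, ih, smul_mul_assoc, mul_assoc, ← h.eq, ← mul_assoc,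
      ← pow_succ, ← succ_nsmul]

theorem coeff_pow_eq_zero {A : MvPowerSeries σ R} (hA : MvPowerSeries.constantCoeff A = 0)
    {d : σ →₀ ℕ} {N : ℕ} (h : d.degree < N) : MvPowerSeries.coeff d (A ^ N) = 0 := by
  apply MvPowerSeries.coeff_of_lt_order
  refine lt_of_lt_of_le ?_ (MvPowerSeries.le_order_pow_of_constantCoeff_eq_zero N hA)
  exact_mod_cast h

theorem constantCoeff_linearForm (c : σ → R) :
    MvPowerSeries.constantCoeff (linearForm c) = 0 := by
  rw [← MvPowerSeries.coeff_zero_eq_constantCoeff_apply]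
  change (if (0 : σ →₀ ℕ).degree = 1 then (0 : σ →₀ ℕ).sum fun i m => m • c i else (0 : R)) = 0
  simp

theorem partialDeriv_linearForm (i : σ) (c : σ → R) :
    partialDeriv i (linearForm c) = MvPowerSeries.C (c i) := by
  classical
  ext d
  rw [coeff_partialDeriv, MvPowerSeries.coeff_C]
  change _ • (if (d + Finsupp.single i 1).degree = 1 then _ else (0 : R)) = _
  rw [map_add, Finsupp.degree_single]
  by_cases hd : d = 0
  · subst hd
    simp
  · rw [if_neg hd, if_neg, smul_zero]
    have : d.degree ≠ 0 := (Finsupp.degree_eq_zero_iff d).not.2 hd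
    omega

theorem commute_linearForm {c : σ → R} {x : R} (h : ∀ i, c i * x = x * c i) :
    Commute (linearForm c) (MvPowerSeries.C x) := by
  ext d
  rw [MvPowerSeries.coeff_mul_C, MvPowerSeries.coeff_C_mul]
  change (if _ then _ else (0 : R)) * x = x * (if _ then _ else (0 : R))
  split_ifs
  · rw [Finsupp.sum, Finset.sum_mul, Finset.mul_sum]
    simp only [smul_mul_assoc, mul_smul_comm, h]
  · simp

theorem neg_linearForm (c : σ → R) : -linearForm c = linearForm (-c) := by
  funext d
  change -(if _ then _ else (0 : R)) = if _ then _ else 0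
  split_ifs
  · simp [Finsupp.sum]
  · simp

variable [Algebra ℂ R]

theorem coeff_expSeries {A : MvPowerSeries σ R} (hA : MvPowerSeries.constantCoeff A = 0)
    {d : σ →₀ ℕ} {M : ℕ} (h : d.degree ≤ M) :
    MvPowerSeries.coeff d (expSeries A) = ∑ N ∈ Finset.range (M + 1),
      ((Nat.factorial N : ℂ)⁻¹) • MvPowerSeries.coeff d (A ^ N) := by
  refine Finset.sum_subset (Finset.range_subset_range.2 (by omega)) fun N _ hN => ?_
  rw [coeff_pow_eq_zero hA (by simpa using hN), smul_zero]

theorem coeff_zero_expSeries (A : MvPowerSeries σ R) :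
    MvPowerSeries.coeff 0 (expSeries A) = 1 := by
  change ∑ N ∈ Finset.range _, _ = _
  simp

/-- The exponential series solves the exponential differential equation. -/
theorem partialDeriv_expSeries (i : σ) {A : MvPowerSeries σ R}
    (hA : MvPowerSeries.constantCoeff A = 0) (h : Commute A (partialDeriv i A)) :
    partialDeriv i (expSeries A) = expSeries A * partialDeriv i A := by
  classical
  ext d
  have hdeg : (d + Finsupp.single i 1).degree = d.degree + 1 := by
    rw [map_add, Finsupp.degree_single]
  rw [coeff_partialDeriv, coeff_expSeries hA hdeg.le, Finset.sum_range_succ', smul_add,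
    Finset.smul_sum]
  have h1 : ∀ N : ℕ, (d i + 1) • ((Nat.factorial (N + 1) : ℂ)⁻¹ •
      MvPowerSeries.coeff (d + Finsupp.single i 1) (A ^ (N + 1))) =
      (Nat.factorial N : ℂ)⁻¹ • MvPowerSeries.coeff d (A ^ N * partialDeriv i A) := by
    intro N
    rw [smul_comm, ← coeff_partialDeriv, partialDeriv_pow_succ i h, map_nsmul,
      ← Nat.cast_smul_eq_nsmul ℂ (N + 1), smul_smul, Nat.factorial_succ, Nat.cast_mul, mul_inv]
    congr 1
    have : ((N + 1 : ℕ) : ℂ) ≠ 0 := Nat.cast_ne_zero.2 (Nat.succ_ne_zero N)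
    field_simp
  have h2 : MvPowerSeries.coeff (d + Finsupp.single i 1) (A ^ 0) = 0 := by
    rw [pow_zero, MvPowerSeries.coeff_one, if_neg]
    intro h
    have := DFunLike.congr_fun h i
    simp at this
  rw [Finset.sum_congr rfl fun N _ => h1 N, h2, smul_zero, smul_zero, add_zero,
    MvPowerSeries.coeff_mul]
  simp only [MvPowerSeries.coeff_mul, Finset.smul_sum]
  rw [Finset.sum_comm]
  refine Finset.sum_congr rfl fun p hp => ?_
  have hle : p.1.degree ≤ d.degree := by
    rw [← mem_antidiagonal.1 hp, map_add]
    exact Nat.le_add_right _ _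
  rw [coeff_expSeries hA hle, Finset.sum_mul]
  simp only [smul_mul_assoc]

theorem coeff_expSeries_linearForm_add_single {c : σ → R} (h : ∀ i j, c i * c j = c j * c i)
    (d : σ →₀ ℕ) (i : σ) :
    (d i + 1) • MvPowerSeries.coeff (d + Finsupp.single i 1) (expSeries (linearForm c)) =
      MvPowerSeries.coeff d (expSeries (linearForm c)) * c i := by
  rw [← coeff_partialDeriv, partialDeriv_expSeries i (constantCoeff_linearForm c),
    partialDeriv_linearForm, MvPowerSeries.coeff_mul_C]
  rw [partialDeriv_linearForm]
  exact commute_linearForm fun j => h j i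

theorem coeff_expSeries_linearForm {S : Type} [CommRing S] [Algebra ℂ S] (c : σ → S)
    (d : σ →₀ ℕ) :
    MvPowerSeries.coeff d (expSeries (linearForm c)) = divPow c d := by
  refine eq_divPow (F := fun d => MvPowerSeries.coeff d (expSeries (linearForm c)))
    (coeff_zero_expSeries _) (fun d i => ?_) d
  rw [mul_comm]
  exact coeff_expSeries_linearForm_add_single (fun i j => mul_comm _ _) d i

/-- The evaluation of polynomials at a commuting family of elements of a non-commutative
algebra. -/
def commAeval {B : Type*} [Semiring B] [Algebra ℂ B] (c : σ → B)
    (h : ∀ i j, c i * c j = c j * c i) : MvPolynomial σ ℂ →ₐ[ℂ] B :=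
  have hc : ∀ a ∈ Set.range c, ∀ b ∈ Set.range c, a * b = b * a := by
    rintro _ ⟨i, rfl⟩ _ ⟨j, rfl⟩
    exact h i j
  letI := Algebra.isMulCommutative_adjoin ℂ hc
  letI : CommSemiring (Algebra.adjoin ℂ (Set.range c)) :=
    { (inferInstance : Semiring (Algebra.adjoin ℂ (Set.range c))) with
      mul_comm := fun a b => this.is_comm.comm a b }
  (Algebra.adjoin ℂ (Set.range c)).val.comp
    (MvPolynomial.aeval fun i => ⟨c i, Algebra.subset_adjoin ⟨i, rfl⟩⟩)

theorem commAeval_X {B : Type*} [Semiring B] [Algebra ℂ B] (c : σ → B)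
    (h : ∀ i j, c i * c j = c j * c i) (i : σ) : commAeval c h (MvPolynomial.X i) = c i := by
  simp [commAeval]

theorem coeff_expSeries_linearForm_eq_commAeval {c : σ → R} (h : ∀ i j, c i * c j = c j * c i)
    (d : σ →₀ ℕ) : MvPowerSeries.coeff d (expSeries (linearForm c)) =
      commAeval c h (divPow MvPolynomial.X d) := by
  induction d using finsupp_single_induction with
  | h0 => rw [coeff_zero_expSeries, divPow_zero, map_one]
  | hs d i ih =>
    apply nsmul_right_injective' (n := d i)
    rw [coeff_expSeries_linearForm_add_single h, ih, ← map_nsmul, divPow_add_single, mul_comm,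
      map_mul, commAeval_X]

end ExpSeries

/-! ### The polynomials `h_j` -/

section CompleteSymmetric

theorem hPoly_zero : hPoly 0 = 1 := by
  have h := fun A : MvPowerSeries Unit (MvPolynomial ℕ+ ℂ) => coeff_zero_expSeries A
  rw [← Finsupp.single_zero ()] at h
  exact h _

/-- Newton's recursion. -/
theorem hPoly_succ (n : ℕ) : (n + 1) • hPoly (n + 1) =
    ∑ p ∈ antidiagonal n, hPoly p.1 * ((p.2 + 1) • MvPolynomial.X (Nat.succPNat p.2)) := by
  let A : PowerSeries (MvPolynomial ℕ+ ℂ) := PowerSeries.mk fun k =>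
    if h : 0 < k then (MvPolynomial.X ⟨k, h⟩ : MvPolynomial ℕ+ ℂ) else 0
  have hA : MvPowerSeries.constantCoeff (σ := Unit) A = 0 := by
    change PowerSeries.constantCoeff A = 0
    rw [← PowerSeries.coeff_zero_eq_constantCoeff_apply, PowerSeries.coeff_mk,
      dif_neg (lt_irrefl 0)]
  have h := partialDeriv_expSeries (σ := Unit) () hA (Commute.all _ _)
  have hd : ∀ (B : PowerSeries (MvPolynomial ℕ+ ℂ)) (m : ℕ),
      PowerSeries.coeff m (partialDeriv (σ := Unit) () B) =
        (m + 1) • PowerSeries.coeff (m + 1) B := by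
    intro B m
    change MvPowerSeries.coeff (Finsupp.single () m) (partialDeriv (σ := Unit) () B) =
      (m + 1) • MvPowerSeries.coeff (Finsupp.single () (m + 1)) B
    rw [coeff_partialDeriv, Finsupp.single_eq_same, Finsupp.single_add]
  have h' := congrArg (PowerSeries.coeff n) h
  rw [hd, PowerSeries.coeff_mul] at h'
  refine h'.trans (Finset.sum_congr rfl fun p _ => ?_)
  rw [hd, PowerSeries.coeff_mk, dif_pos (Nat.succ_pos _)]
  rfl

variable {R : Type*} [CommRing R] [Algebra ℂ R]

/-- The value `h_j(c)` of the polynomial `h_j` at a family `c`. -/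
def hEval (c : ℕ+ → R) (j : ℕ) : R := MvPolynomial.aeval c (hPoly j)

theorem hEval_zero (c : ℕ+ → R) : hEval c 0 = 1 := by
  rw [hEval, hPoly_zero, map_one]

theorem hEval_succ (c : ℕ+ → R) (n : ℕ) : (n + 1) • hEval c (n + 1) =
    ∑ p ∈ antidiagonal n, hEval c p.1 * ((p.2 + 1) • c (Nat.succPNat p.2)) := by
  rw [hEval, ← map_nsmul, hPoly_succ, map_sum]
  refine Finset.sum_congr rfl fun p _ => ?_
  rw [map_mul, map_nsmul, MvPolynomial.aeval_X]
  rfl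

theorem map_hEval {S : Type*} [CommRing S] [Algebra ℂ S] (f : R →ₐ[ℂ] S) (c : ℕ+ → R) (j : ℕ) :
    f (hEval c j) = hEval (fun k => f (c k)) j := by
  rw [hEval, hEval, MvPolynomial.comp_aeval_apply]

/-- A power series with `F' = F P` is determined by its constant coefficient. -/
theorem powerSeries_ode_unique {F G P : PowerSeries R}
    (h0 : PowerSeries.coeff 0 F = PowerSeries.coeff 0 G)
    (hF : PowerSeries.derivative R F = F * P)
    (hG : PowerSeries.derivative R G = G * P) : F = G := by
  ext n
  induction n using Nat.strong_induction_on with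
  | _ n ih =>
    cases n with
    | zero => exact h0
    | succ n =>
      apply nsmul_right_injective' (n := n)
      have hF' := congrArg (PowerSeries.coeff n) hF
      have hG' := congrArg (PowerSeries.coeff n) hG
      rw [PowerSeries.coeff_derivative, PowerSeries.coeff_mul] at hF' hG'
      rw [nsmul_eq_mul, nsmul_eq_mul, mul_comm, mul_comm _ (PowerSeries.coeff (n + 1) G)]
      push_cast
      rw [hF', hG']
      refine Finset.sum_congr rfl fun p hp => ?_
      rw [ih p.1 (Nat.lt_succ_of_le (antidiagonal.fst_le hp))]

/-- The generating series of the `h_j(c)`. -/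
theorem derivative_mk_hEval (c : ℕ+ → R) :
    PowerSeries.derivative R (PowerSeries.mk (hEval c)) =
      PowerSeries.mk (hEval c) * PowerSeries.mk fun k => (k + 1) • c (Nat.succPNat k) := by
  ext n
  rw [PowerSeries.coeff_derivative, PowerSeries.coeff_mk, PowerSeries.coeff_mul,
    mul_comm]
  have h := hEval_succ c n
  rw [nsmul_eq_mul] at h
  push_cast at h
  rw [h]
  simp only [PowerSeries.coeff_mk]

theorem mk_hEval_add (c c' : ℕ+ → R) : PowerSeries.mk (hEval (c + c')) =
    PowerSeries.mk (hEval c) * PowerSeries.mk (hEval c') := by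
  refine powerSeries_ode_unique ?_ (derivative_mk_hEval _)
    (P := PowerSeries.mk fun k => (k + 1) • (c + c') (Nat.succPNat k)) ?_
  · rw [PowerSeries.coeff_mul]
    simp [hEval_zero]
  · have h : (PowerSeries.mk fun k => (k + 1) • (c + c') (Nat.succPNat k)) =
        (PowerSeries.mk fun k => (k + 1) • c (Nat.succPNat k)) +
          PowerSeries.mk fun k => (k + 1) • c' (Nat.succPNat k) := by
      ext n
      simp only [PowerSeries.coeff_mk, map_add, Pi.add_apply, smul_add]
    rw [h, Derivation.leibniz, derivative_mk_hEval, derivative_mk_hEval, smul_eq_mul, smul_eq_mul]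
    ring

theorem hEval_add (c c' : ℕ+ → R) (n : ℕ) :
    hEval (c + c') n = ∑ p ∈ antidiagonal n, hEval c p.1 * hEval c' p.2 := by
  have h := congrArg (PowerSeries.coeff n) (mk_hEval_add c c')
  rw [PowerSeries.coeff_mk, PowerSeries.coeff_mul] at h
  simpa only [PowerSeries.coeff_mk] using h

/-- `h_j(c)` for `j : ℤ`, which vanishes for `j < 0`. -/
def hInt (c : ℕ+ → R) (j : ℤ) : R := if 0 ≤ j then hEval c j.toNat else 0

theorem hInt_natCast (c : ℕ+ → R) (j : ℕ) : hInt c j = hEval c j := by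
  simp [hInt]

theorem hInt_of_neg (c : ℕ+ → R) {j : ℤ} (h : j < 0) : hInt c j = 0 :=
  if_neg (not_le.2 h)

theorem map_hInt {S : Type*} [CommRing S] [Algebra ℂ S] (f : R →ₐ[ℂ] S) (c : ℕ+ → R) (j : ℤ) :
    f (hInt c j) = hInt (fun k => f (c k)) j := by
  unfold hInt
  split_ifs
  · exact map_hEval f c _
  · exact map_zero f

variable {σ : Type}

/-- The linear combination `∑_{g i = k} c_i x_i` of the variables of weight `k`; `fib k` is the
finite set of all `i` with `g i = k`. -/
def weightForm (fib : ℕ+ → Finset σ) (c : σ → ℂ) (k : ℕ+) : MvPolynomial σ ℂ :=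
  ∑ i ∈ fib k, c i • MvPolynomial.X i

theorem nsmul_divPow_sub_single [DecidableEq σ] (c : σ → ℂ) (b : σ →₀ ℕ) (i : σ) :
    (if i ∈ b.support then divPow c (b - Finsupp.single i 1) else 0) * c i = b i * divPow c b := by
  split_ifs with h
  · have hi := Finsupp.mem_support_iff.1 h
    have h1 := divPow_add_single c (b - Finsupp.single i 1) i
    rw [Finsupp.sub_add_single_one_cancel hi] at h1
    rw [mul_comm, ← h1, nsmul_eq_mul, Finsupp.tsub_apply, Finsupp.single_eq_same,
      Nat.sub_add_cancel (Nat.one_le_iff_ne_zero.2 hi)]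
  · rw [Finsupp.notMem_support_iff.1 h]
    simp

theorem sum_fib_eq_weight [DecidableEq σ] {g : σ → ℕ+} {fib : ℕ+ → Finset σ}
    (hfib : ∀ k i, i ∈ fib k ↔ g i = k) {b : σ →₀ ℕ} {n : ℕ}
    (hn : Finsupp.weight (fun i => (g i : ℕ)) b = n + 1) :
    ∑ p ∈ antidiagonal n, ∑ i ∈ fib (Nat.succPNat p.2), (p.2 + 1) * b i = n + 1 := by
  rw [Finset.Nat.sum_antidiagonal_eq_sum_range_succ_mk,
    ← Finset.sum_range_reflect]
  rw [← hn, Finsupp.weight_apply, Finsupp.sum]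
  have h1 : ∀ k ∈ Finset.range (n + 1),
      ∑ i ∈ fib (Nat.succPNat (n - (n + 1 - 1 - k))), (n - (n + 1 - 1 - k) + 1) * b i =
        ∑ i ∈ fib (Nat.succPNat k), b i • (g i : ℕ) := by
    intro k hk
    rw [Finset.mem_range] at hk
    have e : n - (n + 1 - 1 - k) = k := by omega
    rw [e]
    refine Finset.sum_congr rfl fun i hi => ?_
    rw [(hfib _ _).1 hi, smul_eq_mul, mul_comm]
    rfl
  rw [Nat.succ_eq_add_one, Finset.sum_congr rfl h1, ← Finset.sum_biUnion]
  · symm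
    refine Finset.sum_subset (fun i hi => ?_) fun i _ hi => ?_
    · rw [Finset.mem_biUnion]
      have hle : b i • (g i : ℕ) ≤ n + 1 := by
        rw [← hn, Finsupp.weight_apply]
        exact Finset.single_le_sum (f := fun i => b i • (g i : ℕ)) (fun _ _ => Nat.zero_le _) hi
      have hpos : 1 ≤ b i := Nat.one_le_iff_ne_zero.2 (Finsupp.mem_support_iff.1 hi)
      have hle' : (g i : ℕ) ≤ n + 1 := by
        rw [smul_eq_mul] at hle
        nlinarith [(g i).pos]
      refine ⟨(g i).natPred, ?_, ?_⟩
      · rw [Finset.mem_range]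
        have := PNat.natPred_add_one (g i)
        omega
      · rw [hfib, PNat.succPNat_natPred]
    · rw [Finsupp.notMem_support_iff.1 hi, zero_smul]
  · intro k _ l _ hkl
    refine Finset.disjoint_left.2 fun i hi hi' => hkl ?_
    have := ((hfib _ _).1 hi).symm.trans ((hfib _ _).1 hi')
    exact Nat.succPNat_injective this

/-- The coefficients of `h_j(∑_{g i = 1} c_i x_i, ∑_{g i = 2} c_i x_i, …)`, the coefficient of `u^j`
in `exp (∑_i c_i x_i u^{g i})`. -/
theorem coeff_hEval_weightForm [DecidableEq σ] {g : σ → ℕ+} {fib : ℕ+ → Finset σ}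
    (hfib : ∀ k i, i ∈ fib k ↔ g i = k) (c : σ → ℂ) (j : ℕ) (b : σ →₀ ℕ) :
    MvPolynomial.coeff b (hEval (weightForm fib c) j) =
      if Finsupp.weight (fun i => (g i : ℕ)) b = j then divPow c b else 0 := by
  induction j using Nat.strong_induction_on generalizing b with
  | _ j ih =>
    cases j with
    | zero =>
      rw [hEval_zero, MvPolynomial.coeff_one]
      have hiff : Finsupp.weight (fun i => (g i : ℕ)) b = 0 ↔ 0 = b := by
        constructor
        · intro h
          ext i
          rw [Finsupp.weight_apply, Finsupp.sum, Finset.sum_eq_zero_iff] at h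
          by_contra hi
          have h' := h i (Finsupp.mem_support_iff.2 (Ne.symm hi))
          rw [smul_eq_mul, mul_eq_zero] at h'
          exact h'.elim (fun h => hi h.symm) (g i).ne_zero
        · rintro rfl
          simp
      by_cases h : 0 = b
      · rw [if_pos h, if_pos (hiff.2 h), ← h, divPow_zero]
      · rw [if_neg h, if_neg fun h' => h (hiff.1 h')]
    | succ n =>
      apply nsmul_right_injective' (n := n)
      rw [← MvPolynomial.coeff_smul, hEval_succ, MvPolynomial.coeff_sum]
      have h1 : ∀ p ∈ antidiagonal n, MvPolynomial.coeff b (hEval (weightForm fib c) p.1 *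
          ((p.2 + 1) • weightForm fib c (Nat.succPNat p.2))) =
          (if Finsupp.weight (fun i => (g i : ℕ)) b = n + 1 then divPow c b else 0) *
            ((∑ i ∈ fib (Nat.succPNat p.2), (p.2 + 1) * b i : ℕ) : ℂ) := by
        intro p hp
        rw [weightForm, mul_smul_comm, MvPolynomial.coeff_smul, Finset.mul_sum,
          MvPolynomial.coeff_sum, Nat.cast_sum, Finset.mul_sum, Finset.smul_sum]
        refine Finset.sum_congr rfl fun i hi => ?_
        have hw : (if i ∈ b.support then MvPolynomial.coeff (b - Finsupp.single i 1)
            (hEval (weightForm fib c) p.1) else 0) =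
            if Finsupp.weight (fun i => (g i : ℕ)) b = n + 1 then
              (if i ∈ b.support then divPow c (b - Finsupp.single i 1) else 0) else 0 := by
          by_cases hs : i ∈ b.support
          · rw [if_pos hs, if_pos hs,
              ih p.1 (Nat.lt_succ_of_le (antidiagonal.fst_le hp))]
            have h2 := Finsupp.weight_sub_single_add (w := fun i => (g i : ℕ))
              (Finsupp.mem_support_iff.1 hs)
            have h3 := mem_antidiagonal.1 hp
            have h4 : (g i : ℕ) = p.2 + 1 := by
              rw [(hfib _ _).1 hi]
              rfl
            by_cases h5 : Finsupp.weight (fun i => (g i : ℕ)) b = n + 1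
            · rw [if_pos h5, if_pos (by omega)]
            · rw [if_neg h5, if_neg (by omega)]
          · rw [if_neg hs, if_neg hs, ite_self]
        rw [mul_smul_comm, MvPolynomial.coeff_smul, MvPolynomial.coeff_mul_X', hw]
        split_ifs with h5 h6
        · have := nsmul_divPow_sub_single c b i
          rw [if_pos h6] at this
          rw [smul_eq_mul, mul_comm (c i), this, nsmul_eq_mul]
          push_cast
          ring
        · have := nsmul_divPow_sub_single c b i
          rw [if_neg h6, zero_mul] at this
          push_cast
          rw [smul_zero, smul_zero, mul_left_comm, mul_comm (divPow c b), ← this, mul_zero]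
        · simp
      rw [Finset.sum_congr rfl h1, ← Finset.mul_sum, ← Nat.cast_sum]
      split_ifs with h
      · rw [sum_fib_eq_weight hfib h, nsmul_eq_mul, mul_comm]
      · simp

end CompleteSymmetric

/-! ### Power series as functionals on polynomials -/

section Functionals

variable {σ τ : Type}

/-- The functional `P ↦ P(∂) f |_{t = 0}` on polynomials given by a formal power series `f`. It
maps the divided power `x^b / b!` to the coefficient of `t^b`, see `dualPairing_divPow`. -/
def dualPairing (f : MvPowerSeries σ ℂ) : MvPolynomial σ ℂ →ₗ[ℂ] ℂ :=
  (MvPolynomial.basisMonomials σ ℂ).constr ℂ fun b => multiFactorial b * MvPowerSeries.coeff b f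

theorem dualPairing_monomial (f : MvPowerSeries σ ℂ) (b : σ →₀ ℕ) (r : ℂ) :
    dualPairing f (MvPolynomial.monomial b r) =
      r * (multiFactorial b * MvPowerSeries.coeff b f) := by
  have h : MvPolynomial.monomial b r = r • MvPolynomial.basisMonomials σ ℂ b := by
    rw [MvPolynomial.coe_basisMonomials, MvPolynomial.smul_monomial, smul_eq_mul, mul_one]
  rw [h, map_smul, dualPairing, Module.Basis.constr_basis, smul_eq_mul]

theorem dualPairing_divPow (f : MvPowerSeries σ ℂ) (b : σ →₀ ℕ) :
    dualPairing f (divPow MvPolynomial.X b) = MvPowerSeries.coeff b f := by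
  rw [divPow_X, dualPairing_monomial, ← mul_assoc, inv_mul_cancel₀ (multiFactorial_ne_zero b),
    one_mul]

theorem dualPairing_apply (f : MvPowerSeries σ ℂ) (Q : MvPolynomial σ ℂ) :
    dualPairing f Q = ∑ b ∈ Q.support,
      MvPolynomial.coeff b Q * (multiFactorial b * MvPowerSeries.coeff b f) := by
  conv_lhs => rw [Q.as_sum, map_sum]
  simp only [dualPairing_monomial]

theorem ext_divPow {M : Type*} [AddCommMonoid M] [Module ℂ M] {L L' : MvPolynomial σ ℂ →ₗ[ℂ] M}
    (h : ∀ b, L (divPow MvPolynomial.X b) = L' (divPow MvPolynomial.X b)) : L = L' := by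
  refine (MvPolynomial.basisMonomials σ ℂ).ext fun b => ?_
  have e : MvPolynomial.basisMonomials σ ℂ b = multiFactorial b • divPow MvPolynomial.X b := by
    rw [MvPolynomial.coe_basisMonomials, divPow_X, MvPolynomial.smul_monomial, smul_eq_mul,
      mul_inv_cancel₀ (multiFactorial_ne_zero b)]
  rw [e, map_smul, map_smul, h]

/-- A functional with the values `L (x^b / b!)` on the divided powers is the pairing with the power
series `∑ L (x^b / b!) t^b`. -/
theorem dualPairing_eq {f : MvPowerSeries σ ℂ} {L : MvPolynomial σ ℂ →ₗ[ℂ] ℂ}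
    (h : ∀ b, MvPowerSeries.coeff b f = L (divPow MvPolynomial.X b)) : dualPairing f = L :=
  ext_divPow fun b => by rw [dualPairing_divPow, h]

/-- Substitution is dual to the exponential kernel: if `Q` is the coefficient of `t^e` in
`exp (∑_i x_i s_i(t))`, then the coefficient of `t^e` in `f(s(t))` is the value of `f` at `Q`. -/
theorem coeff_subst_eq_dualPairing {s : σ → MvPowerSeries τ ℂ} (hs : MvPowerSeries.HasSubst s)
    (f : MvPowerSeries σ ℂ) (e : τ →₀ ℕ) (Q : MvPolynomial σ ℂ)
    (h : ∀ d, MvPolynomial.coeff d Q = MvPowerSeries.coeff e (divPow s d)) :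
    MvPowerSeries.coeff e (f.subst s) = dualPairing f Q := by
  have h' : ∀ d, MvPowerSeries.coeff e (d.prod fun i m => s i ^ m) =
      multiFactorial d * MvPolynomial.coeff d Q := by
    intro d
    rw [h, divPow, MvPowerSeries.coeff_smul, ← mul_assoc,
      mul_inv_cancel₀ (multiFactorial_ne_zero d), one_mul]
  rw [MvPowerSeries.coeff_subst hs, dualPairing_apply,
    finsum_eq_sum_of_support_subset (s := Q.support)]
  · refine Finset.sum_congr rfl fun d _ => ?_
    rw [h', smul_eq_mul]
    ring
  · intro d hd
    rw [Finset.mem_coe, MvPolynomial.mem_support_iff]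
    intro h0
    exact hd (by simp only [h', h0, mul_zero, smul_zero])

/-- The multi-index with the components `a` and `b`. -/
abbrev sumIndex (a : σ →₀ ℕ) (b : τ →₀ ℕ) : σ ⊕ τ →₀ ℕ :=
  Finsupp.sumFinsuppEquivProdFinsupp.symm (a, b)

theorem exists_sumIndex (d : σ ⊕ τ →₀ ℕ) : ∃ a b, d = sumIndex a b :=
  ⟨_, _, (Finsupp.sumFinsuppEquivProdFinsupp.symm_apply_apply d).symm⟩

theorem sumIndex_inj {a a' : σ →₀ ℕ} {b b' : τ →₀ ℕ} :
    sumIndex a b = sumIndex a' b' ↔ a = a' ∧ b = b' := by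
  rw [EmbeddingLike.apply_eq_iff_eq, Prod.mk.injEq]

theorem sumIndex_add (a a' : σ →₀ ℕ) (b b' : τ →₀ ℕ) :
    sumIndex a b + sumIndex a' b' = sumIndex (a + a') (b + b') := by
  ext (i | i) <;> simp

theorem mapDomain_inl (a : σ →₀ ℕ) :
    a.mapDomain (Sum.inl : σ → σ ⊕ τ) = sumIndex a 0 := by
  ext (i | i)
  · rw [Finsupp.mapDomain_apply Sum.inl_injective]
    simp
  · rw [Finsupp.mapDomain_of_notMem_range _ _ (by simp)]
    simp

theorem mapDomain_inr (b : τ →₀ ℕ) :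
    b.mapDomain (Sum.inr : τ → σ ⊕ τ) = sumIndex 0 b := by
  ext (i | i)
  · rw [Finsupp.mapDomain_of_notMem_range _ _ (by simp)]
    simp
  · rw [Finsupp.mapDomain_apply Sum.inr_injective]
    simp

theorem sum_antidiagonal_sumIndex [DecidableEq σ] [DecidableEq τ] {M : Type*} [AddCommMonoid M]
    (a : σ →₀ ℕ) (b : τ →₀ ℕ) (F : (σ ⊕ τ →₀ ℕ) → (σ ⊕ τ →₀ ℕ) → M) :
    ∑ p ∈ antidiagonal (sumIndex a b), F p.1 p.2 =
      ∑ p ∈ antidiagonal a, ∑ q ∈ antidiagonal b,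
        F (sumIndex p.1 q.1) (sumIndex p.2 q.2) := by
  rw [← Finset.sum_product']
  symm
  refine Finset.sum_bij (fun x _ => (sumIndex x.1.1 x.2.1, sumIndex x.1.2 x.2.2)) ?_ ?_ ?_ ?_
  · rintro ⟨⟨a1, a2⟩, b1, b2⟩ h
    rw [Finset.mem_product, mem_antidiagonal, mem_antidiagonal] at h
    rw [mem_antidiagonal, sumIndex_add, sumIndex_inj]
    exact h
  · rintro ⟨⟨a1, a2⟩, b1, b2⟩ _ ⟨⟨a1', a2'⟩, b1', b2'⟩ _ h
    rw [Prod.mk.injEq, sumIndex_inj, sumIndex_inj] at h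
    obtain ⟨⟨h1, h2⟩, h3, h4⟩ := h
    dsimp only at h1 h2 h3 h4
    rw [h1, h2, h3, h4]
  · rintro ⟨d1, d2⟩ h
    obtain ⟨a1, b1, rfl⟩ := exists_sumIndex d1
    obtain ⟨a2, b2, rfl⟩ := exists_sumIndex d2
    rw [mem_antidiagonal, sumIndex_add, sumIndex_inj] at h
    refine ⟨((a1, a2), b1, b2), ?_, rfl⟩
    rw [Finset.mem_product, mem_antidiagonal, mem_antidiagonal]
    exact h
  · intro x _
    rfl

theorem divPow_X_comp (p : σ → τ) (d : σ →₀ ℕ) :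
    divPow (fun i => (MvPowerSeries.X (p i) : MvPowerSeries τ ℂ)) d =
      MvPowerSeries.monomial (d.mapDomain p) (multiFactorial d)⁻¹ := by
  have h := map_divPow (MvPolynomial.coeToMvPowerSeries.algHom (σ := τ) (R := ℂ) ℂ)
    (fun i => MvPolynomial.X (p i)) d
  have h2 := map_divPow (MvPolynomial.rename (R := ℂ) p) MvPolynomial.X d
  simp only [MvPolynomial.rename_X] at h2
  rw [← h2, divPow_X, MvPolynomial.rename_monomial] at h
  simp only [MvPolynomial.coeToMvPowerSeries.algHom_apply, MvPolynomial.coe_monomial,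
    MvPolynomial.coe_X, Algebra.algebraMap_self,
    RingHom.id_apply, MvPowerSeries.map_id] at h
  exact h.symm

theorem hasSubst_X_comp {p : σ → τ} (hp : Function.Injective p) :
    MvPowerSeries.HasSubst fun i => (MvPowerSeries.X (p i) : MvPowerSeries τ ℂ) where
  const_coeff i := by simp
  coeff_zero d := by
    classical
    refine Set.Subsingleton.finite fun i hi j hj => hp ?_
    simp only [Set.mem_ofPred_eq, MvPowerSeries.coeff_X, ne_eq, ite_eq_right_iff, one_ne_zero,
      imp_false, not_not] at hi hj
    exact (Finsupp.single_left_inj one_ne_zero).1 (hi.symm.trans hj)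

theorem coeff_subst_inl (f : MvPowerSeries σ ℂ) (a : σ →₀ ℕ) (b : τ →₀ ℕ) :
    MvPowerSeries.coeff (sumIndex a b)
        (f.subst fun i => (MvPowerSeries.X (Sum.inl i) : MvPowerSeries (σ ⊕ τ) ℂ)) =
      open Classical in if b = 0 then MvPowerSeries.coeff a f else 0 := by
  classical
  rw [coeff_subst_eq_dualPairing (hasSubst_X_comp Sum.inl_injective) f _
    (if b = 0 then divPow MvPolynomial.X a else 0)]
  · split_ifs
    · exact dualPairing_divPow f a
    · exact map_zero _
  · intro d
    rw [divPow_X_comp, mapDomain_inl, MvPowerSeries.coeff_monomial]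
    simp only [sumIndex_inj]
    by_cases hb : b = 0
    · rw [if_pos hb, divPow_X, MvPolynomial.coeff_monomial]
      by_cases h : a = d
      · rw [if_pos h, if_pos ⟨h, hb⟩, h]
      · rw [if_neg h, if_neg fun h' => h h'.1]
    · rw [if_neg hb, if_neg fun h' => hb h'.2, MvPolynomial.coeff_zero]

theorem coeff_subst_inr (f : MvPowerSeries τ ℂ) (a : σ →₀ ℕ) (b : τ →₀ ℕ) :
    MvPowerSeries.coeff (sumIndex a b)
        (f.subst fun i => (MvPowerSeries.X (Sum.inr i) : MvPowerSeries (σ ⊕ τ) ℂ)) =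
      open Classical in if a = 0 then MvPowerSeries.coeff b f else 0 := by
  classical
  rw [coeff_subst_eq_dualPairing (hasSubst_X_comp Sum.inr_injective) f _
    (if a = 0 then divPow MvPolynomial.X b else 0)]
  · split_ifs
    · exact dualPairing_divPow f b
    · exact map_zero _
  · intro d
    rw [divPow_X_comp, mapDomain_inr, MvPowerSeries.coeff_monomial]
    simp only [sumIndex_inj]
    by_cases ha : a = 0
    · rw [if_pos ha, divPow_X, MvPolynomial.coeff_monomial]
      by_cases h : b = d
      · rw [if_pos h, if_pos ⟨ha, h⟩, h]
      · rw [if_neg h, if_neg fun h' => h h'.2]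
    · rw [if_neg ha, if_neg fun h' => ha h'.1, MvPolynomial.coeff_zero]

/-- The product `f(t) g(t')` in two independent sets of variables. -/
def outerProduct (f : MvPowerSeries σ ℂ) (g : MvPowerSeries τ ℂ) : MvPowerSeries (σ ⊕ τ) ℂ :=
  f.subst (fun i => (MvPowerSeries.X (Sum.inl i) : MvPowerSeries (σ ⊕ τ) ℂ)) *
    g.subst (fun i => (MvPowerSeries.X (Sum.inr i) : MvPowerSeries (σ ⊕ τ) ℂ))

theorem coeff_outerProduct (f : MvPowerSeries σ ℂ) (g : MvPowerSeries τ ℂ) (a : σ →₀ ℕ)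
    (b : τ →₀ ℕ) : MvPowerSeries.coeff (sumIndex a b) (outerProduct f g) =
      MvPowerSeries.coeff a f * MvPowerSeries.coeff b g := by
  classical
  rw [outerProduct, MvPowerSeries.coeff_mul, sum_antidiagonal_sumIndex a b fun d d' =>
    MvPowerSeries.coeff d (f.subst fun i =>
      (MvPowerSeries.X (Sum.inl i) : MvPowerSeries (σ ⊕ τ) ℂ)) *
    MvPowerSeries.coeff d' (g.subst fun i =>
      (MvPowerSeries.X (Sum.inr i) : MvPowerSeries (σ ⊕ τ) ℂ))]
  simp only [coeff_subst_inl, coeff_subst_inr]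
  rw [Finset.sum_eq_single (a, 0), Finset.sum_eq_single (0, b)]
  · simp
  · rintro ⟨b1, b2⟩ h hne
    rw [mem_antidiagonal] at h
    rw [if_neg, zero_mul]
    rintro rfl
    exact hne (Prod.ext rfl (by simpa using h))
  · intro h
    exact absurd (mem_antidiagonal.2 (zero_add b)) h
  · rintro ⟨a1, a2⟩ h hne
    rw [mem_antidiagonal] at h
    refine Finset.sum_eq_zero fun q _ => ?_
    rw [if_neg (c := (a1, a2).2 = 0), mul_zero]
    intro h2
    dsimp only at h2
    subst h2
    exact hne (Prod.ext (by simpa using h) rfl)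
  · intro h
    exact absurd (mem_antidiagonal.2 (add_zero a)) h

theorem subst_outerProduct {ρ : Type} {s : σ ⊕ τ → MvPowerSeries ρ ℂ}
    (hs : MvPowerSeries.HasSubst s) (f : MvPowerSeries σ ℂ) (g : MvPowerSeries τ ℂ) :
    (outerProduct f g).subst s =
      f.subst (fun i => s (Sum.inl i)) * g.subst (fun i => s (Sum.inr i)) := by
  rw [outerProduct, MvPowerSeries.subst_mul hs,
    MvPowerSeries.subst_comp_subst_apply (hasSubst_X_comp Sum.inl_injective) hs,
    MvPowerSeries.subst_comp_subst_apply (hasSubst_X_comp Sum.inr_injective) hs]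
  simp only [MvPowerSeries.subst_X hs]

theorem rename_divPow_mul (a : σ →₀ ℕ) (b : τ →₀ ℕ) :
    MvPolynomial.rename Sum.inl (divPow MvPolynomial.X a) *
      MvPolynomial.rename Sum.inr (divPow MvPolynomial.X b) =
        (divPow MvPolynomial.X (sumIndex a b) : MvPolynomial (σ ⊕ τ) ℂ) := by
  rw [map_divPow, map_divPow, divPow_sum]
  simp only [MvPolynomial.rename_X]

theorem dualPairing_outerProduct (f : MvPowerSeries σ ℂ) (g : MvPowerSeries τ ℂ)
    (P : MvPolynomial σ ℂ) (Q : MvPolynomial τ ℂ) :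
    dualPairing (outerProduct f g) (MvPolynomial.rename Sum.inl P * MvPolynomial.rename Sum.inr Q) =
      dualPairing f P * dualPairing g Q := by
  have h : ((LinearMap.mul ℂ (MvPolynomial (σ ⊕ τ) ℂ)).compl₁₂
        (MvPolynomial.rename Sum.inl).toLinearMap
        (MvPolynomial.rename Sum.inr).toLinearMap).compr₂ (dualPairing (outerProduct f g)) =
      (LinearMap.mul ℂ ℂ).compl₁₂ (dualPairing f) (dualPairing g) := by
    refine ext_divPow fun a => ext_divPow fun b => ?_
    simp only [LinearMap.compr₂_apply, LinearMap.compl₁₂_apply, LinearMap.mul_apply',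
      AlgHom.toLinearMap_apply]
    rw [rename_divPow_mul, dualPairing_divPow, dualPairing_divPow, dualPairing_divPow,
      coeff_outerProduct]
  exact DFunLike.congr_fun (DFunLike.congr_fun h P) Q

/-- Symmetry of the outer product. -/
theorem dualPairing_outerProduct_swap (f g : MvPowerSeries σ ℂ) (P : MvPolynomial (σ ⊕ σ) ℂ) :
    dualPairing (outerProduct f g) (MvPolynomial.rename Sum.swap P) =
      dualPairing (outerProduct g f) P := by
  have h : (dualPairing (outerProduct f g)).comp
      (MvPolynomial.rename (R := ℂ) Sum.swap).toLinearMap = dualPairing (outerProduct g f) := by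
    refine ext_divPow fun d => ?_
    obtain ⟨a, b, rfl⟩ := exists_sumIndex d
    rw [LinearMap.comp_apply, AlgHom.toLinearMap_apply, dualPairing_divPow, coeff_outerProduct,
      map_divPow, divPow_sum]
    simp only [MvPolynomial.rename_X, Sum.swap_inl, Sum.swap_inr]
    rw [mul_comm, mul_comm (MvPowerSeries.coeff a g), ← coeff_outerProduct, ← dualPairing_divPow,
      divPow_sum]
  exact DFunLike.congr_fun h P

end Functionals

/-! ### Vertex operators on polynomials and formal residues -/

section Residues

/-- `P(w) ↦ ∑_i P_i h_{N+i}(c)`: the coefficient of `u^N` in `P(u⁻¹) ∑_j h_j(c) u^j`. Formal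
residues of vertex operators take this form when they act on polynomials. -/
def vertexSum {A : Type*} [CommRing A] [Algebra ℂ A] (c : ℕ+ → A) (N : ℤ) :
    Polynomial A →ₗ[ℂ] A :=
  Polynomial.lsum fun i => LinearMap.mulRight ℂ (hInt c (N + i))

theorem vertexSum_monomial {A : Type*} [CommRing A] [Algebra ℂ A] (c : ℕ+ → A) (N : ℤ) (i : ℕ)
    (a : A) : vertexSum c N (Polynomial.monomial i a) = a * hInt c (N + i) := by
  rw [vertexSum, Polynomial.lsum_apply, Polynomial.sum_monomial_index]
  · rfl
  · exact map_zero _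

variable {σ : Type}

/-- The substitution `x_i ↦ x_i + η_i w^{g i}`. -/
def timeShift (η : σ → ℂ) (g : σ → ℕ+) :
    MvPolynomial σ ℂ →ₐ[ℂ] Polynomial (MvPolynomial σ ℂ) :=
  MvPolynomial.aeval
    ((fun i => η i • Polynomial.X ^ (g i : ℕ)) + fun i => Polynomial.C (MvPolynomial.X i))

theorem timeShift_X (η : σ → ℂ) (g : σ → ℕ+) (i : σ) : timeShift η g (MvPolynomial.X i) =
    η i • Polynomial.X ^ (g i : ℕ) + Polynomial.C (MvPolynomial.X i) := by
  rw [timeShift, MvPolynomial.aeval_X, Pi.add_apply]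

theorem timeShift_divPow [DecidableEq σ] (η : σ → ℂ) (g : σ → ℕ+) (d : σ →₀ ℕ) :
    timeShift η g (divPow MvPolynomial.X d) = ∑ p ∈ antidiagonal d, divPow η p.1 •
      Polynomial.monomial (Finsupp.weight (fun i => (g i : ℕ)) p.1)
        (divPow MvPolynomial.X p.2 : MvPolynomial σ ℂ) := by
  have h : (fun i => timeShift η g (MvPolynomial.X i)) =
      (fun i => η i • (Polynomial.X : Polynomial (MvPolynomial σ ℂ)) ^ (g i : ℕ)) +
        fun i => Polynomial.C (MvPolynomial.X i) := by
    funext i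
    rw [timeShift_X, Pi.add_apply]
  rw [map_divPow, h, divPow_add]
  refine Finset.sum_congr rfl fun p _ => ?_
  rw [divPow_smul_pow]
  have h2 := map_divPow (Polynomial.CAlgHom (R := ℂ) (A := MvPolynomial σ ℂ)) MvPolynomial.X p.2
  simp only [Polynomial.CAlgHom_apply] at h2
  rw [← h2, smul_mul_assoc, mul_comm, Polynomial.C_mul_X_pow_eq_monomial]

theorem vertexSum_timeShift_divPow [DecidableEq σ] (η : σ → ℂ) (g : σ → ℕ+)
    (c : ℕ+ → MvPolynomial σ ℂ) (N : ℤ) (d : σ →₀ ℕ) :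
    vertexSum c N (timeShift η g (divPow MvPolynomial.X d)) =
      ∑ p ∈ antidiagonal d, divPow η p.1 • (divPow MvPolynomial.X p.2 *
        hInt c (N + Finsupp.weight (fun i => (g i : ℕ)) p.1)) := by
  simp only [timeShift_divPow, map_sum, map_smul, vertexSum_monomial]

/-- The shifted times `t_i + c_i u^{g i}`. -/
def shiftedTime (c : σ → ℂ) (g : σ → ℕ+) (i : σ) : MvPowerSeries (Option σ) ℂ :=
  MvPowerSeries.X (some i) + MvPowerSeries.C (c i) * MvPowerSeries.X none ^ (g i : ℕ)

theorem hasSubst_shiftedTime (c : σ → ℂ) {g : σ → ℕ+} {fib : ℕ+ → Finset σ}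
    (hfib : ∀ k i, i ∈ fib k ↔ g i = k) : MvPowerSeries.HasSubst (shiftedTime c g) := by
  have h1 := hasSubst_X_comp (Option.some_injective σ)
  have h2 : MvPowerSeries.HasSubst fun i =>
      (MvPowerSeries.C (c i) * MvPowerSeries.X none ^ (g i : ℕ) : MvPowerSeries (Option σ) ℂ) := by
    classical
    refine ⟨fun i => by simp, fun d => ?_⟩
    by_cases hd : 0 < d none
    · obtain ⟨k, hk⟩ : ∃ k : ℕ+, (k : ℕ) = d none := ⟨⟨d none, hd⟩, rfl⟩
      refine (fib k).finite_toSet.subset fun i hi => ?_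
      rw [Finset.mem_coe, hfib]
      by_contra hne
      refine hi ?_
      rw [MvPowerSeries.coeff_C_mul, MvPowerSeries.coeff_X_pow, if_neg, mul_zero]
      intro h
      apply hne
      apply PNat.eq
      rw [hk, h, Finsupp.single_eq_same]
    · refine Set.finite_empty.subset fun i hi => hi ?_
      rw [MvPowerSeries.coeff_C_mul, MvPowerSeries.coeff_X_pow, if_neg, mul_zero]
      intro h
      rw [h, Finsupp.single_eq_same] at hd
      exact hd (g i).pos
  exact h1.add h2

theorem mapDomain_some_add_single (a : σ →₀ ℕ) (m : ℕ) :
    a.mapDomain some + Finsupp.single none m = a.optionElim m := by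
  ext (_ | i)
  · rw [Finsupp.add_apply, Finsupp.mapDomain_of_notMem_range _ _ (by simp)]
    simp
  · rw [Finsupp.add_apply, Finsupp.mapDomain_apply (Option.some_injective σ)]
    simp

theorem optionElim_inj {a b : σ →₀ ℕ} {m n : ℕ} :
    a.optionElim m = b.optionElim n ↔ a = b ∧ m = n := by
  constructor
  · intro h
    refine ⟨?_, ?_⟩
    · rw [← Finsupp.some_optionElim m a, h, Finsupp.some_optionElim]
    · have := DFunLike.congr_fun h none
      simpa using this
  · rintro ⟨rfl, rfl⟩
    rfl

theorem divPow_shiftedTime [DecidableEq σ] (c : σ → ℂ) (g : σ → ℕ+) (b : σ →₀ ℕ) :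
    divPow (shiftedTime c g) b = ∑ p ∈ antidiagonal b, MvPowerSeries.monomial
      (p.1.optionElim (Finsupp.weight (fun i => (g i : ℕ)) p.2))
      ((multiFactorial p.1)⁻¹ * divPow c p.2) := by
  have h : shiftedTime c g = (fun i => (MvPowerSeries.X (some i) : MvPowerSeries (Option σ) ℂ)) +
      fun i => c i • (MvPowerSeries.X none : MvPowerSeries (Option σ) ℂ) ^ (g i : ℕ) := by
    funext i
    rw [shiftedTime, Pi.add_apply, MvPowerSeries.smul_eq_C_mul]
  rw [h, divPow_add]
  refine Finset.sum_congr rfl fun p _ => ?_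
  rw [divPow_X_comp, divPow_smul_pow, MvPowerSeries.X_pow_eq, mul_smul_comm,
    MvPowerSeries.monomial_mul_monomial, mapDomain_some_add_single, mul_one, ← map_smul,
    smul_eq_mul, mul_comm]

/-- Taylor's formula for the shift of the times. -/
theorem coeff_subst_shiftedTime [DecidableEq σ] (c : σ → ℂ) {g : σ → ℕ+} {fib : ℕ+ → Finset σ}
    (hfib : ∀ k i, i ∈ fib k ↔ g i = k) (F : MvPowerSeries σ ℂ) (d : σ →₀ ℕ) (j : ℕ) :
    MvPowerSeries.coeff (d.optionElim j) (F.subst (shiftedTime c g)) =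
      dualPairing F (divPow MvPolynomial.X d * hEval (weightForm fib c) j) := by
  refine coeff_subst_eq_dualPairing (hasSubst_shiftedTime c hfib) F _ _ fun b => ?_
  rw [divPow_shiftedTime, map_sum, MvPolynomial.coeff_mul]
  refine Finset.sum_congr rfl fun p _ => ?_
  rw [divPow_X, MvPolynomial.coeff_monomial, coeff_hEval_weightForm hfib,
    MvPowerSeries.coeff_monomial]
  simp only [optionElim_inj]
  by_cases h1 : d = p.1
  · by_cases h2 : j = Finsupp.weight (fun i => (g i : ℕ)) p.2
    · rw [if_pos h1, if_pos h2.symm, if_pos ⟨h1, h2⟩, h1]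
    · rw [if_neg (Ne.symm h2), mul_zero]
      exact (if_neg fun h => h2 h.2).symm
  · rw [if_neg h1, zero_mul]
    exact (if_neg fun h => h1 h.1).symm

theorem ofPowerSeries_coeff_int (P : PowerSeries ℂ) (m : ℤ) :
    (HahnSeries.ofPowerSeries ℤ ℂ P).coeff m =
      if 0 ≤ m then PowerSeries.coeff m.toNat P else 0 := by
  split_ifs with h
  · obtain ⟨n, rfl⟩ := Int.eq_ofNat_of_zero_le h
    exact HahnSeries.ofPowerSeries_apply_coeff P n
  · rw [HahnSeries.ofPowerSeries_apply, HahnSeries.embDomain_of_notMem_range]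
    rintro ⟨n, hn⟩
    exact h (hn ▸ Int.natCast_nonneg n)

theorem coeff_toLaurent_shiftedTime [DecidableEq σ] (c : σ → ℂ) {g : σ → ℕ+}
    {fib : ℕ+ → Finset σ} (hfib : ∀ k i, i ∈ fib k ↔ g i = k) (F : MvPowerSeries σ ℂ)
    (d : σ →₀ ℕ) (m : ℤ) :
    (MvPowerSeries.coeff d (toLaurent (F.subst (shiftedTime c g)))).coeff m =
      dualPairing F (divPow MvPolynomial.X d * hInt (weightForm fib c) m) := by
  change (HahnSeries.ofPowerSeries ℤ ℂ (PowerSeries.mk fun j => _)).coeff m = _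
  rw [ofPowerSeries_coeff_int, hInt]
  split_ifs
  · rw [PowerSeries.coeff_mk, coeff_subst_shiftedTime c hfib]
  · rw [mul_zero, map_zero]

theorem algebraMap_laurentSeries (a : ℂ) :
    algebraMap ℂ (LaurentSeries ℂ) a = HahnSeries.single (0 : ℤ) a := by
  rw [HahnSeries.algebraMap_apply', MvPowerSeries.algebraMap_apply, Algebra.algebraMap_self_apply]
  exact HahnSeries.ofPowerSeries_C a

/-- The residue of a product of an exponential and a power series in shifted times, as a functional
of the power series. -/
theorem coeff_laurentCoeff [DecidableEq σ] (c η : σ → ℂ) {g : σ → ℕ+} {fib : ℕ+ → Finset σ}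
    (hfib : ∀ k i, i ∈ fib k ↔ g i = k) (F : MvPowerSeries σ ℂ) (d : σ →₀ ℕ) (p r : ℤ)
    {κ : σ → LaurentSeries ℂ} (hκ : ∀ i, κ i = HahnSeries.single (0 : ℤ) (η i) *
      HahnSeries.single (-1 : ℤ) (1 : ℂ) ^ (g i : ℕ)) :
    MvPowerSeries.coeff d (laurentCoeff r (MvPowerSeries.C (HahnSeries.single p (1 : ℂ)) *
      expSeries (linearForm κ) * toLaurent (F.subst (shiftedTime c g)))) =
      dualPairing F (vertexSum (weightForm fib c) (r - p)
        (timeShift η g (divPow MvPolynomial.X d))) := by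
  have hκ' : κ = fun i => algebraMap ℂ (LaurentSeries ℂ) (η i) *
      HahnSeries.single (-1 : ℤ) (1 : ℂ) ^ (g i : ℕ) := funext fun i => by
    rw [hκ, algebraMap_laurentSeries]
  change (MvPowerSeries.coeff d (MvPowerSeries.C (HahnSeries.single p (1 : ℂ)) *
      expSeries (linearForm κ) * toLaurent (F.subst (shiftedTime c g)))).coeff r = _
  rw [mul_assoc, MvPowerSeries.coeff_C_mul, HahnSeries.coeff_single_mul, one_mul,
    MvPowerSeries.coeff_mul, HahnSeries.coeff_sum, vertexSum_timeShift_divPow, map_sum]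
  refine Finset.sum_congr rfl fun q _ => ?_
  rw [coeff_expSeries_linearForm, hκ', divPow_algebraMap_mul_pow, HahnSeries.single_pow, one_pow,
    algebraMap_laurentSeries, mul_assoc, HahnSeries.coeff_single_mul, HahnSeries.coeff_single_mul,
    one_mul, coeff_toLaurent_shiftedTime c hfib, map_smul]
  rw [smul_eq_mul, nsmul_eq_mul]
  congr 4
  ring

end Residues

/-! ### The boson–fermion correspondence -/

section BosonFermion

theorem vertexSum_C_mul {A : Type*} [CommRing A] [Algebra ℂ A] (c : ℕ+ → A) (N : ℤ) (a : A)
    (P : Polynomial A) : vertexSum c N (Polynomial.C a * P) = a * vertexSum c N P := by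
  induction P using Polynomial.induction_on' with
  | add P Q hP hQ => rw [mul_add, map_add, map_add, hP, hQ, mul_add]
  | monomial i b =>
    rw [Polynomial.C_mul_monomial, vertexSum_monomial, vertexSum_monomial, mul_assoc]

theorem vertexSum_X_pow_mul {A : Type*} [CommRing A] [Algebra ℂ A] (c : ℕ+ → A) (N : ℤ) (k : ℕ)
    (P : Polynomial A) : vertexSum c N (Polynomial.X ^ k * P) = vertexSum c (N + k) P := by
  induction P using Polynomial.induction_on' with
  | add P Q hP hQ => rw [mul_add, map_add, map_add, hP, hQ]
  | monomial i b =>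
    rw [Polynomial.X_pow_mul_monomial, vertexSum_monomial, vertexSum_monomial]
    congr 2
    push_cast
    ring

theorem hInt_mul_support_finite {A : Type*} [CommRing A] [Algebra ℂ A] (c c' : ℕ+ → A) (n : ℤ) :
    (Function.support fun k => hInt c k * hInt c' (n - k)).Finite := by
  refine (Set.finite_Icc 0 n).subset fun k hk => ⟨?_, ?_⟩
  · by_contra h
    exact hk (by simp only [hInt_of_neg c (not_le.1 h), zero_mul])
  · by_contra h
    exact hk (by simp only [hInt_of_neg c' (sub_neg.2 (not_le.1 h)), mul_zero])

theorem hInt_add {A : Type*} [CommRing A] [Algebra ℂ A] (c c' : ℕ+ → A) (n : ℤ) :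
    hInt (c + c') n = ∑ᶠ k : ℤ, hInt c k * hInt c' (n - k) := by
  by_cases hn : 0 ≤ n
  · obtain ⟨m, rfl⟩ := Int.eq_ofNat_of_zero_le hn
    rw [hInt_natCast, hEval_add, Finset.Nat.sum_antidiagonal_eq_sum_range_succ_mk,
      finsum_eq_sum_of_support_subset (s := (Finset.range (m + 1)).map Nat.castEmbedding)]
    · rw [Finset.sum_map]
      refine Finset.sum_congr rfl fun k hk => ?_
      rw [Finset.mem_range] at hk
      rw [Nat.castEmbedding_apply, hInt_natCast, ← Nat.cast_sub (by omega), hInt_natCast]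
    · intro k hk
      rw [Finset.mem_coe, Finset.mem_map]
      have h1 : 0 ≤ k := by
        by_contra h
        exact hk (by simp only [hInt_of_neg c (not_le.1 h), zero_mul])
      have h2 : k ≤ m := by
        by_contra h
        exact hk (by simp only [hInt_of_neg c' (sub_neg.2 (not_le.1 h)), mul_zero])
      exact ⟨k.toNat, Finset.mem_range.2 (by omega), Int.toNat_of_nonneg h1⟩
  · rw [hInt_of_neg _ (not_le.1 hn)]
    symm
    refine finsum_eq_zero_of_forall_eq_zero fun k => ?_
    by_cases hk : k < 0
    · rw [hInt_of_neg _ hk, zero_mul]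
    · rw [hInt_of_neg c' (by omega), mul_zero]

/-- The creation part `J_{-k}`, `k ≥ 1`, of the currents. -/
def raising (k : ℕ+) : Module.End ℂ Fock := current (-((k : ℕ) : ℤ))

theorem raising_comm (k l : ℕ+) : raising k * raising l = raising l * raising k :=
  LinearMap.ext fun v => current_comm (by exact_mod_cast k.pos) (by exact_mod_cast l.pos) v

theorem raising_psi (k : ℕ+) (i : ℤ) (v : Fock) :
    raising k (psi i v) = psi i (raising k v) + psi (i + (k : ℕ)) v :=
  current_psi (by exact_mod_cast k.ne_zero) i v

theorem raising_psiStar (k : ℕ+) (i : ℤ) (v : Fock) :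
    raising k (psiStar i v) = psiStar i (raising k v) - psiStar (i - (k : ℕ)) v :=
  current_psiStar (by exact_mod_cast k.ne_zero) i v

/-- The action of polynomials on the Fock space with `x_k` acting by `J_{-k}`. -/
def bosonAction : MvPolynomial ℕ+ ℂ →ₐ[ℂ] Module.End ℂ Fock := commAeval raising raising_comm

theorem bosonAction_X (k : ℕ+) : bosonAction (MvPolynomial.X k) = raising k :=
  commAeval_X raising raising_comm k

theorem sum_Icc_eq_sum_antidiagonal {M : Type*} [AddCommMonoid M] (n : ℕ) (f : ℤ → M) :
    ∑ K ∈ Finset.Icc (1 : ℤ) (n + 1 : ℕ), f K = ∑ p ∈ antidiagonal n, f ((p.2 + 1 : ℕ) : ℤ) := by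
  symm
  refine Finset.sum_bij (fun p _ => ((p.2 + 1 : ℕ) : ℤ)) ?_ ?_ ?_ ?_
  · rintro ⟨a, b⟩ h
    rw [mem_antidiagonal] at h
    rw [Finset.mem_Icc]
    dsimp only at h ⊢
    omega
  · rintro ⟨a, b⟩ h ⟨a', b'⟩ h' he
    rw [mem_antidiagonal] at h h'
    dsimp only at h h' he
    rw [Prod.mk.injEq]
    omega
  · intro K hK
    rw [Finset.mem_Icc] at hK
    refine ⟨(n + 1 - K.toNat, K.toNat - 1), ?_, ?_⟩
    · rw [mem_antidiagonal]
      dsimp only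
      omega
    · dsimp only
      omega
  · intro p _
    rfl

theorem natCast_succPNat (n : ℕ) : ((Nat.succPNat n : ℕ+) : ℕ) = n + 1 := rfl

theorem succ_nsmul_inv_smul {M : Type*} [AddCommGroup M] [Module ℂ M] (n : ℕ) (x : M) :
    (n + 1) • ((((Nat.succPNat n : ℕ+) : ℕ) : ℂ)⁻¹ • x) = x := by
  rw [natCast_succPNat, ← Nat.cast_smul_eq_nsmul ℂ, smul_smul,
    mul_inv_cancel₀ (Nat.cast_ne_zero.2 (Nat.succ_ne_zero n)), one_smul]

/-- The neighbours `ψ_{m+j}|m⟩` of the vacuum in terms of the currents. -/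
theorem psi_vac_eq_bosonAction (m : ℤ) (j : ℕ) : psi (m + j) (vac m) = bosonAction
    (hEval (fun k => (((k : ℕ) : ℂ)⁻¹) • MvPolynomial.X k) j) (vac (m + 1)) := by
  induction j using Nat.strong_induction_on with
  | _ j ih =>
    cases j with
    | zero => rw [Nat.cast_zero, add_zero, psi_vac_self, hEval_zero, map_one, Module.End.one_apply]
    | succ n =>
      apply nsmul_right_injective' (n := n)
      have h := psi_vac_recursion m (n + 1)
      rw [Nat.cast_smul_eq_nsmul] at h
      rw [h, sum_Icc_eq_sum_antidiagonal, ← LinearMap.smul_apply, ← map_nsmul, hEval_succ, map_sum,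
        LinearMap.sum_apply]
      refine Finset.sum_congr rfl fun p hp => ?_
      have hp' := mem_antidiagonal.1 hp
      rw [succ_nsmul_inv_smul, mul_comm, map_mul, bosonAction_X, Module.End.mul_apply,
        ← ih p.1 (Nat.lt_succ_of_le (antidiagonal.fst_le hp)), raising, natCast_succPNat]
      congr 2
      rw [← hp']
      push_cast
      ring_nf

/-- The neighbours `ψ*_{m-1-j}|m⟩` of the vacuum in terms of the currents. -/
theorem psiStar_vac_eq_bosonAction (m : ℤ) (j : ℕ) : psiStar (m - 1 - j) (vac m) = bosonAction
    (hEval (fun k => -((((k : ℕ) : ℂ)⁻¹) • MvPolynomial.X k)) j) (vac (m - 1)) := by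
  induction j using Nat.strong_induction_on with
  | _ j ih =>
    cases j with
    | zero =>
      have h := psiStar_vac_self (m - 1)
      rw [sub_add_cancel] at h
      rw [Nat.cast_zero, sub_zero, h, hEval_zero, map_one, Module.End.one_apply]
    | succ n =>
      apply nsmul_right_injective' (n := n)
      have h := psiStar_vac_recursion m (n + 1)
      rw [Nat.cast_smul_eq_nsmul] at h
      rw [h, sum_Icc_eq_sum_antidiagonal, ← LinearMap.smul_apply, ← map_nsmul, hEval_succ, map_sum,
        LinearMap.sum_apply, ← Finset.sum_neg_distrib]
      refine Finset.sum_congr rfl fun p hp => ?_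
      have hp' := mem_antidiagonal.1 hp
      rw [smul_neg, succ_nsmul_inv_smul, mul_comm, map_mul, map_neg, bosonAction_X,
        Module.End.mul_apply, LinearMap.neg_apply,
        ← ih p.1 (Nat.lt_succ_of_le (antidiagonal.fst_le hp)), raising, natCast_succPNat]
      congr 3
      rw [← hp']
      push_cast
      ring_nf

theorem psi_vac_eq (m K : ℤ) : psi K (vac m) = bosonAction
    (hInt (fun k => (((k : ℕ) : ℂ)⁻¹) • MvPolynomial.X k) (K - m)) (vac (m + 1)) := by
  by_cases h : m ≤ K
  · obtain ⟨j, hj⟩ := Int.eq_ofNat_of_zero_le (sub_nonneg.2 h)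
    rw [hj, hInt_natCast, ← psi_vac_eq_bosonAction, ← hj, add_sub_cancel]
  · rw [psi_vac_of_lt (by omega), hInt_of_neg _ (by omega), map_zero, LinearMap.zero_apply]

theorem psiStar_vac_eq (m K : ℤ) : psiStar K (vac m) = bosonAction
    (hInt (fun k => -((((k : ℕ) : ℂ)⁻¹) • MvPolynomial.X k)) (m - 1 - K)) (vac (m - 1)) := by
  by_cases h : K ≤ m - 1
  · obtain ⟨j, hj⟩ := Int.eq_ofNat_of_zero_le (sub_nonneg.2 h)
    rw [hj, hInt_natCast, ← psiStar_vac_eq_bosonAction, ← hj, sub_sub_cancel]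
  · rw [psiStar_vac_of_le (by omega), hInt_of_neg _ (by omega), map_zero, LinearMap.zero_apply]

/-- The currents acting on the two factors of `Fock ⊗ Fock`. -/
def raising₂ : ℕ+ ⊕ ℕ+ → Module.End ℂ (Fock ⊗[ℂ] Fock) :=
  Sum.elim (fun k => LinearMap.rTensor Fock (raising k)) fun k => LinearMap.lTensor Fock (raising k)

theorem raising₂_comm (i j : ℕ+ ⊕ ℕ+) : raising₂ i * raising₂ j = raising₂ j * raising₂ i := by
  have h := fun k l v => DFunLike.congr_fun (raising_comm k l) v
  simp only [Module.End.mul_apply] at h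
  rcases i with k | k <;> rcases j with l | l <;>
    refine TensorProduct.ext' fun u v => ?_ <;> simp [raising₂, h k l]

/-- The action of polynomials in two sets of variables on `Fock ⊗ Fock`. -/
def bosonAction₂ : MvPolynomial (ℕ+ ⊕ ℕ+) ℂ →ₐ[ℂ] Module.End ℂ (Fock ⊗[ℂ] Fock) :=
  commAeval raising₂ raising₂_comm

theorem bosonAction₂_X (i : ℕ+ ⊕ ℕ+) : bosonAction₂ (MvPolynomial.X i) = raising₂ i :=
  commAeval_X raising₂ raising₂_comm i

theorem bosonAction₂_rename_inl (P : MvPolynomial ℕ+ ℂ) (u v : Fock) :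
    bosonAction₂ (MvPolynomial.rename Sum.inl P) (u ⊗ₜ v) = bosonAction P u ⊗ₜ v := by
  induction P using MvPolynomial.induction_on generalizing u with
  | C a =>
    rw [MvPolynomial.rename_C, ← MvPolynomial.algebraMap_eq, ← MvPolynomial.algebraMap_eq,
      AlgHom.commutes, AlgHom.commutes, Module.algebraMap_end_apply, Module.algebraMap_end_apply,
      TensorProduct.smul_tmul']
  | add P Q hP hQ =>
    rw [map_add, map_add, map_add, LinearMap.add_apply, LinearMap.add_apply, hP, hQ,
      TensorProduct.add_tmul]
  | mul_X P k hP =>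
    rw [map_mul, map_mul, map_mul, MvPolynomial.rename_X, bosonAction₂_X, bosonAction_X,
      Module.End.mul_apply, Module.End.mul_apply, raising₂, Sum.elim_inl,
      LinearMap.rTensor_tmul, hP]

theorem bosonAction₂_rename_inr (P : MvPolynomial ℕ+ ℂ) (u v : Fock) :
    bosonAction₂ (MvPolynomial.rename Sum.inr P) (u ⊗ₜ v) = u ⊗ₜ bosonAction P v := by
  induction P using MvPolynomial.induction_on generalizing v with
  | C a =>
    rw [MvPolynomial.rename_C, ← MvPolynomial.algebraMap_eq, ← MvPolynomial.algebraMap_eq,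
      AlgHom.commutes, AlgHom.commutes, Module.algebraMap_end_apply, Module.algebraMap_end_apply,
      TensorProduct.tmul_smul]
  | add P Q hP hQ =>
    rw [map_add, map_add, map_add, LinearMap.add_apply, LinearMap.add_apply, hP, hQ,
      TensorProduct.tmul_add]
  | mul_X P k hP =>
    rw [map_mul, map_mul, map_mul, MvPolynomial.rename_X, bosonAction₂_X, bosonAction_X,
      Module.End.mul_apply, Module.End.mul_apply, raising₂, Sum.elim_inr,
      LinearMap.lTensor_tmul, hP]

theorem bosonAction₂_mul (P Q : MvPolynomial ℕ+ ℂ) (u v : Fock) :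
    bosonAction₂ (MvPolynomial.rename Sum.inl P * MvPolynomial.rename Sum.inr Q) (u ⊗ₜ v) =
      bosonAction P u ⊗ₜ bosonAction Q v := by
  rw [map_mul, Module.End.mul_apply, bosonAction₂_rename_inr, bosonAction₂_rename_inl]

theorem finite_exchange_support (s : ℤ) (u v : Fock) :
    (Function.support fun K : ℤ => psiStar K u ⊗ₜ[ℂ] psi (K + s) v).Finite := by
  obtain ⟨b, hb⟩ := exists_psiStar_eq_zero u
  obtain ⟨a, ha⟩ := exists_psi_eq_zero v
  refine (Set.finite_Ico (a - s) b).subset fun K hK => ⟨?_, ?_⟩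
  · by_contra h
    exact hK (by simp only [ha (K + s) (by omega), TensorProduct.tmul_zero])
  · by_contra h
    exact hK (by simp only [hb K (by omega), TensorProduct.zero_tmul])

/-- The operator `∑_K ψ*_K ⊗ ψ_{K+s}`. -/
def exchange (s : ℤ) : Fock ⊗[ℂ] Fock →ₗ[ℂ] Fock ⊗[ℂ] Fock :=
  TensorProduct.lift <| LinearMap.mk₂ ℂ
    (fun u v => ∑ᶠ K : ℤ, psiStar K u ⊗ₜ[ℂ] psi (K + s) v)
    (fun u u' v => by
      simp only [map_add, TensorProduct.add_tmul]
      exact finsum_add_distrib (finite_exchange_support s u v) (finite_exchange_support s u' v))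
    (fun a u v => by
      simp only [map_smul, ← TensorProduct.smul_tmul']
      exact (smul_finsum' a (finite_exchange_support s u v)).symm)
    (fun u v v' => by
      simp only [map_add, TensorProduct.tmul_add]
      exact finsum_add_distrib (finite_exchange_support s u v) (finite_exchange_support s u v'))
    (fun a u v => by
      simp only [map_smul, TensorProduct.tmul_smul]
      exact (smul_finsum' a (finite_exchange_support s u v)).symm)

theorem exchange_tmul (s : ℤ) (u v : Fock) :
    exchange s (u ⊗ₜ v) = ∑ᶠ K : ℤ, psiStar K u ⊗ₜ[ℂ] psi (K + s) v := rfl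

theorem exchange_raising₂_inl (s : ℤ) (k : ℕ+) (w : Fock ⊗[ℂ] Fock) :
    exchange s (raising₂ (Sum.inl k) w) =
      raising₂ (Sum.inl k) (exchange s w) + exchange (s + (k : ℕ)) w := by
  induction w using TensorProduct.induction_on with
  | zero => simp
  | add w w' hw hw' =>
    simp only [map_add, hw, hw']
    abel
  | tmul u v =>
    have h : ∀ K : ℤ, psiStar K (raising k u) ⊗ₜ[ℂ] psi (K + s) v =
        LinearMap.rTensor Fock (raising k) (psiStar K u ⊗ₜ[ℂ] psi (K + s) v) +
          psiStar (K - (k : ℕ)) u ⊗ₜ[ℂ] psi (K - (k : ℕ) + (s + (k : ℕ))) v := by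
      intro K
      rw [LinearMap.rTensor_tmul, raising_psiStar,
        show K - ((k : ℕ) : ℤ) + (s + (k : ℕ)) = K + s by ring, ← TensorProduct.add_tmul,
        sub_add_cancel]
    have hf := finite_exchange_support s u v
    have hg := finite_exchange_support (s + (k : ℕ)) u v
    simp only [raising₂, Sum.elim_inl, LinearMap.rTensor_tmul, exchange_tmul]
    rw [map_finsum _ hf]
    simp only [h]
    rw [finsum_add_distrib]
    · congr 1
      exact finsum_comp_equiv (Equiv.subRight ((k : ℕ) : ℤ))
        (f := fun K => psiStar K u ⊗ₜ[ℂ] psi (K + (s + (k : ℕ))) v)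
    · refine hf.subset fun K hK hK' => hK ?_
      dsimp only at hK' ⊢
      rw [hK', map_zero]
    · exact hg.preimage (f := fun K => K - ((k : ℕ) : ℤ)) (sub_left_injective).injOn

theorem exchange_raising₂_inr (s : ℤ) (k : ℕ+) (w : Fock ⊗[ℂ] Fock) :
    exchange s (raising₂ (Sum.inr k) w) =
      raising₂ (Sum.inr k) (exchange s w) + (-1 : ℂ) • exchange (s + (k : ℕ)) w := by
  induction w using TensorProduct.induction_on with
  | zero => simp
  | add w w' hw hw' =>
    simp only [map_add, hw, hw', smul_add]
    abel
  | tmul u v =>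
    have h : ∀ K : ℤ, psiStar K u ⊗ₜ[ℂ] psi (K + s) (raising k v) =
        LinearMap.lTensor Fock (raising k) (psiStar K u ⊗ₜ[ℂ] psi (K + s) v) +
          (-1 : ℂ) • (psiStar K u ⊗ₜ[ℂ] psi (K + (s + (k : ℕ))) v) := by
      intro K
      rw [LinearMap.lTensor_tmul, raising_psi, ← add_assoc, ← TensorProduct.tmul_smul,
        ← TensorProduct.tmul_add, neg_one_smul, add_neg_cancel_right]
    have hf := finite_exchange_support s u v
    have hg := finite_exchange_support (s + (k : ℕ)) u v
    simp only [raising₂, Sum.elim_inr, LinearMap.lTensor_tmul, exchange_tmul]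
    rw [map_finsum _ hf]
    simp only [h]
    rw [finsum_add_distrib, smul_finsum' _ hg]
    · refine hf.subset fun K hK hK' => hK ?_
      dsimp only at hK' ⊢
      rw [hK', map_zero]
    · refine hg.subset fun K hK hK' => hK ?_
      dsimp only at hK' ⊢
      rw [hK', smul_zero]

/-- The differences `(y_k - x_k) / k`. -/
def relativeTime (k : ℕ+) : MvPolynomial (ℕ+ ⊕ ℕ+) ℂ :=
  (((k : ℕ) : ℂ)⁻¹) • (MvPolynomial.X (Sum.inr k) - MvPolynomial.X (Sum.inl k))

theorem exchange_vac (s m m' : ℤ) : exchange s (vac m ⊗ₜ vac m') =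
    bosonAction₂ (hInt relativeTime (m - 1 - m' + s)) (vac (m - 1) ⊗ₜ vac (m' + 1)) := by
  have hc : (relativeTime : ℕ+ → MvPolynomial (ℕ+ ⊕ ℕ+) ℂ) =
      (fun k : ℕ+ => MvPolynomial.rename Sum.inl
        (-((((k : ℕ) : ℂ)⁻¹) • (MvPolynomial.X k : MvPolynomial ℕ+ ℂ)))) +
        fun k : ℕ+ => MvPolynomial.rename Sum.inr
          ((((k : ℕ) : ℂ)⁻¹) • (MvPolynomial.X k : MvPolynomial ℕ+ ℂ)) := by
    funext k
    rw [Pi.add_apply, map_neg, map_smul, map_smul, MvPolynomial.rename_X, MvPolynomial.rename_X,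
      relativeTime, smul_sub]
    abel
  rw [hc, hInt_add]
  simp only [← map_hInt]
  have h := (LinearMap.applyₗ (R := ℂ) (vac (m - 1) ⊗ₜ[ℂ] vac (m' + 1)) ∘ₗ
    bosonAction₂.toLinearMap).toAddMonoidHom.map_finsum
      (f := fun k : ℤ => MvPolynomial.rename Sum.inl
          (hInt (fun k : ℕ+ => -((((k : ℕ) : ℂ)⁻¹) • MvPolynomial.X k)) k) *
        MvPolynomial.rename Sum.inr
          (hInt (fun k : ℕ+ => (((k : ℕ) : ℂ)⁻¹) • MvPolynomial.X k) (m - 1 - m' + s - k))) (by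
        simp only [map_hInt]
        exact hInt_mul_support_finite _ _ _)
  refine Eq.trans ?_ h.symm
  rw [exchange_tmul, ← finsum_comp_equiv (Equiv.subLeft (m - 1))]
  refine finsum_congr fun K => ?_
  rw [Equiv.subLeft_apply, psi_vac_eq, psiStar_vac_eq, sub_sub_cancel]
  refine Eq.trans ?_ (bosonAction₂_mul _ _ _ _).symm
  congr 4
  ring

/-- The shift `x_k ↦ x_k + w^k`, `y_k ↦ y_k - w^k` of two sets of times. -/
abbrev pairShift : MvPolynomial (ℕ+ ⊕ ℕ+) ℂ →ₐ[ℂ] Polynomial (MvPolynomial (ℕ+ ⊕ ℕ+) ℂ) :=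
  timeShift (Sum.elim 1 (-1)) (Sum.elim id id)

/-- The bosonic form of `∑_K ψ*_K ⊗ ψ_{K+s}`: on states generated from the vacua by the currents it
is the residue of a vertex operator in the relative times. Commuting a current through the operator
changes `s`, which is the shift of the times; on the vacua themselves it is `exchange_vac`. -/
theorem exchange_bosonAction₂ (s m m' : ℤ) (P : MvPolynomial (ℕ+ ⊕ ℕ+) ℂ) :
    exchange s (bosonAction₂ P (vac m ⊗ₜ vac m')) =
      bosonAction₂ (vertexSum relativeTime (m - 1 - m' + s) (pairShift P))
        (vac (m - 1) ⊗ₜ vac (m' + 1)) := by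
  induction P using MvPolynomial.induction_on generalizing s with
  | C a =>
    have h1 : pairShift (MvPolynomial.C a) = Polynomial.C (MvPolynomial.C a) :=
      AlgHom.commutes pairShift a
    rw [h1, ← mul_one (Polynomial.C _), vertexSum_C_mul, ← Polynomial.monomial_zero_one,
      vertexSum_monomial, one_mul, Nat.cast_zero, add_zero, map_mul, ← MvPolynomial.algebraMap_eq,
      AlgHom.commutes, Module.End.mul_apply, Module.algebraMap_end_apply,
      Module.algebraMap_end_apply, map_smul, exchange_vac]
  | add P Q hP hQ =>
    simp only [map_add, LinearMap.add_apply, hP, hQ]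
  | mul_X P i hP =>
    rw [mul_comm, map_mul, map_mul, bosonAction₂_X, Module.End.mul_apply, pairShift, timeShift_X,
      add_mul, map_add, vertexSum_C_mul, smul_mul_assoc, map_smul, vertexSum_X_pow_mul]
    rcases i with k | k
    · rw [exchange_raising₂_inl, hP, hP, map_add, map_mul, bosonAction₂_X, LinearMap.add_apply,
        Module.End.mul_apply, add_comm, ← add_assoc]
      simp
    · rw [exchange_raising₂_inr, hP, hP, map_add, map_mul, bosonAction₂_X, LinearMap.add_apply,
        Module.End.mul_apply, add_comm, ← add_assoc, map_smul, LinearMap.smul_apply]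
      simp

end BosonFermion

/-! ### Group-like operators and tau-functions -/

section Tau

/-- The matrix elements of `G` as a bilinear form. -/
def Operator.form (G : Operator) : Fock →ₗ[ℂ] Fock →ₗ[ℂ] ℂ :=
  LinearMap.mk₂ ℂ G.elt
    (fun U U' V => by
      classical
      rw [Operator.elt, Operator.elt, Operator.elt, Finsupp.sum_add_index']
      · simp
      · intro S a a'
        simp only [add_mul, Finsupp.sum, Finset.sum_add_distrib])
    (fun c U V => by
      rw [Operator.elt, Operator.elt, Finsupp.sum_smul_index' (by simp), smul_eq_mul,
        Finsupp.mul_sum]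
      simp only [Finsupp.mul_sum, smul_eq_mul, mul_assoc])
    (fun U V V' => by
      classical
      rw [Operator.elt, Operator.elt, Operator.elt, ← Finsupp.sum_add]
      refine Finsupp.sum_congr fun S _ => ?_
      rw [Finsupp.sum_add_index']
      · simp
      · intro T b b'
        rw [mul_add])
    (fun c U V => by
      rw [Operator.elt, Operator.elt, smul_eq_mul, Finsupp.mul_sum]
      refine Finsupp.sum_congr fun S _ => ?_
      rw [Finsupp.sum_smul_index' (by simp), Finsupp.mul_sum]
      refine Finsupp.sum_congr fun T _ => ?_
      rw [smul_eq_mul]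
      ring)

/-- The matrix elements of `G ⊗ G`. -/
def Operator.form₂ (G : Operator) : Fock ⊗[ℂ] Fock →ₗ[ℂ] Fock ⊗[ℂ] Fock →ₗ[ℂ] ℂ :=
  (TensorProduct.map₂ G.form G.form).compr₂ (LinearMap.mul' ℂ ℂ)

theorem Operator.form₂_tmul (G : Operator) (U U' V V' : Fock) :
    G.form₂ (U ⊗ₜ U') (V ⊗ₜ V') = G.elt U V * G.elt U' V' := by
  rw [Operator.form₂, LinearMap.compr₂_apply, TensorProduct.map₂_apply_tmul,
    TensorProduct.map_tmul, LinearMap.mul'_apply]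
  rfl

/-- The transpose `∑_K ψ_K ⊗ ψ*_K` of the operator `∑_K ψ*_K ⊗ ψ_K`. -/
def coexchange : Fock ⊗[ℂ] Fock →ₗ[ℂ] Fock ⊗[ℂ] Fock :=
  (TensorProduct.comm ℂ Fock Fock).toLinearMap ∘ₗ exchange 0 ∘ₗ
    (TensorProduct.comm ℂ Fock Fock).toLinearMap

/-- The basic bilinear condition says that `G ⊗ G` commutes with `∑_K ψ_K ⊗ ψ*_K`. -/
theorem GroupLike.form₂_exchange {G : Operator} (hG : GroupLike G) (a b : Fock ⊗[ℂ] Fock) :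
    G.form₂ (exchange 0 a) b = G.form₂ a (coexchange b) := by
  induction a using TensorProduct.induction_on with
  | zero => simp
  | add a a' ha ha' => simp only [map_add, LinearMap.add_apply, ha, ha']
  | tmul U U' =>
    induction b using TensorProduct.induction_on with
    | zero => simp
    | add b b' hb hb' => simp only [map_add, hb, hb']
    | tmul V V' =>
      have h1 := (G.form₂.flip (V ⊗ₜ[ℂ] V')).toAddMonoidHom.map_finsum
        (finite_exchange_support 0 U U')
      have h2 := ((G.form₂ (U ⊗ₜ[ℂ] U')).comp
        (TensorProduct.comm ℂ Fock Fock).toLinearMap).toAddMonoidHom.map_finsum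
        (finite_exchange_support 0 V' V)
      refine Eq.trans h1 (Eq.trans ?_ h2.symm)
      have h := hG U U' V V'
      refine Eq.trans (finsum_congr fun K => ?_) (Eq.trans h (finsum_congr fun K => ?_))
      · change G.form₂ (psiStar K U ⊗ₜ[ℂ] psi (K + 0) U') (V ⊗ₜ[ℂ] V') = _
        rw [Operator.form₂_tmul, add_zero]
        rfl
      · change _ = G.form₂ (U ⊗ₜ[ℂ] U') (psi (K + 0) V ⊗ₜ[ℂ] psiStar K V')
        rw [Operator.form₂_tmul, add_zero]

/-- The sign change of all variables. -/
def negVars {σ : Type} : MvPolynomial σ ℂ →ₐ[ℂ] MvPolynomial σ ℂ :=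
  MvPolynomial.aeval fun i => -MvPolynomial.X i

theorem negVars_X {σ : Type} (i : σ) :
    negVars (MvPolynomial.X i : MvPolynomial σ ℂ) = -MvPolynomial.X i := by
  rw [negVars, MvPolynomial.aeval_X]

theorem coeff_expJPlus (d : ℕ+ →₀ ℕ) :
    MvPowerSeries.coeff d expJPlus = bosonAction (divPow MvPolynomial.X d) := by
  have h : (fun k : ℕ+ => braCurrent ((k : ℕ) : ℤ)) = raising := by
    funext k
    rw [braCurrent_eq, raising]
  rw [expJPlus, h]
  exact coeff_expSeries_linearForm_eq_commAeval raising_comm d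

theorem coeff_expNegJMinus (d : ℕ+ →₀ ℕ) :
    MvPowerSeries.coeff d expNegJMinus = bosonAction (negVars (divPow MvPolynomial.X d)) := by
  have hc : ∀ i j, (-raising) i * (-raising) j = (-raising) j * (-raising) i := fun i j => by
    have h := fun v => DFunLike.congr_fun (raising_comm i j) v
    simp only [Module.End.mul_apply] at h
    refine LinearMap.ext fun v => ?_
    simp only [Pi.neg_apply, Module.End.mul_apply, LinearMap.neg_apply, map_neg, h]
  have h : expNegJMinus = expSeries (linearForm (-raising)) := by
    rw [← neg_linearForm]
    rfl
  rw [h]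
  refine (coeff_expSeries_linearForm_eq_commAeval hc d).trans ?_
  have h2 : commAeval (-raising) hc = bosonAction.comp negVars := by
    refine MvPolynomial.algHom_ext fun k => ?_
    rw [commAeval_X, AlgHom.comp_apply, negVars_X, map_neg, bosonAction_X, Pi.neg_apply]
  rw [← AlgHom.comp_apply, ← h2]

theorem coeff_mkpTau (G : Operator) (q n : ℤ) (d : ℕ+ →₀ ℕ) :
    MvPowerSeries.coeff d (mkpTau G q n) =
      G.elt (bosonAction (divPow MvPolynomial.X d) (vac n)) (vac (n - q)) := by
  rw [← coeff_expJPlus]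
  rfl

theorem coeff_todaTau (G : Operator) (q n : ℤ) (a b : ℕ+ →₀ ℕ) :
    MvPowerSeries.coeff (sumIndex a b) (todaTau G q n) =
      G.elt (bosonAction (divPow MvPolynomial.X a) (vac n))
        (bosonAction (negVars (divPow MvPolynomial.X b)) (vac (n - q))) := by
  rw [← coeff_expJPlus, ← coeff_expNegJMinus]
  change G.elt (MvPowerSeries.coeff (Finsupp.sumFinsuppEquivProdFinsupp (sumIndex a b)).1 expJPlus
      (vac n)) (MvPowerSeries.coeff (Finsupp.sumFinsuppEquivProdFinsupp (sumIndex a b)).2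
        expNegJMinus (vac (n - q))) = _
  rw [sumIndex, Equiv.apply_symm_apply]

theorem dualPairing_mkpTau (G : Operator) (q n n' : ℤ) (P : MvPolynomial (ℕ+ ⊕ ℕ+) ℂ) :
    dualPairing (outerProduct (mkpTau G q n) (mkpTau G q n')) P =
      G.form₂ (bosonAction₂ P (vac n ⊗ₜ vac n')) (vac (n - q) ⊗ₜ vac (n' - q)) := by
  have h : dualPairing (outerProduct (mkpTau G q n) (mkpTau G q n')) =
      (G.form₂.flip (vac (n - q) ⊗ₜ vac (n' - q))) ∘ₗ
        (LinearMap.applyₗ (R := ℂ) (vac n ⊗ₜ[ℂ] vac n')) ∘ₗ bosonAction₂.toLinearMap := by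
    refine dualPairing_eq fun b => ?_
    obtain ⟨a, b, rfl⟩ := exists_sumIndex b
    simp only [LinearMap.comp_apply, AlgHom.toLinearMap_apply, LinearMap.applyₗ_apply_apply,
      LinearMap.flip_apply]
    rw [coeff_outerProduct, coeff_mkpTau, coeff_mkpTau, ← rename_divPow_mul, bosonAction₂_mul,
      Operator.form₂_tmul]
  exact DFunLike.congr_fun h P

/-- The times `t_+`, `t'_+` among all times. -/
def plusTimes : ℕ+ ⊕ ℕ+ → Times := Sum.elim tPlus tPlus'

/-- The times `t_-`, `t'_-` among all times. -/
def minusTimes : ℕ+ ⊕ ℕ+ → Times := Sum.elim tMinus tMinus'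

theorem rename_divPow_plus_mul_minus (a a' b b' : ℕ+ →₀ ℕ) :
    MvPolynomial.rename plusTimes (divPow MvPolynomial.X (sumIndex a a')) *
      MvPolynomial.rename minusTimes (divPow MvPolynomial.X (sumIndex b b')) =
        (divPow MvPolynomial.X (sumIndex (sumIndex a b) (sumIndex a' b')) :
          MvPolynomial Times ℂ) := by
  rw [map_divPow, map_divPow]
  simp only [divPow_sum, MvPolynomial.rename_X, plusTimes, minusTimes, Sum.elim_inl,
    Sum.elim_inr, tPlus, tMinus, tPlus', tMinus']
  ring

theorem negVars_rename {σ τ : Type} (f : σ → τ) (P : MvPolynomial σ ℂ) :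
    negVars (MvPolynomial.rename f P) = MvPolynomial.rename f (negVars P) := by
  have h : negVars.comp (MvPolynomial.rename (R := ℂ) f) =
      (MvPolynomial.rename f).comp negVars := by
    refine MvPolynomial.algHom_ext fun i => ?_
    simp [negVars_X]
  exact DFunLike.congr_fun h P

theorem dualPairing_todaTau (G : Operator) (q n n' : ℤ) (P Q : MvPolynomial (ℕ+ ⊕ ℕ+) ℂ) :
    dualPairing (outerProduct (todaTau G q n) (todaTau G q n'))
        (MvPolynomial.rename plusTimes P * MvPolynomial.rename minusTimes Q) =
      G.form₂ (bosonAction₂ P (vac n ⊗ₜ vac n'))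
        (bosonAction₂ (negVars Q) (vac (n - q) ⊗ₜ vac (n' - q))) := by
  have h : ((LinearMap.mul ℂ (MvPolynomial Times ℂ)).compl₁₂
        (MvPolynomial.rename plusTimes).toLinearMap
        (MvPolynomial.rename minusTimes).toLinearMap).compr₂
          (dualPairing (outerProduct (todaTau G q n) (todaTau G q n'))) =
      G.form₂.compl₁₂
        ((LinearMap.applyₗ (R := ℂ) (vac n ⊗ₜ[ℂ] vac n')) ∘ₗ bosonAction₂.toLinearMap)
        ((LinearMap.applyₗ (R := ℂ) (vac (n - q) ⊗ₜ[ℂ] vac (n' - q))) ∘ₗ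
          bosonAction₂.toLinearMap ∘ₗ negVars.toLinearMap) := by
    refine ext_divPow fun d => ext_divPow fun e => ?_
    obtain ⟨a, a', rfl⟩ := exists_sumIndex d
    obtain ⟨b, b', rfl⟩ := exists_sumIndex e
    simp only [LinearMap.compr₂_apply, LinearMap.compl₁₂_apply, LinearMap.mul_apply',
      AlgHom.toLinearMap_apply, LinearMap.comp_apply, LinearMap.applyₗ_apply_apply]
    rw [rename_divPow_plus_mul_minus, dualPairing_divPow, coeff_outerProduct, coeff_todaTau,
      coeff_todaTau, ← rename_divPow_mul a a', ← rename_divPow_mul b b', map_mul negVars,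
      negVars_rename, negVars_rename, bosonAction₂_mul, bosonAction₂_mul, Operator.form₂_tmul]
  exact DFunLike.congr_fun (DFunLike.congr_fun h P) Q

theorem vertexSum_map {A B : Type*} [CommRing A] [Algebra ℂ A] [CommRing B] [Algebra ℂ B]
    (f : A →ₐ[ℂ] B) (c : ℕ+ → A) (N : ℤ) (P : Polynomial A) :
    vertexSum (fun k => f (c k)) N (Polynomial.mapAlgHom f P) = f (vertexSum c N P) := by
  induction P using Polynomial.induction_on' with
  | add P Q hP hQ => rw [map_add, map_add, map_add, map_add, hP, hQ]
  | monomial i b =>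
    rw [Polynomial.mapAlgHom_monomial, vertexSum_monomial, vertexSum_monomial, map_mul, map_hInt]

theorem comm_bosonAction₂ (P : MvPolynomial (ℕ+ ⊕ ℕ+) ℂ) (w : Fock ⊗[ℂ] Fock) :
    TensorProduct.comm ℂ Fock Fock (bosonAction₂ P w) =
      bosonAction₂ (MvPolynomial.rename Sum.swap P) (TensorProduct.comm ℂ Fock Fock w) := by
  induction P using MvPolynomial.induction_on generalizing w with
  | C a =>
    rw [MvPolynomial.rename_C, ← MvPolynomial.algebraMap_eq, AlgHom.commutes,
      Module.algebraMap_end_apply, Module.algebraMap_end_apply, map_smul]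
  | add P Q hP hQ => simp only [map_add, LinearMap.add_apply, hP, hQ]
  | mul_X P i hP =>
    rw [map_mul, map_mul, map_mul, MvPolynomial.rename_X, bosonAction₂_X, bosonAction₂_X,
      Module.End.mul_apply, Module.End.mul_apply, hP]
    congr 1
    induction w using TensorProduct.induction_on with
    | zero => simp
    | add w w' hw hw' => simp only [map_add, hw, hw']
    | tmul u v =>
      rcases i with k | k <;> simp [raising₂]

/-- The operator `∑_K ψ_K ⊗ ψ*_K` in bosonic form, on kets, where the times act with the opposite
sign. -/
theorem coexchange_bosonAction₂ (m m' : ℤ) (Q : MvPolynomial (ℕ+ ⊕ ℕ+) ℂ) :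
    coexchange (bosonAction₂ (negVars Q) (vac m ⊗ₜ vac m')) =
      bosonAction₂ (negVars (vertexSum relativeTime (m' - 1 - m) (pairShift Q)))
        (vac (m + 1) ⊗ₜ vac (m' - 1)) := by
  -- The involution `x ↦ -y`, `y ↦ -x` preserves the relative times and the shift.
  obtain ⟨θ, hθ⟩ : ∃ θ : MvPolynomial (ℕ+ ⊕ ℕ+) ℂ →ₐ[ℂ] MvPolynomial (ℕ+ ⊕ ℕ+) ℂ,
      ∀ P, θ P = MvPolynomial.rename Sum.swap (negVars P) :=
    ⟨(MvPolynomial.rename Sum.swap).comp negVars, fun _ => rfl⟩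
  have h1 : ∀ i, θ (MvPolynomial.X i) = -MvPolynomial.X i.swap := fun i => by
    simp [hθ, negVars_X]
  have h2 : pairShift.comp θ = (Polynomial.mapAlgHom θ).comp pairShift := by
    refine MvPolynomial.algHom_ext fun i => ?_
    rw [AlgHom.comp_apply, AlgHom.comp_apply, h1, map_neg, timeShift_X, timeShift_X, map_add,
      map_smul, map_pow]
    rcases i with k | k <;> simp [h1, add_comm]
  have h3 : (fun k => θ (relativeTime k)) = relativeTime := by
    funext k
    rw [relativeTime, map_smul, map_sub, h1, h1, Sum.swap_inl, Sum.swap_inr, neg_sub_neg]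
  have h4 : MvPolynomial.rename Sum.swap (vertexSum relativeTime (m' - 1 - m) (pairShift (θ Q))) =
      negVars (vertexSum relativeTime (m' - 1 - m) (pairShift Q)) := by
    have h5 := DFunLike.congr_fun h2 Q
    rw [AlgHom.comp_apply, AlgHom.comp_apply] at h5
    rw [h5]
    conv_lhs => rw [← h3]
    rw [vertexSum_map, hθ, MvPolynomial.rename_rename]
    simp
  rw [coexchange, LinearMap.comp_apply, LinearMap.comp_apply, LinearEquiv.coe_coe,
    comm_bosonAction₂, TensorProduct.comm_tmul]
  rw [← hθ, exchange_bosonAction₂, comm_bosonAction₂, TensorProduct.comm_tmul, add_zero, h4]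

/-- The bilinear identity of the 2DTL hierarchy, as an identity of functionals. The two sides are
the two ways of applying `∑_K ψ_K ⊗ ψ*_K`: to the bras of charges `n + 1`, `n' - 1` and to the kets
of charges `n - q`, `n' - q`. -/
theorem GroupLike.todaTau_bilinear {G : Operator} (hG : GroupLike G) (q n n' : ℤ)
    (P Q : MvPolynomial (ℕ+ ⊕ ℕ+) ℂ) :
    dualPairing (outerProduct (todaTau G q n) (todaTau G q n'))
        (MvPolynomial.rename plusTimes (vertexSum relativeTime (1 + (n - n')) (pairShift P)) *
          MvPolynomial.rename minusTimes Q) =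
      dualPairing (outerProduct (todaTau G q (n + 1)) (todaTau G q (n' - 1)))
        (MvPolynomial.rename plusTimes P * MvPolynomial.rename minusTimes
          (vertexSum relativeTime (-1 - (n - n')) (pairShift Q))) := by
  rw [dualPairing_todaTau, dualPairing_todaTau]
  have h1 := exchange_bosonAction₂ 0 (n + 1) (n' - 1) P
  rw [show n + 1 - 1 - (n' - 1) + 0 = 1 + (n - n') by ring, add_sub_cancel_right,
    sub_add_cancel] at h1
  have h2 := coexchange_bosonAction₂ (n - q) (n' - q) Q
  rw [show n' - q - 1 - (n - q) = -1 - (n - n') by ring, show n - q + 1 = n + 1 - q by ring,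
    show n' - q - 1 = n' - 1 - q by ring] at h2
  rw [← h1, hG.form₂_exchange, h2]

/-- The bilinear identity of the MKP hierarchy, as an identity of functionals: for `n' ≤ n` the
operator `∑_K ψ_K ⊗ ψ*_K` annihilates `|n - q⟩ ⊗ |n' - q⟩`. -/
theorem GroupLike.mkpTau_bilinear {G : Operator} (hG : GroupLike G) (q : ℤ) {n n' : ℤ}
    (h : n' ≤ n) (P : MvPolynomial (ℕ+ ⊕ ℕ+) ℂ) :
    dualPairing (outerProduct (mkpTau G q n) (mkpTau G q n'))
      (vertexSum relativeTime (1 + (n - n')) (pairShift P)) = 0 := by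
  rw [dualPairing_mkpTau]
  have h1 := exchange_bosonAction₂ 0 (n + 1) (n' - 1) P
  rw [show n + 1 - 1 - (n' - 1) + 0 = 1 + (n - n') by ring, add_sub_cancel_right,
    sub_add_cancel] at h1
  rw [← h1, hG.form₂_exchange, coexchange, LinearMap.comp_apply, LinearMap.comp_apply,
    LinearEquiv.coe_coe, TensorProduct.comm_tmul, exchange_vac, hInt_of_neg _ (by omega), map_zero,
    LinearMap.zero_apply, map_zero, map_zero]

end Tau

/-! ### The bilinear identities -/

section BilinearIdentities

theorem zZero_zpow (m : ℤ) : zZero ^ m = HahnSeries.single m 1 :=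
  (RatFunc.single_zpow m).symm

theorem zZero_inv : zZero⁻¹ = HahnSeries.single (-1) 1 := by
  rw [zZero, HahnSeries.inv_single, inv_one]

theorem zInfty_zpow (m : ℤ) : zInfty ^ m = HahnSeries.single (-m) 1 := by
  rw [zInfty, ← zZero_inv, inv_zpow', zZero_zpow]

theorem single_zero_one_mul (x : LaurentSeries ℂ) : HahnSeries.single (0 : ℤ) (1 : ℂ) * x = x :=
  one_mul x

theorem single_zero_neg_one_mul (x : LaurentSeries ℂ) :
    HahnSeries.single (0 : ℤ) (-1 : ℂ) * x = -x := by
  ext n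
  rw [HahnSeries.coeff_single_mul, sub_zero, HahnSeries.coeff_neg, neg_one_mul]

theorem single_zero_zero_mul (x : LaurentSeries ℂ) :
    HahnSeries.single (0 : ℤ) (0 : ℂ) * x = 0 := by
  rw [HahnSeries.single_eq_zero, zero_mul]

theorem mem_pair_iff (k : ℕ+) (i : ℕ+ ⊕ ℕ+) :
    i ∈ ({Sum.inl k, Sum.inr k} : Finset (ℕ+ ⊕ ℕ+)) ↔ (Sum.elim id id i : ℕ+) = k := by
  rcases i with i | i <;> simp

theorem weightForm_pair : weightForm (fun k => {Sum.inl k, Sum.inr k})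
    (Sum.elim (fun k : ℕ+ => -1 / ((k : ℕ) : ℂ)) fun k : ℕ+ => 1 / ((k : ℕ) : ℂ)) =
      relativeTime := by
  funext k
  rw [weightForm, Finset.sum_pair (by simp), relativeTime, smul_sub, Sum.elim_inl, Sum.elim_inr,
    neg_div, one_div, neg_smul, neg_add_eq_sub]

/-- The residues of the MKP hierarchy as functionals. -/
theorem coeff_mkpInfty (m : ℤ) (f g : MvPowerSeries ℕ+ ℂ) (d : ℕ+ ⊕ ℕ+ →₀ ℕ) :
    MvPowerSeries.coeff d (mkpInfty m f g) = dualPairing (outerProduct f g)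
      (vertexSum relativeTime (1 + m) (pairShift (divPow MvPolynomial.X d))) := by
  have hs := subst_outerProduct (hasSubst_shiftedTime (Sum.elim (fun k : ℕ+ => -1 / ((k : ℕ) : ℂ))
    fun k : ℕ+ => 1 / ((k : ℕ) : ℂ)) mem_pair_iff) f g
  have h := coeff_laurentCoeff (Sum.elim (fun k : ℕ+ => -1 / ((k : ℕ) : ℂ))
    fun k : ℕ+ => 1 / ((k : ℕ) : ℂ)) (Sum.elim 1 (-1)) mem_pair_iff (outerProduct f g) d (-m) 1
    (κ := Sum.elim (fun k : ℕ+ => zInfty ^ (k : ℕ)) (fun k : ℕ+ => -zInfty ^ (k : ℕ))) (by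
      rintro (k | k)
      · exact (single_zero_one_mul _).symm
      · exact (single_zero_neg_one_mul _).symm)
  rw [hs, weightForm_pair, sub_neg_eq_add, ← zInfty_zpow] at h
  exact h

theorem mem_quadruple_iff (k : ℕ+) (i : Times) :
    i ∈ ({tPlus k, tPlus' k, tMinus k, tMinus' k} : Finset Times) ↔
      Sum.elim (Sum.elim id id) (Sum.elim id id) i = k := by
  rcases i with (i | i) | (i | i) <;> simp [tPlus, tPlus', tMinus, tMinus']

/-- If only one half `p` of the times is shifted, the other half `s` is inert. -/
theorem vertexSum_timeShift_rename_mul {η : Times → ℂ} {g : Times → ℕ+}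
    {p s : ℕ+ ⊕ ℕ+ → Times} (hp : ∀ i, η (p i) = Sum.elim (1 : ℕ+ → ℂ) (-1) i)
    (hg : ∀ i, g (p i) = Sum.elim id id i) (hs : ∀ i, η (s i) = 0) (N : ℤ)
    (P Q : MvPolynomial (ℕ+ ⊕ ℕ+) ℂ) :
    vertexSum (fun k => MvPolynomial.rename p (relativeTime k)) N
        (timeShift η g (MvPolynomial.rename p P * MvPolynomial.rename s Q)) =
      MvPolynomial.rename p (vertexSum relativeTime N (pairShift P)) *
        MvPolynomial.rename s Q := by
  have h1 : (timeShift η g).comp (MvPolynomial.rename p) =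
      (Polynomial.mapAlgHom (MvPolynomial.rename p)).comp pairShift := by
    refine MvPolynomial.algHom_ext fun i => ?_
    rcases i with i | i <;> simp [timeShift_X, hp, hg]
  have h2 : (timeShift η g).comp (MvPolynomial.rename s) =
      Polynomial.CAlgHom.comp (MvPolynomial.rename s) := by
    refine MvPolynomial.algHom_ext fun i => ?_
    simp [timeShift_X, hs]
  have h3 : timeShift η g (MvPolynomial.rename p P) =
      Polynomial.mapAlgHom (MvPolynomial.rename p) (pairShift P) := DFunLike.congr_fun h1 P
  have h4 : timeShift η g (MvPolynomial.rename s Q) = Polynomial.C (MvPolynomial.rename s Q) :=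
    DFunLike.congr_fun h2 Q
  rw [map_mul, h3, h4, mul_comm, vertexSum_C_mul, vertexSum_map, mul_comm]

/-- The residues at infinity of the 2DTL hierarchy as functionals. -/
theorem coeff_todaInfty (m : ℤ) (f g : MvPowerSeries (ℕ+ ⊕ ℕ+) ℂ) (a a' b b' : ℕ+ →₀ ℕ) :
    MvPowerSeries.coeff (sumIndex (sumIndex a b) (sumIndex a' b')) (todaInfty m f g) =
      dualPairing (outerProduct f g)
        (MvPolynomial.rename plusTimes (vertexSum relativeTime (1 + m)
          (pairShift (divPow MvPolynomial.X (sumIndex a a')))) *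
            MvPolynomial.rename minusTimes (divPow MvPolynomial.X (sumIndex b b'))) := by
  let c : Times → ℂ := Sum.elim (Sum.elim (fun k : ℕ+ => -1 / ((k : ℕ) : ℂ)) 0)
    (Sum.elim (fun k : ℕ+ => 1 / ((k : ℕ) : ℂ)) 0)
  let η : Times → ℂ := Sum.elim (Sum.elim 1 0) (Sum.elim (-1) 0)
  have hs := subst_outerProduct (hasSubst_shiftedTime c mem_quadruple_iff) f g
  have e1 : (fun i => shiftedTime c (Sum.elim (Sum.elim id id) (Sum.elim id id)) (Sum.inl i)) =
      Sum.elim (shift (-1) tPlus) (noShift tMinus) := by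
    funext i
    rcases i with k | k
    · rfl
    · simp [c, shiftedTime, noShift, tMinus]
  have e2 : (fun i => shiftedTime c (Sum.elim (Sum.elim id id) (Sum.elim id id)) (Sum.inr i)) =
      Sum.elim (shift 1 tPlus') (noShift tMinus') := by
    funext i
    rcases i with k | k
    · rfl
    · simp [c, shiftedTime, noShift, tMinus']
  have e3 : weightForm (fun k => {tPlus k, tPlus' k, tMinus k, tMinus' k}) c =
      fun k => MvPolynomial.rename plusTimes (relativeTime k) := by
    funext k
    rw [weightForm, Finset.sum_insert (by simp [tPlus, tPlus', tMinus, tMinus']),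
      Finset.sum_insert (by simp [tPlus', tMinus, tMinus']),
      Finset.sum_pair (by simp [tMinus, tMinus'])]
    simp [c, relativeTime, plusTimes, tPlus, tPlus', tMinus, tMinus', smul_sub, neg_div]
    abel
  have h := coeff_laurentCoeff c η mem_quadruple_iff (outerProduct f g)
    (sumIndex (sumIndex a b) (sumIndex a' b')) (-m) 1
    (κ := Sum.elim (Sum.elim (fun k => zInfty ^ (k : ℕ)) 0)
      (Sum.elim (fun k => -zInfty ^ (k : ℕ)) 0)) (by
      rintro ((k | k) | (k | k))
      · exact (single_zero_one_mul _).symm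
      · exact (single_zero_zero_mul _).symm
      · exact (single_zero_neg_one_mul _).symm
      · exact (single_zero_zero_mul _).symm)
  rw [hs, e1, e2, e3, sub_neg_eq_add, ← zInfty_zpow, ← rename_divPow_plus_mul_minus,
    vertexSum_timeShift_rename_mul] at h
  · exact h
  · rintro (k | k) <;> rfl
  · rintro (k | k) <;> rfl
  · rintro (k | k) <;> rfl

/-- The shift `t_{-k} ↦ t_{-k} + w^k`, `t'_{-k} ↦ t'_{-k} - w^k` of the negative times. -/
abbrev minusShift : MvPolynomial Times ℂ →ₐ[ℂ] Polynomial (MvPolynomial Times ℂ) :=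
  timeShift (Sum.elim (Sum.elim 0 1) (Sum.elim 0 (-1))) (Sum.elim (Sum.elim id id) (Sum.elim id id))

/-- The residues at zero of the 2DTL hierarchy as functionals. -/
theorem coeff_todaZero (m : ℤ) (f g : MvPowerSeries (ℕ+ ⊕ ℕ+) ℂ) (d : Times →₀ ℕ) :
    MvPowerSeries.coeff d (todaZero m f g) = dualPairing (outerProduct f g)
      (vertexSum (fun k => MvPolynomial.rename minusTimes (relativeTime k)) (-1 - m)
        (minusShift (divPow MvPolynomial.X d))) := by
  let c : Times → ℂ := Sum.elim (Sum.elim 0 (fun k : ℕ+ => -1 / ((k : ℕ) : ℂ)))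
    (Sum.elim 0 (fun k : ℕ+ => 1 / ((k : ℕ) : ℂ)))
  have hs := subst_outerProduct (hasSubst_shiftedTime c mem_quadruple_iff) f g
  have e1 : (fun i => shiftedTime c (Sum.elim (Sum.elim id id) (Sum.elim id id)) (Sum.inl i)) =
      Sum.elim (noShift tPlus) (shift (-1) tMinus) := by
    funext i
    rcases i with k | k
    · simp [c, shiftedTime, noShift, tPlus]
    · rfl
  have e2 : (fun i => shiftedTime c (Sum.elim (Sum.elim id id) (Sum.elim id id)) (Sum.inr i)) =
      Sum.elim (noShift tPlus') (shift 1 tMinus') := by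
    funext i
    rcases i with k | k
    · simp [c, shiftedTime, noShift, tPlus']
    · rfl
  have e3 : weightForm (fun k => {tPlus k, tPlus' k, tMinus k, tMinus' k}) c =
      fun k => MvPolynomial.rename minusTimes (relativeTime k) := by
    funext k
    rw [weightForm, Finset.sum_insert (by simp [tPlus, tPlus', tMinus, tMinus']),
      Finset.sum_insert (by simp [tPlus', tMinus, tMinus']),
      Finset.sum_pair (by simp [tMinus, tMinus'])]
    simp [c, relativeTime, minusTimes, tPlus, tPlus', tMinus, tMinus', smul_sub, neg_div]
    abel
  have h := coeff_laurentCoeff c (Sum.elim (Sum.elim 0 1) (Sum.elim 0 (-1))) mem_quadruple_iff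
    (outerProduct f g) d m (-1)
    (κ := Sum.elim (Sum.elim 0 (fun k => zZero⁻¹ ^ (k : ℕ)))
      (Sum.elim 0 (fun k => -zZero⁻¹ ^ (k : ℕ)))) (by
      rw [zZero_inv]
      rintro ((k | k) | (k | k))
      · exact (single_zero_zero_mul _).symm
      · exact (single_zero_one_mul _).symm
      · exact (single_zero_zero_mul _).symm
      · exact (single_zero_neg_one_mul _).symm)
  rw [hs, e1, e2, e3, ← zZero_zpow] at h
  exact h

/-- The bilinear identity of the 2DTL hierarchy. -/
theorem GroupLike.todaInfty_eq_todaZero {G : Operator} (hG : GroupLike G) (q n n' : ℤ) :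
    todaInfty (n - n') (todaTau G q n) (todaTau G q n') =
      todaZero (n - n') (todaTau G q (n + 1)) (todaTau G q (n' - 1)) := by
  ext d
  obtain ⟨d1, d2, rfl⟩ := exists_sumIndex d
  obtain ⟨a, b, rfl⟩ := exists_sumIndex d1
  obtain ⟨a', b', rfl⟩ := exists_sumIndex d2
  rw [coeff_todaInfty, hG.todaTau_bilinear, coeff_todaZero, ← rename_divPow_plus_mul_minus,
    mul_comm (MvPolynomial.rename plusTimes (divPow MvPolynomial.X (sumIndex a a')))
      (MvPolynomial.rename minusTimes (divPow MvPolynomial.X (sumIndex b b'))),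
    mul_comm (MvPolynomial.rename plusTimes (divPow MvPolynomial.X (sumIndex a a'))), minusShift,
    vertexSum_timeShift_rename_mul (p := minusTimes)]
  · rintro (k | k) <;> rfl
  · rintro (k | k) <;> rfl
  · rintro (k | k) <;> rfl

/-- The bilinear identity of the MKP hierarchy. -/
theorem GroupLike.mkpInfty_eq_zero {G : Operator} (hG : GroupLike G) (q : ℤ) {n n' : ℤ}
    (h : n' ≤ n) : mkpInfty (n - n') (mkpTau G q n) (mkpTau G q n') = 0 := by
  ext d
  rw [coeff_mkpInfty, hG.mkpTau_bilinear q h, map_zero]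

variable {σ τ : Type}

theorem hasSubst_X_comp_of_fiber {π : σ → τ} {fib : τ → Finset σ}
    (hfib : ∀ j i, i ∈ fib j ↔ π i = j) :
    MvPowerSeries.HasSubst fun i => (MvPowerSeries.X (π i) : MvPowerSeries τ ℂ) where
  const_coeff i := by simp
  coeff_zero d := by
    classical
    by_cases hd : ∃ j, d = Finsupp.single j 1
    · obtain ⟨j, rfl⟩ := hd
      refine (fib j).finite_toSet.subset fun i hi => ?_
      rw [Finset.mem_coe, hfib]
      by_contra hne
      refine hi ?_
      rw [MvPowerSeries.coeff_X, if_neg]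
      exact fun h => hne ((Finsupp.single_left_inj one_ne_zero).1 h).symm
    · refine Set.finite_empty.subset fun i hi => hi ?_
      rw [MvPowerSeries.coeff_X, if_neg]
      exact fun h => hd ⟨_, h⟩

theorem mapDomain_apply_eq_sum_fiber [DecidableEq τ] {π : σ → τ} {fib : τ → Finset σ}
    (hfib : ∀ j i, i ∈ fib j ↔ π i = j) (d : σ →₀ ℕ) (j : τ) :
    d.mapDomain π j = ∑ i ∈ fib j, d i := by
  classical
  rw [Finsupp.mapDomain, Finsupp.sum_apply, Finsupp.sum]
  simp only [Finsupp.single_apply]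
  rw [← Finset.sum_filter, ← Finset.sum_filter_ne_zero (s := fib j)]
  refine Finset.sum_congr ?_ fun _ _ => rfl
  ext i
  rw [Finset.mem_filter, Finset.mem_filter, Finsupp.mem_support_iff, hfib]
  exact and_comm

/-- The identification of variables along `π` is dual to the summation over the fibres of `π`. -/
theorem coeff_divPow_sum_fiber [DecidableEq σ] [DecidableEq τ] {π : σ → τ} {fib : τ → Finset σ}
    (hfib : ∀ j i, i ∈ fib j ↔ π i = j) (e : τ →₀ ℕ) (d : σ →₀ ℕ) :
    MvPolynomial.coeff d (divPow (fun j => ∑ i ∈ fib j, MvPolynomial.X (R := ℂ) i) e) =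
      if d.mapDomain π = e then divPow 1 d else 0 := by
  induction e using finsupp_single_induction generalizing d with
  | h0 =>
    rw [divPow_zero, MvPolynomial.coeff_one]
    by_cases h : 0 = d
    · rw [if_pos h, ← h, Finsupp.mapDomain_zero, if_pos rfl, divPow_zero]
    · rw [if_neg h, if_neg]
      intro h0
      refine h (Finsupp.ext fun i => ?_)
      have h1 := mapDomain_apply_eq_sum_fiber hfib d (π i)
      rw [h0, Finsupp.zero_apply] at h1
      exact ((Finset.sum_eq_zero_iff.1 h1.symm) i ((hfib _ _).2 rfl)).symm
  | hs e j ih =>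
    apply nsmul_right_injective' (n := e j)
    rw [← MvPolynomial.coeff_smul, divPow_add_single, mul_comm, Finset.mul_sum,
      MvPolynomial.coeff_sum]
    have h1 : ∀ i ∈ fib j, MvPolynomial.coeff d
        (divPow (fun j => ∑ i ∈ fib j, MvPolynomial.X (R := ℂ) i) e * MvPolynomial.X i) =
        if d.mapDomain π = e + Finsupp.single j 1 then (d i : ℂ) * divPow 1 d else 0 := by
      intro i hi
      have h2 := nsmul_divPow_sub_single 1 d i
      rw [Pi.one_apply, mul_one] at h2
      rw [MvPolynomial.coeff_mul_X', ← h2]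
      split_ifs with h3 h4 h4
      · rw [ih, if_pos]
        have h5 := Finsupp.sub_add_single_one_cancel (Finsupp.mem_support_iff.1 h3)
        rw [← h5, Finsupp.mapDomain_add, Finsupp.mapDomain_single, (hfib _ _).1 hi] at h4
        exact add_right_cancel h4
      · rw [ih, if_neg]
        intro h6
        have h5 := Finsupp.sub_add_single_one_cancel (Finsupp.mem_support_iff.1 h3)
        rw [← h5, Finsupp.mapDomain_add, Finsupp.mapDomain_single, (hfib _ _).1 hi, h6] at h4
        exact h4 rfl
      · rfl
      · rfl
    rw [Finset.sum_congr rfl h1]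
    split_ifs with h
    · have h2 := mapDomain_apply_eq_sum_fiber hfib d j
      rw [h, Finsupp.add_apply, Finsupp.single_eq_same] at h2
      rw [← Finset.sum_mul, ← Nat.cast_sum, ← h2, nsmul_eq_mul]
    · simp

/-- The power series obtained by identifying variables along `π`, in terms of the functional
given by `F`. -/
theorem coeff_subst_X_comp {π : σ → τ} {fib : τ → Finset σ}
    (hfib : ∀ j i, i ∈ fib j ↔ π i = j) (F : MvPowerSeries σ ℂ) (e : τ →₀ ℕ) :
    MvPowerSeries.coeff e (F.subst fun i => (MvPowerSeries.X (π i) : MvPowerSeries τ ℂ)) =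
      dualPairing F (divPow (fun j => ∑ i ∈ fib j, MvPolynomial.X (R := ℂ) i) e) := by
  classical
  refine coeff_subst_eq_dualPairing (hasSubst_X_comp_of_fiber hfib) F e _ fun d => ?_
  rw [coeff_divPow_sum_fiber hfib, divPow_X_comp, MvPowerSeries.coeff_monomial, divPow]
  simp [eq_comm]

/-- At `t'_- = t_-` the exponential factor cancels, and for `0 ≤ m` a power series in `z` without a
residue at `z = 0` is left. -/
theorem equateMinus_todaZero {m : ℤ} (hm : 0 ≤ m) (f g : MvPowerSeries (ℕ+ ⊕ ℕ+) ℂ) :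
    equateMinus (todaZero m f g) = 0 := by
  let π : Times → (ℕ+ ⊕ ℕ+) ⊕ ℕ+ :=
    Sum.elim (Sum.elim (fun k => Sum.inl (Sum.inl k)) Sum.inr)
      (Sum.elim (fun k => Sum.inl (Sum.inr k)) Sum.inr)
  let fib : (ℕ+ ⊕ ℕ+) ⊕ ℕ+ → Finset Times :=
    Sum.elim (Sum.elim (fun k => {tPlus k}) fun k => {tPlus' k}) fun k => {tMinus k, tMinus' k}
  have hfib : ∀ j i, i ∈ fib j ↔ π i = j := by
    rintro ((j | j) | j) ((i | i) | (i | i)) <;>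
      simp [fib, π, tPlus, tPlus', tMinus, tMinus']
  have hπ : equateMinus (todaZero m f g) =
      (todaZero m f g).subst fun i => (MvPowerSeries.X (π i) :
        MvPowerSeries ((ℕ+ ⊕ ℕ+) ⊕ ℕ+) ℂ) := by
    rw [equateMinus]
    congr 1
    funext i
    rcases i with (i | i) | (i | i) <;> rfl
  have hL : dualPairing (todaZero m f g) = dualPairing (outerProduct f g) ∘ₗ
      vertexSum (fun k => MvPolynomial.rename minusTimes (relativeTime k)) (-1 - m) ∘ₗ
        minusShift.toLinearMap := dualPairing_eq (coeff_todaZero m f g)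
  ext e
  rw [hπ, coeff_subst_X_comp hfib, hL, LinearMap.comp_apply, LinearMap.comp_apply,
    AlgHom.toLinearMap_apply]
  -- `t_{-k} + t'_{-k}` is invariant under the shift
  have h1 : ∀ j, minusShift (∑ i ∈ fib j, MvPolynomial.X (R := ℂ) i) =
      Polynomial.CAlgHom (R := ℂ) (∑ i ∈ fib j, MvPolynomial.X (R := ℂ) i) := by
    rintro ((j | j) | j)
    · simp [fib, timeShift_X, tPlus]
    · simp [fib, timeShift_X, tPlus']
    · simp only [fib, Sum.elim_inr]
      rw [Finset.sum_pair (by simp [tMinus, tMinus'])]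
      simp [timeShift_X, tMinus, tMinus']
      abel
  rw [map_divPow]
  simp only [h1]
  rw [← map_divPow, Polynomial.CAlgHom_apply, ← Polynomial.monomial_zero_left, vertexSum_monomial,
    hInt_of_neg _ (by omega), mul_zero, map_zero, map_zero]

end BilinearIdentities

/-! ### Hirota equations -/

section Hirota

variable {σ : Type}

theorem divPow_const_smul {R : Type*} [CommRing R] [Algebra ℂ R] (ε : ℂ) (c : σ → R)
    (b : σ →₀ ℕ) : divPow (fun i => ε • c i) b = ε ^ b.degree • divPow c b := by
  symm
  refine eq_divPow (F := fun b => ε ^ b.degree • divPow c b) ?_ (fun d i => ?_) b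
  · simp [divPow_zero]
  · rw [map_add, Finsupp.degree_single, pow_succ, smul_comm, divPow_add_single]
    simp only [mul_smul, smul_mul_assoc, mul_smul_comm]

theorem hasSubst_inl_add_smul_inr (ε : ℂ) : MvPowerSeries.HasSubst fun i : σ =>
    (MvPowerSeries.X (Sum.inl i) + ε • MvPowerSeries.X (Sum.inr i) :
      MvPowerSeries (σ ⊕ σ) ℂ) := by
  have h1 := hasSubst_X_comp (Sum.inl_injective (α := σ) (β := σ))
  have h2 := (hasSubst_X_comp (Sum.inr_injective (α := σ) (β := σ))).smul (MvPowerSeries.C ε)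
  have h3 : (fun i : σ => ε • (MvPowerSeries.X (Sum.inr i) : MvPowerSeries (σ ⊕ σ) ℂ)) =
      (MvPowerSeries.C ε : MvPowerSeries (σ ⊕ σ) ℂ) • fun i => MvPowerSeries.X (Sum.inr i) :=
    funext fun i => by rw [Pi.smul_apply, smul_eq_mul, MvPowerSeries.smul_eq_C_mul]
  rw [← h3] at h2
  exact h1.add h2

/-- The translation `f(t + ε X)` on functionals. -/
theorem coeff_subst_inl_add_smul_inr (ε : ℂ) (f : MvPowerSeries σ ℂ) (a b : σ →₀ ℕ) :
    MvPowerSeries.coeff (sumIndex a b) (f.subst fun i : σ =>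
      (MvPowerSeries.X (Sum.inl i) + ε • MvPowerSeries.X (Sum.inr i) :
        MvPowerSeries (σ ⊕ σ) ℂ)) =
      dualPairing f (divPow MvPolynomial.X a * divPow (fun i => ε • MvPolynomial.X i) b) := by
  classical
  refine coeff_subst_eq_dualPairing (hasSubst_inl_add_smul_inr ε) f _ _ fun d => ?_
  have h : (fun i : σ => (MvPowerSeries.X (Sum.inl i) + ε • MvPowerSeries.X (Sum.inr i) :
      MvPowerSeries (σ ⊕ σ) ℂ)) = (fun i => MvPowerSeries.X (Sum.inl i)) +
        fun i => ε • MvPowerSeries.X (Sum.inr i) := rfl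
  rw [h, divPow_add, map_sum]
  simp only [divPow_const_smul]
  have h1 : ∀ p : (σ →₀ ℕ) × (σ →₀ ℕ), MvPowerSeries.coeff (sumIndex a b)
      (divPow (fun i => (MvPowerSeries.X (Sum.inl i) : MvPowerSeries (σ ⊕ σ) ℂ)) p.1 *
        ε ^ p.2.degree • divPow (fun i => MvPowerSeries.X (Sum.inr i)) p.2) =
      if p = (a, b) then ε ^ b.degree * ((multiFactorial a)⁻¹ * (multiFactorial b)⁻¹) else 0 := by
    intro p
    rw [divPow_X_comp, divPow_X_comp, mapDomain_inl, mapDomain_inr, mul_smul_comm,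
      MvPowerSeries.monomial_mul_monomial, sumIndex_add, zero_add, add_zero,
      MvPowerSeries.coeff_smul, MvPowerSeries.coeff_monomial]
    have hiff : sumIndex a b = sumIndex p.1 p.2 ↔ p = (a, b) := by
      rw [sumIndex_inj, Prod.ext_iff, eq_comm, eq_comm (a := b)]
    simp only [hiff]
    split_ifs with hp
    · rw [hp]
    · rw [mul_zero]
  simp only [h1]
  rw [Finset.sum_ite_eq', mul_smul_comm, divPow_X, divPow_X, MvPolynomial.monomial_mul,
    MvPolynomial.coeff_smul, MvPolynomial.coeff_monomial]
  simp only [mem_antidiagonal, smul_eq_mul, mul_ite, mul_zero]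

/-- The sums `x_i + y_i` of two sets of variables. -/
def sumVar (i : σ) : MvPolynomial (σ ⊕ σ) ℂ :=
  MvPolynomial.X (Sum.inl i) + MvPolynomial.X (Sum.inr i)

/-- The differences `x_i - y_i` of two sets of variables. -/
def diffVar (i : σ) : MvPolynomial (σ ⊕ σ) ℂ :=
  MvPolynomial.X (Sum.inl i) - MvPolynomial.X (Sum.inr i)

theorem divPow_sumVar [DecidableEq σ] (d : σ →₀ ℕ) : divPow sumVar d =
    ∑ p ∈ antidiagonal d, MvPolynomial.rename Sum.inl (divPow MvPolynomial.X p.1) *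
      (MvPolynomial.rename Sum.inr (divPow MvPolynomial.X p.2) : MvPolynomial (σ ⊕ σ) ℂ) := by
  have h : (sumVar : σ → MvPolynomial (σ ⊕ σ) ℂ) = (fun i => MvPolynomial.X (Sum.inl i)) +
      fun i => MvPolynomial.X (Sum.inr i) := rfl
  rw [h, divPow_add]
  refine Finset.sum_congr rfl fun p _ => ?_
  rw [map_divPow, map_divPow]
  simp only [MvPolynomial.rename_X]

theorem divPow_diffVar [DecidableEq σ] (d : σ →₀ ℕ) : divPow diffVar d =
    ∑ p ∈ antidiagonal d, MvPolynomial.rename Sum.inl (divPow MvPolynomial.X p.1) *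
      (MvPolynomial.rename Sum.inr (divPow (fun i => (-1 : ℂ) • MvPolynomial.X i) p.2) :
        MvPolynomial (σ ⊕ σ) ℂ) := by
  have h : (diffVar : σ → MvPolynomial (σ ⊕ σ) ℂ) = (fun i => MvPolynomial.X (Sum.inl i)) +
      fun i => (-1 : ℂ) • MvPolynomial.X (Sum.inr i) := by
    funext i
    rw [Pi.add_apply, neg_one_smul, diffVar, sub_eq_add_neg]
  rw [h, divPow_add]
  refine Finset.sum_congr rfl fun p _ => ?_
  rw [map_divPow, map_divPow]
  simp only [map_smul, MvPolynomial.rename_X]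

theorem coeff_mul_eq_dualPairing (f g : MvPowerSeries σ ℂ) (d : σ →₀ ℕ) :
    MvPowerSeries.coeff d (f * g) = dualPairing (outerProduct f g) (divPow sumVar d) := by
  classical
  rw [divPow_sumVar, map_sum, MvPowerSeries.coeff_mul]
  refine Finset.sum_congr rfl fun p _ => ?_
  rw [dualPairing_outerProduct, dualPairing_divPow, dualPairing_divPow]

theorem coeff_hirotaProduct (f g : MvPowerSeries σ ℂ) (d α : σ →₀ ℕ) :
    MvPowerSeries.coeff (sumIndex d α) (hirotaProduct f g) =
      dualPairing (outerProduct f g) (divPow sumVar d * divPow diffVar α) := by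
  classical
  have h1 := coeff_subst_inl_add_smul_inr 1 f
  have h2 := coeff_subst_inl_add_smul_inr (-1) g
  simp only [one_smul, neg_one_smul, ← sub_eq_add_neg] at h1 h2
  rw [hirotaProduct, MvPowerSeries.coeff_mul, sum_antidiagonal_sumIndex d α fun e e' =>
    MvPowerSeries.coeff e (f.subst fun i : σ =>
      (MvPowerSeries.X (Sum.inl i) + MvPowerSeries.X (Sum.inr i) : MvPowerSeries (σ ⊕ σ) ℂ)) *
    MvPowerSeries.coeff e' (g.subst fun i : σ =>
      (MvPowerSeries.X (Sum.inl i) - MvPowerSeries.X (Sum.inr i) : MvPowerSeries (σ ⊕ σ) ℂ)),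
    divPow_sumVar, divPow_diffVar, Finset.sum_mul_sum, map_sum]
  refine Finset.sum_congr rfl fun p _ => ?_
  rw [map_sum]
  refine Finset.sum_congr rfl fun r _ => ?_
  rw [h1, h2, ← dualPairing_outerProduct, map_mul (MvPolynomial.rename Sum.inl),
    map_mul (MvPolynomial.rename Sum.inr), mul_mul_mul_comm]
  simp only [neg_one_smul]

/-- Hirota derivatives as functionals of the outer product. -/
theorem coeff_hirota (P : MvPolynomial σ ℂ) (f g : MvPowerSeries σ ℂ) (d : σ →₀ ℕ) :
    MvPowerSeries.coeff d (hirota P f g) = dualPairing (outerProduct f g)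
      (divPow sumVar d * MvPolynomial.aeval diffVar P) := by
  conv_rhs => rw [P.as_sum, map_sum, Finset.mul_sum, map_sum]
  change (∑ α ∈ P.support, P.coeff α * multiFactorial α *
    MvPowerSeries.coeff (sumIndex d α) (hirotaProduct f g)) = _
  refine Finset.sum_congr rfl fun α _ => ?_
  have h : MvPolynomial.monomial α (P.coeff α) =
      (P.coeff α * multiFactorial α) • divPow MvPolynomial.X α := by
    rw [divPow_X, MvPolynomial.smul_monomial, smul_eq_mul, mul_assoc,
      mul_inv_cancel₀ (multiFactorial_ne_zero α), mul_one]
  rw [h, map_smul, map_divPow, mul_smul_comm, map_smul, coeff_hirotaProduct, smul_eq_mul]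
  simp only [MvPolynomial.aeval_X]

theorem rename_swap_divPow_sumVar (d : σ →₀ ℕ) :
    MvPolynomial.rename Sum.swap (divPow sumVar d) =
      (divPow sumVar d : MvPolynomial (σ ⊕ σ) ℂ) := by
  rw [map_divPow]
  congr 1
  funext i
  simp [sumVar, add_comm]

theorem rename_swap_aeval_diffVar (P : MvPolynomial σ ℂ) :
    MvPolynomial.rename Sum.swap (MvPolynomial.aeval diffVar P) =
      (MvPolynomial.aeval (fun i => -diffVar i) P : MvPolynomial (σ ⊕ σ) ℂ) := by
  have h := MvPolynomial.comp_aeval_apply (R := ℂ) (diffVar : σ → MvPolynomial (σ ⊕ σ) ℂ)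
    (MvPolynomial.rename (R := ℂ) Sum.swap) P
  rw [h]
  congr 2
  funext i
  simp [diffVar]

/-- Odd Hirota derivatives of a power series with itself vanish. -/
theorem hirota_self_eq_zero {P : MvPolynomial σ ℂ} (hP : negVars P = -P) (f : MvPowerSeries σ ℂ) :
    hirota P f f = 0 := by
  ext d
  have h : (MvPolynomial.aeval (fun i => -diffVar i) P : MvPolynomial (σ ⊕ σ) ℂ) =
      -MvPolynomial.aeval diffVar P := by
    have h1 := MvPolynomial.comp_aeval_apply (R := ℂ) (fun i => -MvPolynomial.X i)
      (MvPolynomial.aeval (diffVar : σ → MvPolynomial (σ ⊕ σ) ℂ)) P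
    simp only [map_neg, MvPolynomial.aeval_X] at h1
    rw [← h1, ← map_neg, ← hP, negVars]
  have h2 := dualPairing_outerProduct_swap f f (divPow sumVar d * MvPolynomial.aeval diffVar P)
  rw [map_mul, rename_swap_divPow_sumVar, rename_swap_aeval_diffVar, h, mul_neg, map_neg] at h2
  rw [coeff_hirota, map_zero]
  exact self_eq_neg.1 h2.symm

theorem pairShift_sumVar (k : ℕ+) : pairShift (sumVar k) = Polynomial.C (sumVar k) := by
  simp [sumVar, timeShift_X]
  abel

theorem pairShift_divPow_sumVar (d : ℕ+ →₀ ℕ) :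
    pairShift (divPow sumVar d) = Polynomial.C (divPow sumVar d) := by
  have h := map_divPow (Polynomial.CAlgHom (R := ℂ) (A := MvPolynomial (ℕ+ ⊕ ℕ+) ℂ)) sumVar d
  simp only [Polynomial.CAlgHom_apply] at h
  rw [map_divPow, h]
  simp only [pairShift_sumVar]

theorem pairShift_neg_diffVar (k : ℕ+) : pairShift (-diffVar k) =
    (-2 : ℂ) • Polynomial.X ^ (k : ℕ) + Polynomial.C (-diffVar k) := by
  have h : (-2 : ℂ) • (Polynomial.X ^ (k : ℕ) : Polynomial (MvPolynomial (ℕ+ ⊕ ℕ+) ℂ)) =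
      -Polynomial.X ^ (k : ℕ) - Polynomial.X ^ (k : ℕ) := by
    rw [neg_smul, two_smul]
    abel
  rw [h]
  simp [diffVar, timeShift_X]
  abel

theorem relativeTime_eq (k : ℕ+) : relativeTime k = (((k : ℕ) : ℂ)⁻¹) • -diffVar k := by
  rw [relativeTime, diffVar, neg_sub]

theorem mem_singleton_iff (k i : ℕ+) : i ∈ ({k} : Finset ℕ+) ↔ id i = k := Finset.mem_singleton

theorem coeff_aeval_hPoly (j : ℕ) (b : ℕ+ →₀ ℕ) : MvPowerSeries.coeff b
    (MvPolynomial.aeval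
      (fun l : ℕ+ => (-2 : ℂ) • (MvPowerSeries.X l : MvPowerSeries ℕ+ (MvPolynomial ℕ+ ℂ)))
      (hPoly j)) =
    if Finsupp.weight (fun k : ℕ+ => (k : ℕ)) b = j then
      algebraMap ℂ (MvPolynomial ℕ+ ℂ) (divPow (fun _ => -2) b) else 0 := by
  have h := map_hEval (MvPolynomial.coeToMvPowerSeries.algHom (σ := ℕ+) (R := ℂ)
    (MvPolynomial ℕ+ ℂ)) (weightForm (fun k => {k}) fun _ => -2) j
  have h2 : (fun k => MvPolynomial.coeToMvPowerSeries.algHom (σ := ℕ+) (R := ℂ)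
      (MvPolynomial ℕ+ ℂ) (weightForm (fun k => {k}) (fun _ => -2) k)) =
      fun l : ℕ+ => (-2 : ℂ) • (MvPowerSeries.X l : MvPowerSeries ℕ+ (MvPolynomial ℕ+ ℂ)) := by
    funext k
    rw [weightForm, Finset.sum_singleton, map_smul, MvPolynomial.coeToMvPowerSeries.algHom_apply,
      MvPolynomial.coe_X, MvPowerSeries.map_X]
  rw [h2] at h
  change MvPowerSeries.coeff b (hEval _ j) = _
  rw [← h, MvPolynomial.coeToMvPowerSeries.algHom_apply, MvPowerSeries.coeff_map,
    MvPolynomial.coeff_coe, coeff_hEval_weightForm mem_singleton_iff, apply_ite (algebraMap _ _),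
    map_zero]
  rfl

/-- The times `D̃_k = D_k / k`. -/
def scaledVar (k : ℕ+) : MvPolynomial ℕ+ ℂ := ((k : ℕ) : ℂ)⁻¹ • MvPolynomial.X k

/-- The generating polynomials of the Hirota equations of the KP hierarchy as finite sums. -/
theorem kpHirotaPoly_eq (γ : ℕ+ →₀ ℕ) : kpHirotaPoly γ = ∑ p ∈ antidiagonal γ,
    divPow (fun _ : ℕ+ => (-2 : ℂ)) p.1 • (divPow MvPolynomial.X p.2 *
      hEval scaledVar (Finsupp.weight (fun k : ℕ+ => (k : ℕ)) p.1 + 1)) := by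
  have h : ∀ j, MvPowerSeries.coeff γ
      (MvPolynomial.aeval
          (fun l : ℕ+ => (-2 : ℂ) • (MvPowerSeries.X l : MvPowerSeries ℕ+ (MvPolynomial ℕ+ ℂ)))
          (hPoly j) *
        MvPowerSeries.C (MvPolynomial.aeval
          (fun l : ℕ+ => ((l : ℕ) : ℂ)⁻¹ • (MvPolynomial.X l : MvPolynomial ℕ+ ℂ))
          (hPoly (j + 1))) *
        expSeries (linearForm fun l : ℕ+ => (MvPolynomial.X l : MvPolynomial ℕ+ ℂ))) =
      ∑ p ∈ antidiagonal γ, if j = Finsupp.weight (fun k : ℕ+ => (k : ℕ)) p.1 then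
        divPow (fun _ : ℕ+ => (-2 : ℂ)) p.1 • (divPow MvPolynomial.X p.2 *
          hEval scaledVar (j + 1)) else 0 := by
    intro j
    rw [mul_right_comm, mul_comm _ (MvPowerSeries.C _), MvPowerSeries.coeff_C_mul,
      MvPowerSeries.coeff_mul, Finset.mul_sum]
    refine Finset.sum_congr rfl fun p _ => ?_
    rw [coeff_aeval_hPoly, coeff_expSeries_linearForm]
    simp only [eq_comm (a := j)]
    split_ifs
    · rw [Algebra.smul_def, mul_comm, mul_assoc]
      rfl
    · rw [zero_mul, mul_zero]
  rw [kpHirotaPoly]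
  simp only [h]
  rw [finsum_sum_comm]
  · refine Finset.sum_congr rfl fun p _ => ?_
    rw [finsum_eq_single _ (Finsupp.weight (fun k : ℕ+ => (k : ℕ)) p.1) fun j hj => if_neg hj,
      if_pos rfl]
  · intro p _
    refine (Set.finite_singleton (Finsupp.weight (fun k : ℕ+ => (k : ℕ)) p.1)).subset fun j hj => ?_
    by_contra hne
    exact hj (if_neg hne)

/-- The bilinear identity applied to the products of powers of `x_k + y_k` and `y_k - x_k` produces
the Hirota polynomials of the KP hierarchy. -/
theorem vertexSum_pairShift_divPow (d γ : ℕ+ →₀ ℕ) :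
    vertexSum relativeTime 1 (pairShift (divPow sumVar d * divPow (fun k => -diffVar k) γ)) =
      divPow sumVar d * MvPolynomial.aeval (fun k => -diffVar k) (kpHirotaPoly γ) := by
  have h1 : (fun k => pairShift (-diffVar k)) =
      (fun k : ℕ+ => (-2 : ℂ) • (Polynomial.X : Polynomial (MvPolynomial (ℕ+ ⊕ ℕ+) ℂ)) ^ (k : ℕ)) +
        fun k => Polynomial.C (-diffVar k) := funext pairShift_neg_diffVar
  have h2 := map_divPow (Polynomial.CAlgHom (R := ℂ) (A := MvPolynomial (ℕ+ ⊕ ℕ+) ℂ))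
    fun k => -diffVar k
  simp only [Polynomial.CAlgHom_apply] at h2
  rw [map_mul, pairShift_divPow_sumVar, vertexSum_C_mul, map_divPow, h1, divPow_add, map_sum,
    kpHirotaPoly_eq, map_sum]
  congr 1
  refine Finset.sum_congr rfl fun p _ => ?_
  rw [divPow_smul_pow (fun _ : ℕ+ => (-2 : ℂ)), ← h2, smul_mul_assoc, map_smul, map_smul, mul_comm,
    Polynomial.C_mul_X_pow_eq_monomial, vertexSum_monomial, map_mul, map_divPow, map_hEval,
    add_comm (1 : ℤ), ← Nat.cast_add_one, hInt_natCast]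
  have h3 : (fun k => MvPolynomial.aeval (fun k => -diffVar k) (scaledVar k)) = relativeTime := by
    funext k
    rw [scaledVar, map_smul, MvPolynomial.aeval_X, relativeTime_eq]
  rw [h3]
  simp only [MvPolynomial.aeval_X]

/-- The Hirota equations of the KP hierarchy. -/
theorem GroupLike.hirota_kpHirotaPoly {G : Operator} (hG : GroupLike G) (q n : ℤ) (γ : ℕ+ →₀ ℕ) :
    hirota (kpHirotaPoly γ) (mkpTau G q n) (mkpTau G q n) = 0 := by
  ext d
  have h := hG.mkpTau_bilinear q (le_refl n) (divPow sumVar d * divPow (fun k => -diffVar k) γ)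
  rw [sub_self, add_zero, vertexSum_pairShift_divPow, ← rename_swap_aeval_diffVar,
    ← rename_swap_divPow_sumVar, ← map_mul, dualPairing_outerProduct_swap] at h
  rw [coeff_hirota, h, map_zero]

theorem hEval_one {R : Type*} [CommRing R] [Algebra ℂ R] (c : ℕ+ → R) : hEval c 1 = c 1 := by
  have h := hEval_succ c 0
  rw [Finset.Nat.antidiagonal_zero, Finset.sum_singleton, hEval_zero, zero_add, one_smul,
    one_smul, one_mul] at h
  exact h

theorem two_mul_hEval_two {R : Type*} [CommRing R] [Algebra ℂ R] (c : ℕ+ → R) :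
    2 * hEval c 2 = c 1 ^ 2 + 2 * c 2 := by
  have h := hEval_succ c 1
  rw [Finset.Nat.sum_antidiagonal_eq_sum_range_succ_mk] at h
  simp only [Finset.sum_range_succ, Finset.sum_range_zero, Nat.sub_zero, Nat.sub_self, hEval_zero,
    hEval_one, nsmul_eq_mul] at h
  have e1 : Nat.succPNat 0 = 1 := rfl
  have e2 : Nat.succPNat 1 = 2 := rfl
  rw [e1, e2] at h
  push_cast at h
  linear_combination h

theorem hEval_four {R : Type*} [CommRing R] [Algebra ℂ R] (c : ℕ+ → R) :
    24 * hEval c 4 = c 1 ^ 4 + 12 * c 1 ^ 2 * c 2 + 12 * c 2 ^ 2 + 24 * c 1 * c 3 + 24 * c 4 := by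
  have h2 := two_mul_hEval_two c
  have h3 := hEval_succ c 2
  have h4 := hEval_succ c 3
  rw [Finset.Nat.sum_antidiagonal_eq_sum_range_succ_mk] at h3 h4
  simp only [Finset.sum_range_succ, Finset.sum_range_zero, Nat.sub_zero, Nat.sub_self, hEval_zero,
    hEval_one, nsmul_eq_mul] at h3 h4
  have e1 : Nat.succPNat 0 = 1 := rfl
  have e2 : Nat.succPNat 1 = 2 := rfl
  have e3 : Nat.succPNat 2 = 3 := rfl
  have e4 : Nat.succPNat 3 = 4 := rfl
  simp only [Nat.reduceSub, Nat.reduceAdd, e1, e2, e3, e4] at h3 h4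
  push_cast at h3 h4
  linear_combination 6 * h4 + 2 * c 1 * h3 + (c 1 ^ 2 + 6 * c 2) * h2

theorem hirota_add (P Q : MvPolynomial σ ℂ) (f g : MvPowerSeries σ ℂ) :
    hirota (P + Q) f g = hirota P f g + hirota Q f g := by
  ext d
  rw [map_add, coeff_hirota, coeff_hirota, coeff_hirota, map_add, mul_add, map_add]

theorem hirota_smul (a : ℂ) (P : MvPolynomial σ ℂ) (f g : MvPowerSeries σ ℂ) :
    hirota (a • P) f g = a • hirota P f g := by
  ext d
  rw [MvPowerSeries.coeff_smul, coeff_hirota, coeff_hirota, map_smul, mul_smul_comm, map_smul,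
    smul_eq_mul]

end Hirota

/-! ### The first equations of the hierarchies -/

section FirstEquations

theorem natCast_mul_scaledVar (k : ℕ+) :
    (((k : ℕ) : ℂ) • scaledVar k : MvPolynomial ℕ+ ℂ) = MvPolynomial.X k :=
  smul_inv_smul₀ (Nat.cast_ne_zero.2 k.ne_zero) _

theorem natCast_mul_relativeTime (k : ℕ+) : ((k : ℕ) : ℂ) • relativeTime k = -diffVar k := by
  rw [relativeTime_eq]
  exact smul_inv_smul₀ (Nat.cast_ne_zero.2 k.ne_zero) _

theorem kpHirotaPoly_single_three : kpHirotaPoly (Finsupp.single 3 1) =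
    MvPolynomial.X 1 * MvPolynomial.X 3 - 2 * hEval scaledVar 4 := by
  rw [kpHirotaPoly_eq, Finsupp.antidiagonal_single, Finset.sum_map,
    Finset.Nat.sum_antidiagonal_eq_sum_range_succ_mk]
  have h1 : ∀ {R : Type} [CommRing R] [Algebra ℂ R] (c : ℕ+ → R),
      divPow c (Finsupp.single 3 1) = c 3 := fun c => by
    have h := divPow_add_single c 0 3
    simpa [divPow_zero] using h
  simp [Finset.sum_range_succ, divPow_zero, h1, hEval_one, scaledVar, Finsupp.weight_single]
  rw [two_smul]
  ring

/-- The first Hirota equation of the KP hierarchy. It is the equation of the coefficient of `a_3`,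
up to the odd Hirota derivatives `D_1² D_2` and `D_4`, which vanish on `τ_n · τ_n`. -/
theorem GroupLike.hirota_kp {G : Operator} (hG : GroupLike G) (q n : ℤ) :
    hirota (MvPolynomial.X 1 ^ 4 + 3 * MvPolynomial.X 2 ^ 2 -
        4 * MvPolynomial.X 1 * MvPolynomial.X 3) (mkpTau G q n) (mkpTau G q n) = 0 := by
  have h : (MvPolynomial.X 1 ^ 4 + 3 * MvPolynomial.X 2 ^ 2 -
      4 * MvPolynomial.X 1 * MvPolynomial.X 3 : MvPolynomial ℕ+ ℂ) =
      (-12 : ℂ) • kpHirotaPoly (Finsupp.single 3 1) +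
        (-(6 * MvPolynomial.X 1 ^ 2 * MvPolynomial.X 2 + 6 * MvPolynomial.X 4)) := by
    have h4 := hEval_four scaledVar
    have e1 := natCast_mul_scaledVar 1
    have e2 := natCast_mul_scaledVar 2
    have e3 := natCast_mul_scaledVar 3
    have e4 := natCast_mul_scaledVar 4
    rw [PNat.one_coe, Nat.cast_one, one_smul] at e1
    simp only [PNat.val_ofNat, Nat.cast_ofNat, MvPolynomial.smul_eq_C_mul, map_ofNat] at e2 e3 e4
    rw [kpHirotaPoly_single_three, MvPolynomial.smul_eq_C_mul, map_neg, map_ofNat, ← e1, ← e2,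
      ← e3, ← e4]
    linear_combination -h4
  rw [h, hirota_add, hirota_smul, hG.hirota_kpHirotaPoly, hirota_self_eq_zero, smul_zero, add_zero]
  simp only [map_neg, map_add, map_mul, map_pow, negVars_X, map_ofNat]
  ring

/-- The first Hirota equation of the MKP hierarchy: the bilinear identity for `n + 1` and `n` at
`t' = t`, where only `h_2` of the relative times contributes. -/
theorem GroupLike.hirota_mkp {G : Operator} (hG : GroupLike G) (q n : ℤ) :
    hirota (MvPolynomial.X 1 ^ 2 - MvPolynomial.X 2) (mkpTau G q (n + 1)) (mkpTau G q n) = 0 := by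
  ext d
  have h := hG.mkpTau_bilinear q (show n ≤ n + 1 by omega) (divPow sumVar d)
  have h2 : MvPolynomial.aeval diffVar
      (MvPolynomial.X 1 ^ 2 - MvPolynomial.X 2 : MvPolynomial ℕ+ ℂ) =
        (2 : ℂ) • hEval relativeTime 2 := by
    have e := two_mul_hEval_two relativeTime
    have e1 := natCast_mul_relativeTime 1
    have e2 := natCast_mul_relativeTime 2
    rw [PNat.one_coe, Nat.cast_one, one_smul] at e1
    rw [PNat.val_ofNat, Nat.cast_ofNat, two_smul, ← two_mul] at e2
    rw [two_smul, ← two_mul, e, e1, e2, map_sub, map_pow, MvPolynomial.aeval_X,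
      MvPolynomial.aeval_X]
    ring
  rw [pairShift_divPow_sumVar, ← Polynomial.monomial_zero_left, vertexSum_monomial,
    show 1 + (n + 1 - n) + ((0 : ℕ) : ℤ) = ((2 : ℕ) : ℤ) by push_cast; ring, hInt_natCast] at h
  rw [coeff_hirota, h2, mul_smul_comm, map_smul, h, smul_zero, map_zero]

/-- The first Hirota equation of the 2DTL hierarchy. It results from the bilinear identity for
`n = n'` in the first order in `t_{-1} - t'_{-1}`. -/
theorem GroupLike.hirota_toda {G : Operator} (hG : GroupLike G) (q n : ℤ) :
    (1 / 2 : ℂ) • hirota (MvPolynomial.X (Sum.inl 1) * MvPolynomial.X (Sum.inr 1))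
        (todaTau G q n) (todaTau G q n) + todaTau G q (n + 1) * todaTau G q (n - 1) = 0 := by
  ext d
  obtain ⟨a, b, rfl⟩ := exists_sumIndex d
  -- `x_1 - y_1` extracts the first order in `t_{-1} - t'_{-1}`; the shift translates it by `2 w`
  have h := hG.todaTau_bilinear q n n (divPow sumVar a)
    (divPow sumVar b * ((1 / 2 : ℂ) • diffVar 1))
  have hd : (divPow sumVar (sumIndex a b) : MvPolynomial Times ℂ) =
      MvPolynomial.rename plusTimes (divPow sumVar a) *
        MvPolynomial.rename minusTimes (divPow sumVar b) := by
    rw [divPow_sum, map_divPow, map_divPow]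
    congr 2 <;> funext i <;> simp [sumVar, plusTimes, minusTimes, tPlus, tMinus, tPlus', tMinus']
  have hD : MvPolynomial.aeval (diffVar : ℕ+ ⊕ ℕ+ → MvPolynomial Times ℂ)
      (MvPolynomial.X (Sum.inl 1) * MvPolynomial.X (Sum.inr 1) : MvPolynomial (ℕ+ ⊕ ℕ+) ℂ) =
      MvPolynomial.rename plusTimes (diffVar 1) * MvPolynomial.rename minusTimes (diffVar 1) := by
    simp [diffVar, plusTimes, minusTimes, tPlus, tMinus, tPlus', tMinus']
  have h1 : pairShift (diffVar 1) = (2 : ℂ) • Polynomial.X ^ 1 + Polynomial.C (diffVar 1) := by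
    have e := pairShift_neg_diffVar 1
    rw [map_neg, map_neg, neg_smul, ← neg_add, neg_inj] at e
    exact e
  have h0 : hInt (relativeTime) 0 = 1 := (hInt_natCast relativeTime 0).trans (hEval_zero _)
  have h2 : vertexSum relativeTime (-1 - (n - n))
      (pairShift (divPow sumVar b * ((1 / 2 : ℂ) • diffVar 1))) = divPow sumVar b := by
    rw [map_mul, pairShift_divPow_sumVar, vertexSum_C_mul, map_smul, map_smul, h1, map_add,
      map_smul, ← Polynomial.monomial_zero_left, vertexSum_monomial, ← mul_one (Polynomial.X ^ 1),
      vertexSum_X_pow_mul, ← Polynomial.monomial_zero_one, vertexSum_monomial,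
      hInt_of_neg _ (show -1 - (n - n) + ((0 : ℕ) : ℤ) < 0 by simp),
      show -1 - (n - n) + ((1 : ℕ) : ℤ) + ((0 : ℕ) : ℤ) = 0 by simp, h0, mul_zero, add_zero,
      mul_one, smul_smul]
    norm_num
  have h3 : hInt relativeTime (1 + (n - n)) = -diffVar 1 := by
    rw [sub_self, add_zero]
    refine (hInt_natCast relativeTime 1).trans ((hEval_one _).trans ?_)
    rw [relativeTime_eq, PNat.one_coe, Nat.cast_one, inv_one, one_smul]
  rw [h2, pairShift_divPow_sumVar, ← Polynomial.monomial_zero_left, vertexSum_monomial,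
    Nat.cast_zero, add_zero, h3, ← hd, ← coeff_mul_eq_dualPairing] at h
  rw [map_add, MvPowerSeries.coeff_smul, coeff_hirota, ← h, hD, hd, map_zero]
  have e : MvPolynomial.rename plusTimes (divPow sumVar a * -diffVar 1) *
      MvPolynomial.rename minusTimes (divPow sumVar b * ((1 / 2 : ℂ) • diffVar 1)) =
      (-(1 / 2) : ℂ) • (MvPolynomial.rename plusTimes (divPow sumVar a) *
        MvPolynomial.rename minusTimes (divPow sumVar b) *
        (MvPolynomial.rename plusTimes (diffVar 1) *
          MvPolynomial.rename minusTimes (diffVar 1))) := by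
    rw [map_mul, map_mul, map_neg, map_smul, neg_smul, mul_smul_comm, mul_smul_comm, ← smul_neg]
    congr 1
    ring
  rw [e, map_smul, smul_eq_mul]
  ring

end FirstEquations

end

end FreeFermion

theorem mainTheorem5 (G : Operator) (hG : GroupLike G) (q : ℤ) :
    -- bilinear identity of the 2DTL hierarchy
    (∀ n n' : ℤ,
      todaInfty (n - n') (todaTau G q n) (todaTau G q n') =
        todaZero (n - n') (todaTau G q (n + 1)) (todaTau G q (n' - 1))) ∧
    -- MKP: the specialization `t'_- = t_-`, `n ≥ n'`
    (∀ n n' : ℤ, n' ≤ n →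
      equateMinus (todaInfty (n - n') (todaTau G q n) (todaTau G q n')) = 0) ∧
    (∀ n n' : ℤ, n' ≤ n → mkpInfty (n - n') (mkpTau G q n) (mkpTau G q n') = 0) ∧
    -- KP: the case `n = n'`
    (∀ n : ℤ, mkpInfty 0 (mkpTau G q n) (mkpTau G q n) = 0) ∧
    -- Hirota equations of the KP hierarchy, and the first of them
    (∀ (n : ℤ) (γ : ℕ+ →₀ ℕ), hirota (kpHirotaPoly γ) (mkpTau G q n) (mkpTau G q n) = 0) ∧
    (∀ n : ℤ,
      hirota (MvPolynomial.X 1 ^ 4 + 3 * MvPolynomial.X 2 ^ 2 -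
        4 * MvPolynomial.X 1 * MvPolynomial.X 3) (mkpTau G q n) (mkpTau G q n) = 0) ∧
    -- the first Hirota equation of the MKP hierarchy
    (∀ n : ℤ,
      hirota (MvPolynomial.X 1 ^ 2 - MvPolynomial.X 2) (mkpTau G q (n + 1)) (mkpTau G q n) = 0) ∧
    -- the first Hirota equation of the 2DTL hierarchy
    (∀ n : ℤ,
      (1 / 2 : ℂ) • hirota (MvPolynomial.X (Sum.inl 1) * MvPolynomial.X (Sum.inr 1))
          (todaTau G q n) (todaTau G q n) +
        todaTau G q (n + 1) * todaTau G q (n - 1) = 0) := by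
  refine ⟨hG.todaInfty_eq_todaZero q, fun n n' h => ?_, fun n n' h => hG.mkpInfty_eq_zero q h,
    fun n => ?_, hG.hirota_kpHirotaPoly q, hG.hirota_kp q, hG.hirota_mkp q, hG.hirota_toda q⟩
  · rw [hG.todaInfty_eq_todaZero, equateMinus_todaZero (by omega)]
  · have h := hG.mkpInfty_eq_zero q (le_refl n)
    rwa [sub_self] at h
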